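/- Let $R>0$, let $D_R\subset\mathbb{R}^2$ be the open disk of radius $R$ centred at the origin, and for $B>0$ let $H_B$ be the magnetic Dirichlet Laplacian on $D_R$ with constant field $B$, i.e. the self-adjoint operator in $L^2(D_R)$ given by the closure of the quadratic form $u\mapsto\int_{D_R}|(-i\nabla+A)u|^2\,dx$, $u\in C_0^\infty(D_R)$, with $A(x)=\frac B2(-x_2,x_1)$. Let $$M(a,b,z)=\sum_{k=0}^\infty\frac{(a)_k}{(b)_k\,k!}z^k,\qquad (c)_k=c(c+1)\cdots(c+k-1),$$ be Kummer's function; for $b,z>0$ let $a_1(b,z)>a_2(b,z)>\dots$ denote the real roots of $a\mapsto M(a,b,z)$ in decreasing order, and for $m\in\mathbb{N}=\{1,2,\dots\}$, $l\in\mathbb{Z}$ put $$\lambda_{m,l}(B)=\Bigl(l+|l|+1-2a_m\bigl(|l|+1,\tfrac{BR^2}{2}\bigr)\Bigr)B .$$ Fix $l\in\mathbb{Z}$. For every $B>0$ all the roots $a_m(|l|+1,BR^2/2)$, $m\in\mathbb{N}$, exist, and $\lambda_{1,l}(B)<\lambda_{2,l}(B)<\dots$ are precisely the eigenvalues of $H_B$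 that have an eigenfunction of the form $\psi(r,\varphi)=Z(r)e^{il\varphi}$ in polar coordinates. Moreover, for every fixed $m\in\mathbb{N}$, $$\frac{\lambda_{m,l}(B)}{B}>l+|l|+1+2(m-1)\qquad\text{for all }B>0,$$ and, as $B\to+\infty$, $$\frac{\lambda_{m,l}(B)}{B}-\bigl(l+|l|+1+2(m-1)\bigr)=\frac{2}{\Gamma(|l|+m)\,\Gamma(m)}\left(\frac{BR^2}{2}\right)^{|l|+1+2(m-1)}e^{-BR^2/2}\,\bigl(1+O(B^{-1})\bigr),$$ where the constant in $O(B^{-1})$ may depend on $m$, $l$ and $R$. -/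

import Mathlib

open MeasureTheory Filter Topology Asymptotics
open scoped ContDiff

namespace MagneticDisk

noncomputable section

/-! ### The magnetic Dirichlet Laplacian with constant field

The plane `ℝ²` is identified with `ℂ` through `x = x₁ + i x₂`; smoothness is real smoothness, and
`volume` on `ℂ` is two-dimensional Lebesgue measure. -/

/-- The linear gauge `A(x) = (B/2) (-x₂, x₁)`. -/
def vectorPotential (B : ℝ) (x : ℂ) : Fin 2 → ℝ :=
  ![B / 2 * (-x.im), B / 2 * x.re]

/-- The partial derivative `∂ⱼ u` at `x`. -/
def partialDeriv (j : Fin 2) (u : ℂ → ℂ) (x : ℂ) : ℂ :=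
  fderiv ℝ u x ((![1, Complex.I] : Fin 2 → ℂ) j)

/-- The `j`-th component of `(-i∇ + A) u`. -/
def magneticGradient (B : ℝ) (u : ℂ → ℂ) (j : Fin 2) (x : ℂ) : ℂ :=
  -Complex.I * partialDeriv j u x + (vectorPotential B x j : ℂ) * u x

/-- `φ ∈ C₀^∞(Ω)`. -/
def IsTestFunction (Ω : Set ℂ) (φ : ℂ → ℂ) : Prop :=
  ContDiff ℝ ∞ φ ∧ HasCompactSupport φ ∧ tsupport φ ⊆ Ω

/-- `ψ` lies in the domain of the closure of the form `a[u] = ∫_Ω |(-i∇ + A)u|²`, `u ∈ C₀^∞(Ω)`,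
and `g` is the (then almost everywhere unique) magnetic gradient of `ψ`: some sequence of test
functions converges to `ψ` in `L²(Ω)` while its magnetic gradients converge to `g` in `L²(Ω)`. -/
def InFormDomain (Ω : Set ℂ) (B : ℝ) (ψ : ℂ → ℂ) (g : Fin 2 → ℂ → ℂ) : Prop :=
  MemLp ψ 2 (volume.restrict Ω) ∧ (∀ j, MemLp (g j) 2 (volume.restrict Ω)) ∧
  ∃ φ : ℕ → ℂ → ℂ, (∀ n, IsTestFunction Ω (φ n)) ∧
    Tendsto (fun n => eLpNorm (fun x => φ n x - ψ x) 2 (volume.restrict Ω)) atTop (𝓝 0) ∧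
    ∀ j, Tendsto (fun n => eLpNorm (fun x => magneticGradient B (φ n) j x - g j x) 2
      (volume.restrict Ω)) atTop (𝓝 0)

/-- `H_B^Ω ψ = f`, where `H_B^Ω` is the Friedrichs operator of the form above: `ψ` is in the domain
of the closed form, `f ∈ L²(Ω)`, and `a[ψ, φ] = ⟨f, φ⟩` for all `φ` in the form core `C₀^∞(Ω)`. -/
def MagneticLaplacianEq (Ω : Set ℂ) (B : ℝ) (ψ f : ℂ → ℂ) : Prop :=
  MemLp f 2 (volume.restrict Ω) ∧
  ∃ g : Fin 2 → ℂ → ℂ, InFormDomain Ω B ψ g ∧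
    ∀ φ : ℂ → ℂ, IsTestFunction Ω φ →
      ∫ x in Ω, ∑ j, g j x * (starRingEnd ℂ) (magneticGradient B φ j x) =
        ∫ x in Ω, f x * (starRingEnd ℂ) (φ x)

/-- `ψ` is an eigenfunction of `H_B^Ω` with eigenvalue `lam`. -/
def IsEigenfunction (Ω : Set ℂ) (B lam : ℝ) (ψ : ℂ → ℂ) : Prop :=
  MagneticLaplacianEq Ω B ψ (fun x => (lam : ℂ) * ψ x) ∧ ¬ (ψ =ᵐ[volume.restrict Ω] 0)

/-- The open disk `D_R` of radius `R` centred at the origin. -/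
def disk (R : ℝ) : Set ℂ := Metric.ball 0 R

/-- `ψ(r, θ) = Z(r) e^{ilθ}` on `D_R`, for some radial function `Z`. -/
def HasAngularMomentum (R : ℝ) (l : ℤ) (ψ : ℂ → ℂ) : Prop :=
  ∃ Z : ℝ → ℂ, ∀ r : ℝ, 0 < r → r < R → ∀ θ : ℝ,
    ψ (r * Complex.exp (θ * Complex.I)) = Z r * Complex.exp (l * θ * Complex.I)

/-- `lam` is an eigenvalue of the magnetic Dirichlet Laplacian on `D_R` possessing an eigenfunction
of angular momentum `l`. -/
def IsEigenvalueWithMomentum (R B : ℝ) (l : ℤ) (lam : ℝ) : Prop :=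
  ∃ ψ : ℂ → ℂ, IsEigenfunction (disk R) B lam ψ ∧ HasAngularMomentum R l ψ

/-! ### Kummer's function, its roots, and the eigenvalue branches -/

/-- Kummer's confluent hypergeometric function `M(a,b,z) = ∑ₖ (a)ₖ / ((b)ₖ k!) zᵏ`. -/
def kummerM (a b z : ℝ) : ℝ :=
  ∑' k : ℕ, (ascPochhammer ℝ k).eval a / ((ascPochhammer ℝ k).eval b * (k.factorial : ℝ)) * z ^ k

/-- `a` is the `m`-th largest root (`m = 1, 2, …`) of `a ↦ M(a,b,z)`: it is a root, and exactly
`m - 1` roots are larger. -/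
def IsKummerRoot (b z : ℝ) (m : ℕ) (a : ℝ) : Prop :=
  kummerM a b z = 0 ∧ {a' : ℝ | a < a' ∧ kummerM a' b z = 0}.encard + 1 = m

theorem IsKummerRoot.unique {b z : ℝ} {m : ℕ} {a₁ a₂ : ℝ}
    (h₁ : IsKummerRoot b z m a₁) (h₂ : IsKummerRoot b z m a₂) : a₁ = a₂ := by
  have key : ∀ x y : ℝ, IsKummerRoot b z m x → IsKummerRoot b z m y → ¬ x < y := by
    intro x y hx hy hxy
    have hfin : {a' : ℝ | x < a' ∧ kummerM a' b z = 0}.Finite := by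
      rw [← Set.encard_lt_top_iff]
      refine lt_of_le_of_lt (le_add_of_nonneg_right (zero_le (a := (1 : ℕ∞)))) ?_
      rw [hx.2]
      exact ENat.natCast_lt_top m
    have hss : {a' : ℝ | y < a' ∧ kummerM a' b z = 0} ⊂ {a' : ℝ | x < a' ∧ kummerM a' b z = 0} := by
      refine ⟨fun a ha => ⟨hxy.trans ha.1, ha.2⟩, fun h => ?_⟩
      exact lt_irrefl y (h ⟨hxy, hy.1⟩).1
    have hlt := (hfin.subset hss.1).encard_lt_encard hss
    have heq := hx.2.trans hy.2.symm
    exact hlt.ne' ((ENat.add_left_injective_of_ne_top ENat.one_ne_top) heq)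
  exact le_antisymm (not_lt.1 (key _ _ h₂ h₁)) (not_lt.1 (key _ _ h₁ h₂))

/-- The root `a_m(b,z)`: the `m`-th largest root of `a ↦ M(a,b,z)`. -/
def kummerRoot (m : ℕ) (b z : ℝ) : ℝ :=
  Classical.epsilon (IsKummerRoot b z m)

/-- The eigenvalue branch `λ_{m,l}(B) = (l + |l| + 1 - 2 a_m(|l| + 1, B R² / 2)) B` of `D_R`. -/
def eigenvalueBranch (R : ℝ) (m : ℕ) (l : ℤ) (B : ℝ) : ℝ :=
  ((l : ℝ) + |(l : ℝ)| + 1 - 2 * kummerRoot m (|(l : ℝ)| + 1) (B * R ^ 2 / 2)) * B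

end

end MagneticDisk

namespace MagneticDisk

noncomputable section

/-! ### Kummer's function: power series, derivative, differential equation -/

/-! Write b = |l| + 1 and z = BR²/2. On functions |x|^|l| e^{ilθ} e^{-B|x|²/4} y(B|x|²/2) the
magnetic Laplacian acts on y as Kummer's operator (`magneticLaplacian_angularProfile`), and y =
M(a,b,·) belongs to the value (l + b - 2a)B. If M(a,b,z) = 0, this function is smooth on the plane
and vanishes to first order on the circle; cutting it off near the circle puts it in the form
domain, so it is an eigenfunction (`isEigenvalueWithMomentum_of_kummerM_eq_zero`).

The converse must treat eigenfunctions that satisfy only the weak equation. If M(a,b,z) ≠ 0, a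
suitable multiple of M(a,b,·) corrects each power s^{k+1} to vanish at z. Testing with these
functions yields a recursion for the moments of ψ. Their exponential growth bound makes all of them
vanish, and Weierstrass approximation then gives ψ = 0
(`kummerM_eq_zero_of_isEigenvalueWithMomentum`).

The roots of a ↦ M(a,b,z) are counted by oscillation theory. By Sturm comparison, the roots above a
are at most as many as the zeros of M(a,b,·) in (0,z). At a = -N this is a polynomial of degree at
most N, so at most N roots lie in [-N,∞) (`card_roots_le`). This gives both the enumeration from
above and the strict bound a_m < -(m-1). There are infinitely many roots because a Prüfer angle
tends to -∞ with a (`infinite_roots`).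

For large z put a = -N - δ with N = m - 1. Division of Kummer's series by (a)_N leaves `kummerHead`
- δ `kummerTail`, so a root satisfies δ = head/tail. The head is z^N/((b)_N N!) (1 + O(1/z)), and
the tail at δ = 0 is (b-1)! e^z z^{-(N+b)} (1 + O(1/z)). A crude lower bound on the tail gives δ =
O(z^{-2}), which suffices to replace the tail at δ by the tail at 0
(`exists_kummerRoot_asymptotics`). -/

theorem hasSum_of_eq {f g : ℕ → ℝ} {x : ℝ} (h : HasSum g x) (e : ∀ k, f k = g k) :
    HasSum f x := by
  rwa [funext e]

/-- The `k`-th Taylor coefficient of `M(a,b,·)`. -/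
def kummerCoeff (a b : ℝ) (k : ℕ) : ℝ :=
  (ascPochhammer ℝ k).eval a / ((ascPochhammer ℝ k).eval b * (k.factorial : ℝ))

theorem kummerM_eq_tsum (a b z : ℝ) : kummerM a b z = ∑' k, kummerCoeff a b k * z ^ k := rfl

@[simp] theorem kummerCoeff_zero (a b : ℝ) : kummerCoeff a b 0 = 1 := by
  simp [kummerCoeff]

theorem ascPochhammer_eval_pos {b : ℝ} (hb : 0 < b) (k : ℕ) : 0 < (ascPochhammer ℝ k).eval b :=
  ascPochhammer_pos k b hb

theorem kummerCoeff_succ {b : ℝ} (hb : 0 < b) (a : ℝ) (k : ℕ) :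
    kummerCoeff a b (k + 1) = kummerCoeff a b k * ((a + k) / ((b + k) * (k + 1))) := by
  simp only [kummerCoeff, ascPochhammer_succ_eval, Nat.factorial_succ]
  push_cast
  field_simp

theorem kummerCoeff_succ_mul {b : ℝ} (hb : 0 < b) (a : ℝ) (k : ℕ) :
    kummerCoeff a b (k + 1) * ((b + k) * (k + 1)) = kummerCoeff a b k * (a + k) := by
  rw [kummerCoeff_succ hb]
  field_simp

/-- The coefficientwise form of M'(a,b,·) = (a/b) M(a+1,b+1,·). -/
theorem kummerCoeff_succ_shift {b : ℝ} (hb : 0 < b) (a : ℝ) (k : ℕ) :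
    kummerCoeff a b (k + 1) * (k + 1) = a / b * kummerCoeff (a + 1) (b + 1) k := by
  induction k with
  | zero => simp [kummerCoeff_succ hb]
  | succ k ih =>
    rw [kummerCoeff_succ hb, kummerCoeff_succ (by linarith : 0 < b + 1)]
    push_cast
    rw [← mul_assoc (a / b), ← ih]
    field_simp
    ring

/-- For b ≥ 1 each ratio of consecutive coefficients is at most (1 + |a|)/(k + 1) in modulus. The
series is therefore dominated by an exponential series, locally uniformly in a and z. -/
theorem abs_kummerCoeff_le {b : ℝ} (hb : 1 ≤ b) (a : ℝ) (k : ℕ) :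
    |kummerCoeff a b k| ≤ (1 + |a|) ^ k / (k.factorial : ℝ) := by
  induction k with
  | zero => simp
  | succ k ih =>
    rw [kummerCoeff_succ (by linarith), abs_mul, pow_succ, Nat.factorial_succ]
    push_cast
    have h1 : |(a + k) / ((b + k) * (k + 1))| ≤ (1 + |a|) / (k + 1) := by
      have hk : (0 : ℝ) ≤ k := by positivity
      rw [abs_div, abs_of_pos (by positivity : 0 < (b + k) * ((k : ℝ) + 1)),
        div_le_div_iff₀ (by positivity) (by positivity)]
      have h2 : |a + k| ≤ |a| + k := (abs_add_le _ _).trans (by simp)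
      have h3 : |a| + k ≤ (1 + |a|) * (b + k) := by
        nlinarith [abs_nonneg a, mul_nonneg (abs_nonneg a) hk,
          mul_nonneg (abs_nonneg a) (by linarith : 0 ≤ b - 1)]
      calc |a + k| * (k + 1) ≤ (1 + |a|) * (b + k) * (k + 1) := by
            gcongr; exact h2.trans h3
        _ = _ := by ring
    calc _ ≤ (1 + |a|) ^ k / (k.factorial : ℝ) * ((1 + |a|) / (k + 1)) := by gcongr
      _ = _ := by
        have : (k.factorial : ℝ) ≠ 0 := by positivity
        have h3 : (k : ℝ) + 1 ≠ 0 := by positivity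
        field_simp

theorem norm_kummerCoeff_mul_pow_le {a b z A Z : ℝ} (hb : 1 ≤ b) (ha : |a| ≤ A) (hz : |z| ≤ Z)
    (k : ℕ) :
    ‖kummerCoeff a b k * z ^ k‖ ≤ ((1 + A) * Z) ^ k / (k.factorial : ℝ) := by
  rw [norm_mul, norm_pow, Real.norm_eq_abs, Real.norm_eq_abs, mul_pow, mul_div_right_comm]
  have := abs_kummerCoeff_le hb a k
  have h0 := abs_nonneg a
  have hA : 0 ≤ A := h0.trans ha
  calc _ ≤ (1 + |a|) ^ k / (k.factorial : ℝ) * |z| ^ k := by gcongr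
    _ ≤ _ := by gcongr

theorem summable_kummer {b : ℝ} (hb : 1 ≤ b) (a z : ℝ) :
    Summable fun k => kummerCoeff a b k * z ^ k :=
  Summable.of_norm_bounded (Real.summable_pow_div_factorial _)
    (norm_kummerCoeff_mul_pow_le hb le_rfl le_rfl)

theorem hasSum_kummerM {b : ℝ} (hb : 1 ≤ b) (a z : ℝ) :
    HasSum (fun k => kummerCoeff a b k * z ^ k) (kummerM a b z) :=
  (summable_kummer hb a z).hasSum

@[simp] theorem kummerM_zero_right (a b : ℝ) : kummerM a b 0 = 1 := by
  rw [kummerM_eq_tsum, tsum_eq_single 0]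
  · simp
  · intro k hk; simp [hk]

/-- The derivative of `M(a,b,·)`. -/
def kummerD (a b z : ℝ) : ℝ := a / b * kummerM (a + 1) (b + 1) z

theorem hasSum_kummerD {b : ℝ} (hb : 1 ≤ b) (a z : ℝ) :
    HasSum (fun k : ℕ => kummerCoeff a b (k + 1) * (k + 1) * z ^ k) (kummerD a b z) := by
  simp_rw [kummerCoeff_succ_shift (by linarith : 0 < b), mul_assoc]
  exact (hasSum_kummerM (by linarith) _ z).mul_left _

theorem hasSum_mul_kummerD {b : ℝ} (hb : 1 ≤ b) (a z : ℝ) :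
    HasSum (fun k : ℕ => kummerCoeff a b k * k * z ^ k) (z * kummerD a b z) := by
  have h := (hasSum_kummerD hb a z).mul_left z
  have h2 : HasSum (fun k : ℕ => kummerCoeff a b (k + 1) * ((k + 1 : ℕ) : ℝ) * z ^ (k + 1))
      (z * kummerD a b z) := by
    refine hasSum_of_eq h fun k => ?_
    push_cast; ring
  have h3 := (hasSum_nat_add_iff (f := fun k : ℕ => kummerCoeff a b k * k * z ^ k) 1).1 h2
  simpa using h3

theorem hasDerivAt_kummerM {b : ℝ} (hb : 1 ≤ b) (a z : ℝ) :
    HasDerivAt (kummerM a b) (kummerD a b z) z := by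
  set Z : ℝ := |z| + 1
  have hmain := hasDerivAt_tsum_of_isPreconnected
    (g := fun k z => kummerCoeff a b k * z ^ k)
    (g' := fun k z => kummerCoeff a b k * (k * z ^ (k - 1)))
    (u := fun k => (1 + |a|) * (((1 + |a|) * Z) ^ (k - 1) / ((k - 1).factorial : ℝ)))
    (t := Metric.ball 0 Z) (y₀ := 0) (y := z)
    ?_ Metric.isOpen_ball (convex_ball _ _).isPreconnected
    (fun k y _ => (hasDerivAt_pow k y).const_mul _) ?_ (by simp [Z]; positivity)
    (summable_kummer hb a 0) (by simp [Z])
  · refine hmain.congr_deriv ?_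
    have h := hasSum_kummerD hb a z
    have h2 := (hasSum_nat_add_iff
      (f := fun k : ℕ => kummerCoeff a b k * (k * z ^ (k - 1))) 1).1 (?_ : HasSum _ (kummerD a b z))
    · simpa using h2.tsum_eq
    · refine hasSum_of_eq h fun k => ?_
      push_cast; ring
  · apply (summable_nat_add_iff 1).1
    simpa using (Real.summable_pow_div_factorial ((1 + |a|) * Z)).mul_left (1 + |a|)
  · intro k y hy
    have hy' : |y| ≤ Z := by simpa using (mem_ball_zero_iff.1 hy).le
    rcases k with _ | k
    · simp; positivity
    · have h1 := abs_kummerCoeff_le hb a (k + 1)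
      simp only [norm_mul, norm_pow, Real.norm_eq_abs, Nat.add_sub_cancel, Nat.abs_cast]
      calc _ ≤ (1 + |a|) ^ (k + 1) / ((k + 1).factorial : ℝ) * (((k + 1 : ℕ) : ℝ) * Z ^ k) := by
            gcongr
        _ = _ := by
            rw [Nat.factorial_succ, mul_pow]; push_cast; field_simp; ring

theorem hasDerivAt_kummerD {b : ℝ} (hb : 1 ≤ b) (a z : ℝ) :
    HasDerivAt (kummerD a b) (a / b * kummerD (a + 1) (b + 1) z) z :=
  (hasDerivAt_kummerM (by linarith : 1 ≤ b + 1) (a + 1) z).const_mul (a / b)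

/-- Kummer's differential equation. -/
theorem kummer_ode {b : ℝ} (hb : 1 ≤ b) (a z : ℝ) :
    z * (a / b * kummerD (a + 1) (b + 1) z) + (b - z) * kummerD a b z - a * kummerM a b z = 0 := by
  have h1 := (hasSum_mul_kummerD (by linarith : 1 ≤ b + 1) (a + 1) z).mul_left (a / b)
  have h2 := (hasSum_kummerD hb a z).mul_left b
  have h3 := hasSum_mul_kummerD hb a z
  have h4 := (hasSum_kummerM hb a z).mul_left a
  have h := ((h1.add h2).sub h3).sub h4
  have h0 : HasSum (fun _ : ℕ => (0 : ℝ)) 0 := hasSum_zero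
  have := h.unique (by
    refine hasSum_of_eq h0 fun k => ?_
    -- With c_k the coefficients of M(a,b,·), the coefficient of z^k is (k+1)(k+b) c_{k+1} - (k+a)
    -- c_k, which the recursion makes zero.
    have e1 := kummerCoeff_succ_shift (by linarith : 0 < b) a k
    have e2 := kummerCoeff_succ_mul (by linarith : 0 < b) a k
    linear_combination (-(k * z ^ k)) * e1 + z ^ k * e2)
  linear_combination this

theorem contDiff_kummerM {b : ℝ} (hb : 1 ≤ b) (a : ℝ) : ContDiff ℝ ∞ (kummerM a b) := by
  rw [contDiff_infty]
  intro k
  induction k generalizing a b with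
  | zero =>
    exact contDiff_zero.2 (continuous_iff_continuousAt.2 fun z =>
      (hasDerivAt_kummerM hb a z).continuousAt)
  | succ k ih =>
    have hd : deriv (kummerM a b) = kummerD a b := by
      ext z; exact (hasDerivAt_kummerM hb a z).deriv
    push_cast
    rw [contDiff_succ_iff_deriv]
    refine ⟨fun z => (hasDerivAt_kummerM hb a z).differentiableAt, by simp, ?_⟩
    rw [hd]
    exact contDiff_const.mul (ih (by linarith) (a + 1))

theorem continuous_kummerM_uncurry {b : ℝ} (hb : 1 ≤ b) :
    Continuous fun q : ℝ × ℝ => kummerM q.1 b q.2 := by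
  rw [continuous_iff_continuousAt]
  rintro ⟨a₀, z₀⟩
  have hc : ContinuousOn (fun q : ℝ × ℝ => ∑' k, kummerCoeff q.1 b k * q.2 ^ k)
      (Metric.ball 0 (|a₀| + 1) ×ˢ Metric.ball 0 (|z₀| + 1)) := by
    refine continuousOn_tsum (fun k => ?_)
      (Real.summable_pow_div_factorial ((1 + (|a₀| + 1)) * (|z₀| + 1))) ?_
    · have : Continuous fun q : ℝ × ℝ => kummerCoeff q.1 b k * q.2 ^ k := by
        unfold kummerCoeff
        have := (ascPochhammer ℝ k).continuous
        fun_prop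
      exact this.continuousOn
    · rintro k ⟨a, z⟩ ⟨ha, hz⟩
      exact norm_kummerCoeff_mul_pow_le hb (by simpa using (mem_ball_zero_iff.1 ha).le)
        (by simpa using (mem_ball_zero_iff.1 hz).le) k
  exact hc.continuousAt ((Metric.isOpen_ball.prod Metric.isOpen_ball).mem_nhds (by simp))

theorem continuous_kummerM_left {b : ℝ} (hb : 1 ≤ b) (z : ℝ) :
    Continuous fun a => kummerM a b z :=
  (continuous_kummerM_uncurry hb).comp (by fun_prop : Continuous fun a : ℝ => (a, z))

theorem continuous_kummerD_uncurry {b : ℝ} (hb : 1 ≤ b) :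
    Continuous fun q : ℝ × ℝ => kummerD q.1 b q.2 := by
  have := (continuous_kummerM_uncurry (by linarith : 1 ≤ b + 1)).comp
    (by fun_prop : Continuous fun q : ℝ × ℝ => (q.1 + 1, q.2))
  unfold kummerD
  exact (continuous_fst.div_const b).mul this

theorem kummerCoeff_neg_nat_eq_zero {b : ℝ} (hb : 1 ≤ b) {n k : ℕ} (h : n < k) :
    kummerCoeff (-(n : ℝ)) b k = 0 := by
  induction k, h using Nat.le_induction with
  | base => rw [kummerCoeff_succ (by linarith)]; simp
  | succ k _ ih => rw [kummerCoeff_succ (by linarith), ih, zero_mul]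

/-- For `a = -n` Kummer's function is a polynomial of degree at most `n`, with at most `n` zeros. -/
theorem card_zeros_kummerM_neg_nat_le {b : ℝ} (hb : 1 ≤ b) (n : ℕ) (T : Finset ℝ)
    (hT : ∀ t ∈ T, kummerM (-(n : ℝ)) b t = 0) : T.card ≤ n := by
  set q : Polynomial ℝ := ∑ k ∈ Finset.range (n + 1),
    Polynomial.C (kummerCoeff (-(n : ℝ)) b k) * Polynomial.X ^ k
  have hq : ∀ z, q.eval z = kummerM (-(n : ℝ)) b z := by
    intro z
    rw [kummerM_eq_tsum, tsum_eq_sum (s := Finset.range (n + 1))]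
    · simp [q, Polynomial.eval_finsetSum]
    · intro k hk
      rw [kummerCoeff_neg_nat_eq_zero hb (by simpa using hk), zero_mul]
  have hq0 : q ≠ 0 := by
    intro h
    have := hq 0
    simp [h] at this
  have hdeg : q.natDegree ≤ n := by
    apply Polynomial.natDegree_sum_le_of_forall_le
    intro k hk
    exact (Polynomial.natDegree_C_mul_X_pow_le _ _).trans (Nat.lt_succ_iff.1 (Finset.mem_range.1 hk))
  refine le_trans ?_ hdeg
  refine Polynomial.card_le_degree_of_subset_roots (Z := T) fun t ht => ?_
  rw [Polynomial.mem_roots hq0, Polynomial.IsRoot, hq]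
  exact hT t (by simpa using ht)

/-! ### Self-adjoint form of Kummer's equation, for integral `b = n + 1` -/

theorem one_le_natCast_add_one (n : ℕ) : (1 : ℝ) ≤ (n : ℝ) + 1 := by simp

/-- The weighted derivative `s^{n+1} e^{-s} M'(a,n+1,s)`. -/
def kummerFlux (n : ℕ) (a s : ℝ) : ℝ := s ^ (n + 1) * Real.exp (-s) * kummerD a (n + 1) s

/-- Multiplication by s^n e^{-s} brings Kummer's equation to divergence form; the comparison and
Prüfer arguments both rest on this form. -/
theorem hasDerivAt_kummerFlux (n : ℕ) (a s : ℝ) :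
    HasDerivAt (kummerFlux n a) (a * (s ^ n * Real.exp (-s)) * kummerM a (n + 1) s) s := by
  have hb := one_le_natCast_add_one n
  have h1 : HasDerivAt (fun s : ℝ => Real.exp (-s)) (-Real.exp (-s)) s := by
    simpa using (hasDerivAt_neg s).exp
  have h := ((hasDerivAt_pow (n + 1) s).mul h1).mul (hasDerivAt_kummerD hb a s)
  refine h.congr_deriv ?_
  have e := kummer_ode hb a s
  simp only [Nat.add_sub_cancel, pow_succ, Pi.mul_apply]
  push_cast
  linear_combination (s ^ n * Real.exp (-s)) * e

theorem continuous_kummerFlux (n : ℕ) (a : ℝ) : Continuous (kummerFlux n a) :=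
  continuous_iff_continuousAt.2 fun s => (hasDerivAt_kummerFlux n a s).continuousAt


/-! ### Sturm comparison for Kummer's equation -/

/-- `M(a,n+1,·)` and its derivative have no common positive zero. -/
theorem kummerM_ne_zero_or_kummerD_ne_zero (n : ℕ) (a : ℝ) {s₀ : ℝ} (hs₀ : 0 < s₀) :
    kummerM a (n + 1) s₀ ≠ 0 ∨ kummerD a (n + 1) s₀ ≠ 0 := by
  by_contra! hcon
  have hb := one_le_natCast_add_one n
  obtain ⟨h0, h1⟩ := hcon
  -- Uniqueness for the initial value problem, by a Gronwall argument: a common zero at s₀ spreads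
  -- to all of (0, s₀), and by continuity to 0, where M equals 1. The bound is taken on [ε, s₀]
  -- because the equation is singular at 0.
  have key : ∀ ε ∈ Set.Ioo 0 s₀, kummerM a (n + 1) ε = 0 := by
    rintro ε ⟨hε, hεs⟩
    have hcont : ContinuousOn
        (fun s : ℝ => 1 / (s ^ (n + 1) * Real.exp (-s)) + a * (s ^ n * Real.exp (-s)))
        (Set.Icc ε s₀) := by
      intro s hs
      have hs' : s ^ (n + 1) * Real.exp (-s) ≠ 0 := by
        have : 0 < s := hε.trans_le hs.1
        positivity
      apply ContinuousAt.continuousWithinAt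
      refine ContinuousAt.add (ContinuousAt.div continuousAt_const ?_ hs') ?_ <;> fun_prop
    obtain ⟨K, hK⟩ := isCompact_Icc.exists_bound_of_continuousOn hcont
    -- The exponential weight makes this energy nondecreasing, since 2|uf| ≤ u² + f². As E is
    -- nonnegative and vanishes at s₀, it vanishes to the left as well.
    set E : ℝ → ℝ := fun s => (kummerM a (n + 1) s ^ 2 + kummerFlux n a s ^ 2) * Real.exp (K * s)
    have hE : ∀ s, HasDerivAt E
        ((2 * kummerM a (n + 1) s * kummerD a (n + 1) s
          + 2 * kummerFlux n a s * (a * (s ^ n * Real.exp (-s)) * kummerM a (n + 1) s))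
          * Real.exp (K * s)
        + (kummerM a (n + 1) s ^ 2 + kummerFlux n a s ^ 2) * (Real.exp (K * s) * K)) s := by
      intro s
      have e1 := (hasDerivAt_kummerM hb a s).pow 2
      have e2 := (hasDerivAt_kummerFlux n a s).pow 2
      have e3 : HasDerivAt (fun s => Real.exp (K * s)) (Real.exp (K * s) * K) s := by
        simpa using ((hasDerivAt_id s).const_mul K).exp
      refine ((e1.add e2).mul e3).congr_deriv ?_
      simp
    have hmono : MonotoneOn E (Set.Icc ε s₀) := by
      refine monotoneOn_of_deriv_nonneg (convex_Icc _ _)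
        (fun s _ => (hE s).continuousAt.continuousWithinAt)
        (fun s _ => (hE s).differentiableAt.differentiableWithinAt) ?_
      intro s hs
      rw [interior_Icc] at hs
      have hs0 : 0 < s := hε.trans hs.1
      rw [(hE s).deriv]
      have hb1 := hK s (Set.Ioo_subset_Icc_self hs)
      rw [Real.norm_eq_abs] at hb1
      set u := kummerM a (n + 1) s
      set f := kummerFlux n a s with hf
      have hd : kummerD a (n + 1) s = f * (1 / (s ^ (n + 1) * Real.exp (-s))) := by
        rw [hf, kummerFlux]; field_simp
      rw [hd]
      set g := 1 / (s ^ (n + 1) * Real.exp (-s))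
      set w := s ^ n * Real.exp (-s)
      have h2 : |2 * u * f| ≤ u ^ 2 + f ^ 2 := by
        rw [abs_le]; constructor <;> nlinarith [sq_nonneg (u + f), sq_nonneg (u - f)]
      have h3 : |2 * u * f * (g + a * w)| ≤ (u ^ 2 + f ^ 2) * K := by
        rw [abs_mul]; gcongr
      have h4 := neg_abs_le (2 * u * f * (g + a * w))
      have : 0 ≤ (2 * u * f * (g + a * w) + (u ^ 2 + f ^ 2) * K) * Real.exp (K * s) :=
        mul_nonneg (by linarith) (Real.exp_nonneg _)
      linarith
    have h := hmono ⟨le_rfl, hεs.le⟩ ⟨hεs.le, le_rfl⟩ hεs.le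
    have hE0 : E s₀ = 0 := by simp [E, h0, h1, kummerFlux]
    rw [hE0] at h
    have h5 : kummerM a (n + 1) ε ^ 2 + kummerFlux n a ε ^ 2 ≤ 0 :=
      nonpos_of_mul_nonpos_left h (Real.exp_pos _)
    nlinarith [sq_nonneg (kummerM a (n + 1) ε), sq_nonneg (kummerFlux n a ε)]
  have hc := (hasDerivAt_kummerM hb a 0).continuousAt.tendsto.mono_left
    (nhdsWithin_le_nhds (s := Set.Ioi 0))
  have h' : Tendsto (kummerM a (n + 1)) (𝓝[>] 0) (𝓝 0) := by
    refine tendsto_const_nhds.congr' ?_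
    filter_upwards [Ioo_mem_nhdsGT hs₀] with ε hε
    exact (key ε hε).symm
  have := tendsto_nhds_unique hc h'
  simp at this

/-- Sturm's comparison theorem, by Picone's identity. -/
theorem exists_zero_of_lt (n : ℕ) {a a' x y : ℝ} (haa : a < a') (hx : 0 ≤ x) (hxy : x < y)
    (hvx : x = 0 ∨ kummerM a' (n + 1) x = 0) (hvy : kummerM a' (n + 1) y = 0) :
    ∃ t ∈ Set.Ico x y, kummerM a (n + 1) t = 0 := by
  by_contra! hu
  have hb := one_le_natCast_add_one n
  have hy : 0 < y := hx.trans_lt hxy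
  set u := kummerM a (n + 1) with hudef
  set v := kummerM a' (n + 1) with hvdef
  have hdu := fun s => hasDerivAt_kummerM hb a s
  have hdv := fun s => hasDerivAt_kummerM hb a' s
  have hfu := fun s => hasDerivAt_kummerFlux n a s
  have hfv := fun s => hasDerivAt_kummerFlux n a' s
  rw [← hudef] at hdu
  rw [← hvdef] at hdv
  -- Picone's function. Its derivative is a sum of two nonnegative terms, one of them a positive
  -- weight times v². Since F is 0 at x and tends to 0 at y, it vanishes identically, so v does too,
  -- which is impossible.
  set F : ℝ → ℝ := fun s => v s * kummerFlux n a' s - v s ^ 2 * kummerFlux n a s / u s with hF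
  have hderiv : ∀ s ∈ Set.Ico x y, HasDerivAt F
      ((a' - a) * (s ^ n * Real.exp (-s)) * v s ^ 2 + s ^ (n + 1) * Real.exp (-s) *
        (kummerD a' (n + 1) s - v s * kummerD a (n + 1) s / u s) ^ 2) s := by
    intro s hs
    have hus := hu s hs
    refine (((hdv s).mul (hfv s)).sub
      ((((hdv s).pow 2).mul (hfu s)).div (hdu s) hus)).congr_deriv ?_
    simp only [kummerFlux, Pi.mul_apply, Pi.pow_apply, ← hudef, ← hvdef]
    field_simp
    ring
  have hmono : MonotoneOn F (Set.Ico x y) := by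
    refine monotoneOn_of_deriv_nonneg (convex_Ico _ _)
      (fun s hs => (hderiv s hs).continuousAt.continuousWithinAt)
      (fun s hs => (hderiv s (interior_subset hs)).differentiableAt.differentiableWithinAt) ?_
    intro s hs
    rw [(hderiv s (interior_subset hs)).deriv]
    have hs0 : 0 ≤ s := hx.trans (interior_subset hs).1
    have : 0 ≤ a' - a := by linarith
    positivity
  have hFx : F x = 0 := by
    rcases hvx with h | h
    · simp [hF, kummerFlux, h]
    · simp [hF, h]
  have hcfu := (continuous_kummerFlux n a).continuousAt (x := y)
  have hcfv := (continuous_kummerFlux n a').continuousAt (x := y)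
  have hFy : Tendsto F (𝓝[<] y) (𝓝 0) := by
    -- Only [x, y) is assumed free of zeros of u. If u(y) = 0, this zero is simple, so v/u tends to
    -- the ratio of derivatives and v²/u still tends to 0.
    by_cases huy : u y = 0
    · have huy' : kummerD a (n + 1) y ≠ 0 :=
        (kummerM_ne_zero_or_kummerD_ne_zero n a hy).resolve_left (by simpa using huy)
      have s1 := ((hasDerivAt_iff_tendsto_slope.1 (hdu y)).mono_left
        (nhdsWithin_mono y (fun s hs => ne_of_lt hs) : 𝓝[<] y ≤ 𝓝[≠] y))
      have s2 := ((hasDerivAt_iff_tendsto_slope.1 (hdv y)).mono_left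
        (nhdsWithin_mono y (fun s hs => ne_of_lt hs) : 𝓝[<] y ≤ 𝓝[≠] y))
      have cv := (hdv y).continuousAt.tendsto.mono_left (nhdsWithin_le_nhds (s := Set.Iio y))
      have c1 := hcfu.tendsto.mono_left (nhdsWithin_le_nhds (s := Set.Iio y))
      have c2 := hcfv.tendsto.mono_left (nhdsWithin_le_nhds (s := Set.Iio y))
      have := (cv.mul c2).sub ((cv.mul c1).mul (s2.div s1 huy'))
      rw [hvy] at this
      simp only [zero_mul, sub_zero] at this
      refine this.congr' ?_
      filter_upwards [self_mem_nhdsWithin, Ioo_mem_nhdsLT hxy] with s hs hs'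
      have h1 : s - y ≠ 0 := sub_ne_zero.2 (ne_of_lt hs)
      have h2 := hu s ⟨hs'.1.le, hs'.2⟩
      simp only [hF, Pi.div_apply, slope_def_field, huy, hvy, sub_zero]
      field_simp
    · have : ContinuousAt F y :=
        ((hdv y).continuousAt.mul hcfv).sub
          ((((hdv y).continuousAt.pow 2).mul hcfu).div (hdu y).continuousAt huy)
      have h2 := this.tendsto.mono_left (nhdsWithin_le_nhds (s := Set.Iio y))
      simpa [hF, hvy] using h2
  have hF0 : ∀ s ∈ Set.Ico x y, F s = 0 := by
    intro s hs
    apply le_antisymm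
    · refine ge_of_tendsto hFy ?_
      filter_upwards [Ioo_mem_nhdsLT hs.2] with t ht
      exact hmono hs ⟨hs.1.trans ht.1.le, ht.2⟩ ht.1.le
    · rw [← hFx]; exact hmono ⟨le_rfl, hxy⟩ hs hs.1
  have hv0 : ∀ s ∈ Set.Ioo x y, v s = 0 := by
    intro s hs
    have hs' : s ∈ Set.Ico x y := ⟨hs.1.le, hs.2⟩
    have h1 : HasDerivAt F 0 s := by
      refine (hasDerivAt_const s (0 : ℝ)).congr_of_eventuallyEq ?_
      filter_upwards [Ioo_mem_nhds hs.1 hs.2] with t ht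
      exact hF0 t ⟨ht.1.le, ht.2⟩
    have h2 := (hderiv s hs').unique h1
    have hs0 : 0 < s := hx.trans_lt hs.1
    have h3 : 0 < (a' - a) * (s ^ n * Real.exp (-s)) := by
      have : 0 < a' - a := by linarith
      positivity
    have h4 : 0 ≤ s ^ (n + 1) * Real.exp (-s) *
        (kummerD a' (n + 1) s - v s * kummerD a (n + 1) s / u s) ^ 2 := by positivity
    have h5 : (a' - a) * (s ^ n * Real.exp (-s)) * v s ^ 2 ≤ 0 := by linarith
    have h6 : v s ^ 2 ≤ 0 := nonpos_of_mul_nonpos_right h5 h3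
    nlinarith
  obtain ⟨s, hs⟩ := exists_between hxy
  have hds : kummerD a' (n + 1) s = 0 := by
    refine (hdv s).unique ((hasDerivAt_const s (0 : ℝ)).congr_of_eventuallyEq ?_)
    filter_upwards [Ioo_mem_nhds hs.1 hs.2] with t ht
    exact hv0 t ht
  rcases kummerM_ne_zero_or_kummerD_ne_zero n a' (hx.trans_lt hs.1) with h | h
  · exact h (hv0 s hs)
  · exact h hds

/-- Sturm comparison is applied between consecutive points of S, with 0 as the initial point. The
new zeros are distinct because each lies to the right of the previous point of S, while the earlier
ones lie strictly to its left. -/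
theorem exists_finset_zeros_of_lt (n : ℕ) {a a' : ℝ} (haa : a < a') (S : Finset ℝ)
    (hS : ∀ s ∈ S, 0 < s ∧ kummerM a' (n + 1) s = 0) :
    ∃ T : Finset ℝ, T.card = S.card ∧
      ∀ t ∈ T, 0 < t ∧ kummerM a (n + 1) t = 0 ∧ ∃ s ∈ S, t < s := by
  induction S using Finset.induction_on_max with
  | empty => exact ⟨∅, by simp⟩
  | insert y S hlt ih =>
    obtain ⟨T, hcard, hT⟩ := ih fun s hs => hS s (Finset.mem_insert_of_mem hs)
    obtain ⟨hy, hvy⟩ := hS y (Finset.mem_insert_self _ _)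
    have hyS : y ∉ S := fun h => lt_irrefl _ (hlt y h)
    obtain ⟨x, hx0, hxy, hvx, hSx⟩ : ∃ x, 0 ≤ x ∧ x < y ∧
        (x = 0 ∨ kummerM a' (n + 1) x = 0) ∧ ∀ s ∈ S, s ≤ x := by
      rcases S.eq_empty_or_nonempty with rfl | hne
      · exact ⟨0, le_rfl, hy, Or.inl rfl, by simp⟩
      · have hm := S.max'_mem hne
        have := hS _ (Finset.mem_insert_of_mem hm)
        exact ⟨S.max' hne, this.1.le, hlt _ hm, Or.inr this.2, fun s hs => S.le_max' s hs⟩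
    obtain ⟨t, ht, hut⟩ := exists_zero_of_lt n haa hx0 hxy hvx hvy
    have htT : t ∉ T := by
      intro h
      obtain ⟨s, hs, hts⟩ := (hT t h).2.2
      exact absurd (hSx s hs) (not_le.2 (ht.1.trans_lt hts))
    have ht0 : 0 < t := by
      refine lt_of_le_of_ne (hx0.trans ht.1) ?_
      rintro rfl
      simp at hut
    refine ⟨insert t T, by rw [Finset.card_insert_of_notMem htT, Finset.card_insert_of_notMem hyS,
      hcard], ?_⟩
    intro r hr
    rcases Finset.mem_insert.1 hr with rfl | hr
    · exact ⟨ht0, hut, y, Finset.mem_insert_self _ _, ht.2⟩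
    · obtain ⟨h1, h2, s, hs, h3⟩ := hT r hr
      exact ⟨h1, h2, s, Finset.mem_insert_of_mem hs, h3⟩

/-- Roots of `M(·,n+1,z)` above `a` give zeros of `M(a,n+1,·)` in `(0,z)`. -/
theorem exists_finset_zeros_of_roots (n : ℕ) {z : ℝ} (hz : 0 < z) (S : Finset ℝ)
    (hS : ∀ r ∈ S, kummerM r (n + 1) z = 0) (a : ℝ) (ha : ∀ r ∈ S, a < r) :
    ∃ T : Finset ℝ, T.card = S.card ∧ ∀ t ∈ T, 0 < t ∧ kummerM a (n + 1) t = 0 ∧ t < z := by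
  induction S using Finset.induction_on_min generalizing a with
  | empty => exact ⟨∅, by simp⟩
  | insert r S hlt ih =>
    have hrS : r ∉ S := fun h => lt_irrefl _ (hlt r h)
    obtain ⟨T, hcard, hT⟩ := ih (fun s hs => hS s (Finset.mem_insert_of_mem hs)) r hlt
    have hzT : z ∉ T := fun h => lt_irrefl _ (hT z h).2.2
    -- With r the smallest root, z is one more zero of M(r,n+1,·) beside those found for the larger
    -- roots; lowering the parameter from r to a moves all of them strictly to the left.
    obtain ⟨T', hcard', hT'⟩ := exists_finset_zeros_of_lt n (ha r (Finset.mem_insert_self _ _))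
      (insert z T) (by
        intro s hs
        rcases Finset.mem_insert.1 hs with rfl | hs
        · exact ⟨hz, hS r (Finset.mem_insert_self _ _)⟩
        · exact ⟨(hT s hs).1, (hT s hs).2.1⟩)
    refine ⟨T', by rw [hcard', Finset.card_insert_of_notMem hzT,
      Finset.card_insert_of_notMem hrS, hcard], fun t ht => ?_⟩
    obtain ⟨h1, h2, s, hs, h3⟩ := hT' t ht
    refine ⟨h1, h2, h3.trans_le ?_⟩
    rcases Finset.mem_insert.1 hs with rfl | hs
    · exact le_rfl
    · exact (hT s hs).2.2.le

/-- `M(·,n+1,z)` has at most `N` real roots in `[-N, ∞)`. -/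
theorem card_roots_le (n N : ℕ) {z : ℝ} (hz : 0 < z) (S : Finset ℝ)
    (hS : ∀ r ∈ S, kummerM r (n + 1) z = 0 ∧ -(N : ℝ) ≤ r) : S.card ≤ N := by
  have hb := one_le_natCast_add_one n
  -- The point -N is set aside because the previous lemma needs roots strictly above the parameter.
  -- If -N is itself a root, it is accounted for by the extra zero z of the polynomial.
  obtain ⟨T, hcard, hT⟩ := exists_finset_zeros_of_roots n hz (S.erase (-(N : ℝ)))
    (fun r hr => (hS r (Finset.mem_of_mem_erase hr)).1) (-(N : ℝ))
    (fun r hr => lt_of_le_of_ne (hS r (Finset.mem_of_mem_erase hr)).2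
      (Finset.ne_of_mem_erase hr).symm)
  by_cases h : -(N : ℝ) ∈ S
  · have hzT : z ∉ T := fun h => lt_irrefl _ (hT z h).2.2
    have := card_zeros_kummerM_neg_nat_le hb N (insert z T) (by
      intro t ht
      rcases Finset.mem_insert.1 ht with rfl | ht
      · exact (hS _ h).1
      · exact (hT t ht).2.1)
    rw [Finset.card_insert_of_notMem hzT, hcard, Finset.card_erase_add_one h] at this
    exact this
  · rw [Finset.erase_eq_of_notMem h] at hcard
    rw [← hcard]
    exact card_zeros_kummerM_neg_nat_le hb N T fun t ht => (hT t ht).2.1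

theorem finite_roots_above (n : ℕ) {z : ℝ} (hz : 0 < z) (a : ℝ) :
    {r : ℝ | a ≤ r ∧ kummerM r (n + 1) z = 0}.Finite := by
  obtain ⟨N, hN⟩ := exists_nat_ge (-a)
  by_contra h
  obtain ⟨S, hS, hcard⟩ := Set.Infinite.exists_subset_card_eq h (N + 1)
  have := card_roots_le n N hz S fun r hr => ⟨(hS hr).2, by linarith [(hS hr).1]⟩
  omega


/-! ### Infinitely many roots, by the Prüfer angle -/

/-- The speed of the Prüfer angle of `(k M(-k²,n+1,s), s^{n+1} e^{-s} M'(-k²,n+1,s))` at `k = e^τ`,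
with its sign reversed. -/
def pruferSpeed (n : ℕ) (τ s : ℝ) : ℝ :=
  Real.exp τ * (Real.exp τ ^ 2 * (|s| ^ n * Real.exp (-|s|)) *
      kummerM (-(Real.exp τ ^ 2)) (n + 1) |s| ^ 2
    + |s| ^ (n + 1) * Real.exp (-|s|) * kummerD (-(Real.exp τ ^ 2)) (n + 1) |s| ^ 2) /
  (Real.exp τ ^ 2 * kummerM (-(Real.exp τ ^ 2)) (n + 1) |s| ^ 2 +
    kummerFlux n (-(Real.exp τ ^ 2)) |s| ^ 2)

theorem prufer_radius_pos (n : ℕ) (a : ℝ) {k s : ℝ} (hk : 0 < k) (hs : 0 ≤ s) :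
    0 < k ^ 2 * kummerM a (n + 1) s ^ 2 + kummerFlux n a s ^ 2 := by
  rcases hs.eq_or_lt with rfl | hs
  · simp only [kummerM_zero_right]; positivity
  · rcases kummerM_ne_zero_or_kummerD_ne_zero n a hs with h | h
    · positivity
    · have : kummerFlux n a s ≠ 0 := by unfold kummerFlux; positivity
      positivity

/-- The absolute values in `pruferSpeed` keep the denominator positive for every real s, so that
continuity holds on the whole plane and the angle is differentiable at 0 from both sides. -/
theorem continuous_pruferSpeed (n : ℕ) : Continuous fun q : ℝ × ℝ => pruferSpeed n q.1 q.2 := by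
  have hb := one_le_natCast_add_one n
  have hg : Continuous fun q : ℝ × ℝ => (-(Real.exp q.1 ^ 2), |q.2|) := by fun_prop
  have h1 : Continuous fun q : ℝ × ℝ => kummerM (-(Real.exp q.1 ^ 2)) (n + 1) |q.2| :=
    (continuous_kummerM_uncurry hb).comp hg
  have h2 : Continuous fun q : ℝ × ℝ => kummerD (-(Real.exp q.1 ^ 2)) (n + 1) |q.2| :=
    (continuous_kummerD_uncurry hb).comp hg
  unfold pruferSpeed
  refine Continuous.div ?_ ?_ fun q =>
    (prufer_radius_pos n _ (Real.exp_pos _) (abs_nonneg _)).ne'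
  · fun_prop
  · unfold kummerFlux; fun_prop

theorem continuous_pruferSpeed_right (n : ℕ) (τ : ℝ) : Continuous (pruferSpeed n τ) :=
  (continuous_pruferSpeed n).comp (by fun_prop : Continuous fun s : ℝ => (τ, s))

theorem pruferSpeed_nonneg (n : ℕ) (τ s : ℝ) : 0 ≤ pruferSpeed n τ s := by
  unfold pruferSpeed; positivity

/-- The Prüfer angle. -/
def pruferAngle (n : ℕ) (τ s : ℝ) : ℝ := -∫ t in (0 : ℝ)..s, pruferSpeed n τ t

theorem hasDerivAt_pruferAngle (n : ℕ) (τ s : ℝ) :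
    HasDerivAt (pruferAngle n τ) (-pruferSpeed n τ s) s :=
  ((continuous_pruferSpeed_right n τ).integral_hasStrictDerivAt 0 s).hasDerivAt.neg

theorem continuous_pruferAngle_left (n : ℕ) (s : ℝ) : Continuous fun τ => pruferAngle n τ s :=
  (intervalIntegral.continuous_parametric_intervalIntegral_of_continuous'
    (continuous_pruferSpeed n) 0 s).neg

/-- The vector (kM, flux), k = e^τ, stays parallel to (cos θ, sin θ). The quotient X²/D below is the
squared sine of the angle between them; it starts at 0, and the speed of θ is chosen to make its
derivative vanish. Consequently cos θ = 0 forces M = 0. -/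
theorem kummerFlux_mul_cos_pruferAngle (n : ℕ) (τ : ℝ) {z : ℝ} (hz : 0 ≤ z) :
    kummerFlux n (-(Real.exp τ ^ 2)) z * Real.cos (pruferAngle n τ z) =
      Real.exp τ * kummerM (-(Real.exp τ ^ 2)) (n + 1) z * Real.sin (pruferAngle n τ z) := by
  have hb := one_le_natCast_add_one n
  set k := Real.exp τ with hk
  have hk0 : 0 < k := Real.exp_pos τ
  set a := -(k ^ 2) with ha
  set X : ℝ → ℝ := fun s => kummerFlux n a s * Real.cos (pruferAngle n τ s) -
    k * kummerM a (n + 1) s * Real.sin (pruferAngle n τ s) with hX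
  set D : ℝ → ℝ := fun s => k ^ 2 * kummerM a (n + 1) s ^ 2 + kummerFlux n a s ^ 2 with hD
  have hD0 : ∀ s, 0 ≤ s → D s ≠ 0 := fun s hs => (prufer_radius_pos n a hk0 hs).ne'
  have hder : ∀ s, 0 ≤ s → HasDerivAt (fun s => X s ^ 2 / D s) 0 s := by
    intro s hs
    have hu := hasDerivAt_kummerM hb a s
    have hf := hasDerivAt_kummerFlux n a s
    have hθ := hasDerivAt_pruferAngle n τ s
    have hXd := (hf.mul hθ.cos).sub ((hu.const_mul k).mul hθ.sin)
    have hDd := ((hu.pow 2).const_mul (k ^ 2)).add (hf.pow 2)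
    refine ((hXd.pow 2).div hDd (hD0 s hs)).congr_deriv ?_
    have hg : pruferSpeed n τ s * D s = k * (k ^ 2 * (s ^ n * Real.exp (-s)) *
        kummerM a (n + 1) s ^ 2 + kummerFlux n a s * kummerD a (n + 1) s) := by
      simp only [pruferSpeed, abs_of_nonneg hs, ← hk, ← ha]
      rw [div_mul_cancel₀ _ (hD0 s hs)]
      simp only [kummerFlux]
      ring
    rw [div_eq_zero_iff]
    left
    simp only [Pi.mul_apply, Pi.sub_apply, Pi.add_apply, Pi.pow_apply]
    simp only [hD] at hg
    set u := kummerM a (n + 1) s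
    set f := kummerFlux n a s
    set u' := kummerD a (n + 1) s
    set w := s ^ n * Real.exp (-s)
    set g := pruferSpeed n τ s
    set C := Real.cos (pruferAngle n τ s)
    set S := Real.sin (pruferAngle n τ s)
    simp only [Nat.cast_ofNat, Nat.add_one_sub_one, pow_one]
    linear_combination (2 * (f * C - k * u * S) * (k * u * C + f * S)) * hg
  have hconst := constant_of_has_deriv_right_zero (f := fun s => X s ^ 2 / D s) (a := 0) (b := z)
    (fun s hs => (hder s hs.1).continuousAt.continuousWithinAt)
    (fun s hs => (hder s hs.1).hasDerivWithinAt) z ⟨hz, le_rfl⟩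
  have hX0 : X 0 = 0 := by simp [hX, kummerFlux, pruferAngle]
  simp only [hX0] at hconst
  have : X z = 0 := by
    have h := hD0 z hz
    have : X z ^ 2 = 0 := by
      simpa [h] using hconst
    simpa using this
  simp only [hX] at this
  linarith

/-- Up to the factor k = e^τ the speed is (w(kM)² + pM'²)/((kM)² + (pM')²), with w = s^n e^{-s} and
p = s^{n+1} e^{-s}, hence at least k min(w, 1/p). On [z/2, z] this minimum is bounded below
independently of τ, so the angle falls at least linearly in k. -/
theorem pruferAngle_le (n : ℕ) {z : ℝ} (hz : 0 < z) (τ : ℝ) :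
    pruferAngle n τ z ≤
      -(Real.exp τ * min ((z / 2) ^ n * Real.exp (-z)) (1 / z ^ (n + 1)) * (z / 2)) := by
  set δ := min ((z / 2) ^ n * Real.exp (-z)) (1 / z ^ (n + 1))
  have hint : ∀ x y, IntervalIntegrable (pruferSpeed n τ) volume x y := fun x y =>
    (continuous_pruferSpeed_right n τ).intervalIntegrable x y
  have h1 : 0 ≤ ∫ t in (0 : ℝ)..(z / 2), pruferSpeed n τ t :=
    intervalIntegral.integral_nonneg (by linarith) fun t _ => pruferSpeed_nonneg n τ t
  have h2 : ∫ _ in (z / 2)..z, Real.exp τ * δ ≤ ∫ t in (z / 2)..z, pruferSpeed n τ t := by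
    refine intervalIntegral.integral_mono_on (by linarith) (by simp) (hint _ _) fun s hs => ?_
    have hs0 : 0 < s := by linarith [hs.1]
    have hD := prufer_radius_pos n (-(Real.exp τ ^ 2)) (Real.exp_pos τ) hs0.le
    simp only [pruferSpeed, abs_of_pos hs0]
    rw [le_div_iff₀ hD, mul_assoc]
    refine mul_le_mul_of_nonneg_left ?_ (Real.exp_nonneg _)
    have hw : δ ≤ s ^ n * Real.exp (-s) := by
      refine (min_le_left _ _).trans ?_
      gcongr
      · exact hs.1
      · exact hs.2
    have hp : δ * (s ^ (n + 1) * Real.exp (-s)) ≤ 1 := by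
      have hδ : δ ≤ 1 / z ^ (n + 1) := min_le_right _ _
      have : s ^ (n + 1) * Real.exp (-s) ≤ z ^ (n + 1) * 1 := by
        gcongr
        · exact hs.2
        · simpa using hs0.le
      calc _ ≤ 1 / z ^ (n + 1) * (z ^ (n + 1) * 1) := by gcongr
        _ = 1 := by field_simp
    rw [mul_add]
    refine add_le_add ?_ ?_
    · calc _ = (Real.exp τ ^ 2 * kummerM (-(Real.exp τ ^ 2)) (n + 1) s ^ 2) * δ := by ring
        _ ≤ (Real.exp τ ^ 2 * kummerM (-(Real.exp τ ^ 2)) (n + 1) s ^ 2) *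
            (s ^ n * Real.exp (-s)) := by gcongr
        _ = _ := by ring
    · have h0 : 0 ≤ s ^ (n + 1) * Real.exp (-s) * kummerD (-(Real.exp τ ^ 2)) (n + 1) s ^ 2 := by
        positivity
      calc _ = (δ * (s ^ (n + 1) * Real.exp (-s))) *
            (s ^ (n + 1) * Real.exp (-s) * kummerD (-(Real.exp τ ^ 2)) (n + 1) s ^ 2) := by
            simp only [kummerFlux]; ring
        _ ≤ 1 * (s ^ (n + 1) * Real.exp (-s) * kummerD (-(Real.exp τ ^ 2)) (n + 1) s ^ 2) := by
            gcongr
        _ = _ := one_mul _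
  have h3 := intervalIntegral.integral_add_adjacent_intervals (hint 0 (z / 2)) (hint (z / 2) z)
  rw [intervalIntegral.integral_const, smul_eq_mul] at h2
  simp only [pruferAngle]
  rw [← h3]
  linarith

/-- As τ grows, the continuous angle at z runs down to -∞ and so takes every sufficiently low value
-(π/2 + jπ). Each of these gives a root -e^{2τ}, and different angles give different roots. -/
theorem infinite_roots (n : ℕ) {z : ℝ} (hz : 0 < z) :
    {r : ℝ | kummerM r (n + 1) z = 0}.Infinite := by
  set δ := min ((z / 2) ^ n * Real.exp (-z)) (1 / z ^ (n + 1))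
  have hδ : 0 < δ := lt_min (by positivity) (by positivity)
  have hbot : Tendsto (fun τ => pruferAngle n τ z) atTop atBot := by
    refine tendsto_atBot_mono (pruferAngle_le n hz) (tendsto_neg_atTop_atBot.comp ?_)
    exact ((Real.tendsto_exp_atTop.atTop_mul_const hδ).atTop_mul_const (by positivity))
  -- The shift by j₀ places all target values below the angle at τ = 0, as the intermediate value
  -- theorem requires.
  obtain ⟨j₀, hj₀⟩ := exists_nat_ge (-pruferAngle n 0 z)
  have hex : ∀ j : ℕ, ∃ τ, pruferAngle n τ z = -(Real.pi / 2 + (j₀ + j : ℕ) * Real.pi) := by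
    intro j
    have hle : -(Real.pi / 2 + (j₀ + j : ℕ) * Real.pi) ≤ pruferAngle n 0 z := by
      have : (j₀ : ℝ) * 1 ≤ (j₀ + j : ℕ) * Real.pi := by
        push_cast
        gcongr
        · simp
        · linarith [Real.pi_gt_three]
      linarith [Real.pi_pos]
    obtain ⟨τ₁, hτ₁⟩ := (hbot.eventually_le_atBot
      (-(Real.pi / 2 + (j₀ + j : ℕ) * Real.pi))).exists
    exact mem_range_of_exists_le_of_exists_ge (continuous_pruferAngle_left n z)
      ⟨τ₁, hτ₁⟩ ⟨0, hle⟩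
  choose τ hτ using hex
  refine Set.infinite_of_injective_forall_mem (f := fun j => -(Real.exp (τ j) ^ 2)) ?_ ?_
  · intro i j hij
    have h1 : Real.exp (τ i) = Real.exp (τ j) :=
      (pow_left_inj₀ (Real.exp_nonneg _) (Real.exp_nonneg _) two_ne_zero).1 (neg_injective hij)
    have h2 := Real.exp_injective h1
    have h3 := hτ i
    rw [h2, hτ j] at h3
    have h4 : ((j₀ + j : ℕ) : ℝ) = (j₀ + i : ℕ) :=
      mul_right_cancel₀ Real.pi_ne_zero (by linarith)
    have := Nat.cast_injective h4
    omega
  · intro j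
    have h := kummerFlux_mul_cos_pruferAngle n (τ j) hz.le
    have hc : Real.cos (pruferAngle n (τ j) z) = 0 := by
      rw [hτ j, Real.cos_neg, Real.cos_add_nat_mul_pi]; simp
    have hs : Real.sin (pruferAngle n (τ j) z) ≠ 0 := by
      intro hs
      have := Real.sin_sq_add_cos_sq (pruferAngle n (τ j) z)
      rw [hs, hc] at this
      simp at this
    rw [hc, mul_zero] at h
    have := (mul_eq_zero.1 h.symm).resolve_right hs
    exact (mul_eq_zero.1 this).resolve_left (Real.exp_pos _).ne'

/-! ### Enumeration of the roots -/

theorem exists_isKummerRoot (n : ℕ) {z : ℝ} (hz : 0 < z) {m : ℕ} (hm : 1 ≤ m) :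
    ∃ a, IsKummerRoot (n + 1) z m a := by
  -- Since only finitely many roots lie above any level, every set that contains a root contains a
  -- largest one. The enumeration applies this to the whole line and then to the half-line below the
  -- last root found.
  have hnext : ∀ U : Set ℝ, {r ∈ U | kummerM r (n + 1) z = 0}.Nonempty →
      ∃ a ∈ U, kummerM a (n + 1) z = 0 ∧ ∀ r ∈ U, kummerM r (n + 1) z = 0 → r ≤ a := by
    rintro U ⟨c, hcU, hc⟩
    have hfin : {r : ℝ | r ∈ U ∧ c ≤ r ∧ kummerM r (n + 1) z = 0}.Finite :=
      (finite_roots_above n hz c).subset fun r hr => hr.2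
    obtain ⟨a, ha, hmax⟩ := hfin.exists_maximalFor id _ ⟨c, hcU, le_rfl, hc⟩
    refine ⟨a, ha.1, ha.2.2, fun r hrU hr => ?_⟩
    rcases le_total c r with h | h
    · by_contra! hlt
      exact absurd (hmax ⟨hrU, h, hr⟩ hlt.le) (not_le.2 hlt)
    · exact h.trans ha.2.1
  induction m, hm using Nat.le_induction with
  | base =>
    obtain ⟨a, -, ha, hmax⟩ := hnext Set.univ (by
      simpa using (infinite_roots n hz).nonempty)
    refine ⟨a, ha, ?_⟩
    have : {a' : ℝ | a < a' ∧ kummerM a' (n + 1) z = 0} = ∅ := by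
      ext r
      simp only [Set.mem_ofPred_eq, Set.mem_empty_iff_false, iff_false, not_and]
      exact fun h1 h2 => absurd (hmax r trivial h2) (not_le.2 h1)
    simp [this]
  | succ m hm ih =>
    obtain ⟨a, ha, hcard⟩ := ih
    obtain ⟨a', ha', hr', hmax⟩ := hnext (Set.Iio a) (by
      by_contra hne
      refine infinite_roots n hz ((finite_roots_above n hz a).subset fun r hr => ⟨?_, hr⟩)
      by_contra hlt
      exact hne ⟨r, not_le.1 hlt, hr⟩)
    refine ⟨a', hr', ?_⟩
    have : {r : ℝ | a' < r ∧ kummerM r (n + 1) z = 0} =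
        insert a {r : ℝ | a < r ∧ kummerM r (n + 1) z = 0} := by
      ext r
      simp only [Set.mem_ofPred_eq, Set.mem_insert_iff]
      constructor
      · rintro ⟨h1, h2⟩
        rcases lt_trichotomy r a with h | h | h
        · exact absurd (hmax r h h2) (not_le.2 h1)
        · exact Or.inl h
        · exact Or.inr ⟨h, h2⟩
      · rintro (rfl | ⟨h1, h2⟩)
        · exact ⟨ha', ha⟩
        · exact ⟨lt_trans ha' h1, h2⟩
    rw [this, Set.encard_insert_of_notMem (by simp), hcard]
    push_cast
    rfl

theorem isKummerRoot_kummerRoot (n : ℕ) {z : ℝ} (hz : 0 < z) {m : ℕ} (hm : 1 ≤ m) :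
    IsKummerRoot (n + 1) z m (kummerRoot m (n + 1) z) :=
  Classical.epsilon_spec (exists_isKummerRoot n hz hm)

/-- The roots from the `m`-th on form a set of `m` elements. -/
theorem IsKummerRoot.encard_le_setOf {b z a : ℝ} {m : ℕ} (h : IsKummerRoot b z m a) :
    {r : ℝ | a ≤ r ∧ kummerM r b z = 0}.encard = m := by
  have : {r : ℝ | a ≤ r ∧ kummerM r b z = 0} = insert a {r : ℝ | a < r ∧ kummerM r b z = 0} := by
    ext r
    simp only [Set.mem_ofPred_eq, Set.mem_insert_iff, le_iff_lt_or_eq]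
    constructor
    · rintro ⟨h1 | h1, h2⟩
      · exact Or.inr ⟨h1, h2⟩
      · exact Or.inl h1.symm
    · rintro (rfl | h1)
      · exact ⟨Or.inr rfl, h.1⟩
      · exact ⟨Or.inl h1.1, h1.2⟩
  rw [this, Set.encard_insert_of_notMem (by simp), h.2]

theorem IsKummerRoot.lt_of_encard {b z a c : ℝ} {m : ℕ} (h : IsKummerRoot b z m a)
    (hc : {r : ℝ | c ≤ r ∧ kummerM r b z = 0}.encard < m) : a < c := by
  by_contra! hca
  refine absurd hc (not_lt.2 ?_)
  rw [← h.encard_le_setOf]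
  exact Set.encard_le_encard fun r hr => ⟨hca.trans hr.1, hr.2⟩

theorem IsKummerRoot.lt_of_le_encard {b z a c : ℝ} {m : ℕ} (h : IsKummerRoot b z m a)
    (hc : (m : ℕ∞) ≤ {r : ℝ | c < r ∧ kummerM r b z = 0}.encard) : c < a := by
  by_contra! hca
  have hle : {r : ℝ | c < r ∧ kummerM r b z = 0}.encard ≤
      {r : ℝ | a < r ∧ kummerM r b z = 0}.encard :=
    Set.encard_le_encard fun r hr => ⟨hca.trans_lt hr.1, hr.2⟩
  have h1 := hc.trans hle
  rw [← h.2] at h1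
  have hfin : {r : ℝ | a < r ∧ kummerM r b z = 0}.encard ≠ ⊤ := by
    intro htop
    have := h.2
    simp [htop] at this
  exact absurd h1 (not_le.2 ((ENat.lt_add_one_iff hfin).2 le_rfl))

theorem IsKummerRoot.lt_of_succ {b z a a' : ℝ} {m : ℕ} (h : IsKummerRoot b z m a)
    (h' : IsKummerRoot b z (m + 1) a') : a' < a := by
  refine h'.lt_of_encard ?_
  rw [h.encard_le_setOf]
  exact_mod_cast Nat.lt_succ_self m

/-- The upper bound `a_m < -(m-1)`. -/
theorem IsKummerRoot.lt_neg {n : ℕ} {z a : ℝ} (hz : 0 < z) {m : ℕ}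
    (h : IsKummerRoot (n + 1) z (m + 1) a) : a < -(m : ℝ) := by
  refine h.lt_of_encard ?_
  have hfin := finite_roots_above n hz (-(m : ℝ))
  rw [hfin.encard_eq_coe_toFinset_card]
  have := card_roots_le n m hz hfin.toFinset (fun r hr => by
    have := hfin.mem_toFinset.1 hr
    exact ⟨this.2, this.1⟩)
  exact_mod_cast Nat.lt_succ_iff.2 this

theorem exists_isKummerRoot_of_eq_zero (n : ℕ) {z a : ℝ} (hz : 0 < z)
    (ha : kummerM a (n + 1) z = 0) : ∃ m, 1 ≤ m ∧ IsKummerRoot (n + 1) z m a := by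
  have hfin : {r : ℝ | a < r ∧ kummerM r (n + 1) z = 0}.Finite :=
    (finite_roots_above n hz a).subset fun r hr => ⟨hr.1.le, hr.2⟩
  refine ⟨hfin.toFinset.card + 1, by omega, ha, ?_⟩
  rw [hfin.encard_eq_coe_toFinset_card]
  push_cast
  rfl


/-! ### The large-`z` behaviour of the roots -/

/-- Coefficients of the tail of Kummer's series at `a = -N-δ` after the `N`-th term, with
`(a)_{N+1}` factored out. -/
def tailCoeff (d N : ℕ) (δ : ℝ) (j : ℕ) : ℝ :=
  (ascPochhammer ℝ j).eval (1 - δ) /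
    ((ascPochhammer ℝ (j + N + 1)).eval ((d : ℝ) + 1) * ((j + N + 1).factorial : ℝ))

/-- The tail of Kummer's series at `a = -N-δ`, with `(a)_{N+1}` factored out. -/
def kummerTail (d N : ℕ) (δ z : ℝ) : ℝ := ∑' j, tailCoeff d N δ j * z ^ (j + N + 1)

/-- The first `N + 1` terms of Kummer's series at `a = -N-δ`, divided by `(a)_N`. -/
def kummerHead (d N : ℕ) (δ z : ℝ) : ℝ :=
  ∑ k ∈ Finset.range (N + 1), kummerCoeff (-(N : ℝ) - δ) (d + 1) k /
    (ascPochhammer ℝ N).eval (-(N : ℝ) - δ) * z ^ k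

theorem ascPochhammer_eval_nonneg {x : ℝ} (hx : 0 ≤ x) (k : ℕ) :
    0 ≤ (ascPochhammer ℝ k).eval x := by
  induction k with
  | zero => simp
  | succ k ih => rw [ascPochhammer_succ_eval]; positivity

theorem ascPochhammer_eval_mono {x y : ℝ} (hx : 0 ≤ x) (hxy : x ≤ y) (k : ℕ) :
    (ascPochhammer ℝ k).eval x ≤ (ascPochhammer ℝ k).eval y := by
  induction k with
  | zero => simp
  | succ k ih =>
    rw [ascPochhammer_succ_eval, ascPochhammer_succ_eval]
    have := ascPochhammer_eval_nonneg (hx.trans hxy) k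
    gcongr

theorem ascPochhammer_eval_one_eq (k : ℕ) : (ascPochhammer ℝ k).eval (1 : ℝ) = k.factorial := by
  simp

theorem factorial_le_ascPochhammer (d k : ℕ) :
    (k.factorial : ℝ) ≤ (ascPochhammer ℝ k).eval ((d : ℝ) + 1) := by
  rw [← ascPochhammer_eval_one_eq]
  exact ascPochhammer_eval_mono zero_le_one (by simp) k

theorem ascPochhammer_eval_natCast_add_one (d k : ℕ) :
    (ascPochhammer ℝ k).eval ((d : ℝ) + 1) = ((d + k).factorial : ℝ) / d.factorial := by
  have h : (d.factorial : ℝ) ≠ 0 := by positivity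
  induction k with
  | zero => simp [h]
  | succ k ih =>
    rw [ascPochhammer_succ_eval, ih, ← add_assoc, Nat.factorial_succ]
    push_cast
    field_simp
    ring

theorem tailCoeff_nonneg {d N : ℕ} {δ : ℝ} (hδ : δ ≤ 1) (j : ℕ) : 0 ≤ tailCoeff d N δ j := by
  have h1 := ascPochhammer_eval_nonneg (by linarith : 0 ≤ 1 - δ) j
  have h2 := ascPochhammer_eval_pos (by positivity : 0 < (d : ℝ) + 1) (j + N + 1)
  unfold tailCoeff
  positivity

theorem tailCoeff_le_zero {d N : ℕ} {δ : ℝ} (h0 : 0 ≤ δ) (hδ : δ ≤ 1) (j : ℕ) :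
    tailCoeff d N δ j ≤ tailCoeff d N 0 j := by
  have h2 := ascPochhammer_eval_pos (by positivity : 0 < (d : ℝ) + 1) (j + N + 1)
  unfold tailCoeff
  gcongr
  exact ascPochhammer_eval_mono (by linarith) (by linarith) j

theorem tailCoeff_zero_le (d N j : ℕ) : tailCoeff d N 0 j ≤ 1 / ((j + N + 1).factorial : ℝ) := by
  have h1 := factorial_le_ascPochhammer d (j + N + 1)
  have h3 : (j.factorial : ℝ) ≤ ((j + N + 1).factorial : ℝ) := by
    exact_mod_cast Nat.factorial_le (by omega)
  have h4 : (0 : ℝ) < ((j + N + 1).factorial : ℝ) := by positivity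
  have h5 := h4.trans_le h1
  unfold tailCoeff
  rw [sub_zero, ascPochhammer_eval_one_eq, div_le_div_iff₀ (by positivity) h4, one_mul]
  gcongr
  exact h3.trans h1

theorem tailCoeff_zero_succ (d N j : ℕ) :
    tailCoeff d N 0 (j + 1) =
      tailCoeff d N 0 j * ((j + 1) / (((d : ℝ) + 1 + (j + N + 1)) * (j + N + 2))) := by
  unfold tailCoeff
  rw [show j + 1 + N + 1 = j + N + 1 + 1 by ring, ascPochhammer_succ_eval, ascPochhammer_succ_eval,
    Nat.factorial_succ (j + N + 1)]
  push_cast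
  field_simp
  ring

theorem summable_tail {d N : ℕ} {δ z : ℝ} (h0 : 0 ≤ δ) (hδ : δ ≤ 1) (hz : 0 ≤ z) :
    Summable fun j => tailCoeff d N δ j * z ^ (j + N + 1) := by
  refine Summable.of_nonneg_of_le
    (fun j => mul_nonneg (tailCoeff_nonneg hδ j) (pow_nonneg hz _)) (fun j => ?_)
    ((summable_nat_add_iff (N + 1)).2 (Real.summable_pow_div_factorial z))
  have := (tailCoeff_le_zero (d := d) (N := N) h0 hδ j).trans (tailCoeff_zero_le d N j)
  calc _ ≤ 1 / ((j + N + 1).factorial : ℝ) * z ^ (j + N + 1) := by gcongr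
    _ = _ := by rw [← add_assoc]; ring

theorem ascPochhammer_add_eval (x : ℝ) (m k : ℕ) :
    (ascPochhammer ℝ (m + k)).eval x =
      (ascPochhammer ℝ m).eval x * (ascPochhammer ℝ k).eval (x + m) := by
  rw [← ascPochhammer_mul]
  simp [Polynomial.eval_comp]

/-- The factors of (-N-δ)_N have modulus N + δ - i ≥ 1, so the partial products do not decrease.
This bounds the coefficients of the head uniformly in δ. -/
theorem abs_ascPochhammer_le {N : ℕ} {δ : ℝ} (hδ : 0 ≤ δ) {k : ℕ} (hk : k ≤ N) :
    |(ascPochhammer ℝ k).eval (-(N : ℝ) - δ)| ≤ |(ascPochhammer ℝ N).eval (-(N : ℝ) - δ)| := by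
  have key : ∀ M, k ≤ M → M ≤ N → |(ascPochhammer ℝ k).eval (-(N : ℝ) - δ)| ≤
      |(ascPochhammer ℝ M).eval (-(N : ℝ) - δ)| := by
    intro M hM
    induction M, hM using Nat.le_induction with
    | base => exact fun _ => le_rfl
    | succ M hM ih =>
      intro hMN
      refine (ih (by omega)).trans ?_
      rw [ascPochhammer_succ_eval, abs_mul]
      refine le_mul_of_one_le_right (abs_nonneg _) ?_
      have : (M : ℝ) + 1 ≤ N := by exact_mod_cast hMN
      rw [abs_of_nonpos (by linarith)]
      linarith
  exact key N hk le_rfl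

theorem ascPochhammer_neg_ne_zero {N : ℕ} {δ : ℝ} (hδ : 0 ≤ δ) :
    (ascPochhammer ℝ N).eval (-(N : ℝ) - δ) ≠ 0 := by
  have := abs_ascPochhammer_le (N := N) hδ (Nat.zero_le N)
  simp only [ascPochhammer_zero, Polynomial.eval_one, abs_one] at this
  exact abs_pos.1 (by linarith)

/-- For a = -N - δ one has (a)_{N+1} = (a)_N (a + N) = -δ (a)_N, and the remaining factors of
(a)_{N+1+j} form (1-δ)_j. The root equation thus becomes δ = head/tail. -/
theorem kummerM_eq_head_sub_tail (d N : ℕ) {δ z : ℝ} (hδ : 0 ≤ δ) :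
    kummerM (-(N : ℝ) - δ) (d + 1) z / (ascPochhammer ℝ N).eval (-(N : ℝ) - δ) =
      kummerHead d N δ z - δ * kummerTail d N δ z := by
  have hA := ascPochhammer_neg_ne_zero (N := N) hδ
  rw [div_eq_iff hA]
  have h := (summable_kummer (one_le_natCast_add_one d) (-(N : ℝ) - δ) z).sum_add_tsum_nat_add
    (N + 1)
  rw [kummerM_eq_tsum, ← h, kummerHead, kummerTail, sub_mul, Finset.sum_mul, mul_right_comm,
    ← tsum_mul_left, sub_eq_add_neg (Finset.sum _ _), ← tsum_neg]
  congr 1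
  · refine Finset.sum_congr rfl fun k _ => ?_
    field_simp
  · refine tsum_congr fun j => ?_
    rw [kummerCoeff, tailCoeff, show j + (N + 1) = N + 1 + j by ring, ascPochhammer_add_eval,
      ascPochhammer_succ_eval, show N + 1 + j = j + N + 1 by ring]
    push_cast
    rw [show -(N : ℝ) - δ + (N + 1) = 1 - δ by ring]
    ring

/-- The top term does not depend on δ, and each of the N lower terms has a coefficient of modulus at
most 1. For N = 0 the truncated exponent is harmless, since the factor N vanishes. -/
theorem kummerHead_sub_le (d N : ℕ) {δ z : ℝ} (hδ : 0 ≤ δ) (hz : 1 ≤ z) :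
    |kummerHead d N δ z - z ^ N / ((ascPochhammer ℝ N).eval ((d : ℝ) + 1) * N.factorial)| ≤
      N * z ^ (N - 1) := by
  have hA := ascPochhammer_neg_ne_zero (N := N) hδ
  rw [kummerHead, Finset.sum_range_succ]
  have e : kummerCoeff (-(N : ℝ) - δ) (d + 1) N / (ascPochhammer ℝ N).eval (-(N : ℝ) - δ) * z ^ N =
      z ^ N / ((ascPochhammer ℝ N).eval ((d : ℝ) + 1) * N.factorial) := by
    rw [kummerCoeff]; field_simp
  rw [e, add_sub_cancel_right]
  refine (Finset.abs_sum_le_sum_abs _ _).trans ?_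
  refine (Finset.sum_le_card_nsmul _ _ (z ^ (N - 1)) fun k hk => ?_).trans (by simp)
  have hk' : k < N := Finset.mem_range.1 hk
  have h1 := factorial_le_ascPochhammer d k
  have h2 : (1 : ℝ) ≤ k.factorial := by exact_mod_cast Nat.factorial_pos k
  have h3 := abs_ascPochhammer_le hδ hk'.le
  rw [abs_mul, abs_div, kummerCoeff, abs_div, abs_of_nonneg (by positivity : (0 : ℝ) ≤ z ^ k),
    abs_of_pos (a := _ * (k.factorial : ℝ)) (by nlinarith)]
  have h5 : |(ascPochhammer ℝ k).eval (-(N : ℝ) - δ)| /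
      ((ascPochhammer ℝ k).eval ((d : ℝ) + 1) * (k.factorial : ℝ)) /
      |(ascPochhammer ℝ N).eval (-(N : ℝ) - δ)| ≤ 1 := by
    have hpos : 0 < |(ascPochhammer ℝ N).eval (-(N : ℝ) - δ)| := abs_pos.2 hA
    rw [div_le_one hpos]
    refine (div_le_self (abs_nonneg _) ?_).trans h3
    nlinarith
  calc _ ≤ 1 * z ^ k := by gcongr
    _ ≤ z ^ (N - 1) := by rw [one_mul]; exact pow_le_pow_right₀ hz (by omega)

/-- The term j = 1 alone suffices. It exceeds the order z^N of the head by two powers of z, which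
later yields δ = O(z^{-2}). -/
theorem kummerTail_ge (d N : ℕ) {δ z : ℝ} (h0 : 0 ≤ δ) (hδ : δ ≤ 1 / 2) (hz : 0 ≤ z) :
    1 / 2 / ((ascPochhammer ℝ (N + 2)).eval ((d : ℝ) + 1) * ((N + 2).factorial : ℝ)) * z ^ (N + 2)
      ≤ kummerTail d N δ z := by
  have h := (summable_tail (d := d) (N := N) h0 (by linarith) hz).le_tsum 1
    (fun j _ => mul_nonneg (tailCoeff_nonneg (by linarith) j) (pow_nonneg hz _))
  refine le_trans ?_ h
  rw [show 1 + N + 1 = N + 2 by ring]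
  refine mul_le_mul_of_nonneg_right ?_ (pow_nonneg hz _)
  have h2 := ascPochhammer_eval_pos (by positivity : 0 < (d : ℝ) + 1) (N + 2)
  rw [tailCoeff, show 1 + N + 1 = N + 2 by ring]
  gcongr
  simp
  linarith

/-- A Bernoulli inequality for the product of the factors 1 - δ/i, 1 ≤ i ≤ j. -/
theorem factorial_mul_le_ascPochhammer {δ : ℝ} (h0 : 0 ≤ δ) (hδ : δ ≤ 1) (j : ℕ) :
    (j.factorial : ℝ) * (1 - δ * j) ≤ (ascPochhammer ℝ j).eval (1 - δ) := by
  induction j with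
  | zero => simp
  | succ j ih =>
    rcases le_total 0 (1 - δ * j) with h | h
    · rw [ascPochhammer_succ_eval, Nat.factorial_succ]
      push_cast
      have hj : (0 : ℝ) ≤ j := by positivity
      have hf : (0 : ℝ) ≤ j.factorial := by positivity
      calc _ = (j.factorial : ℝ) * ((j + 1) * (1 - δ * (j + 1))) := by ring
        _ ≤ (j.factorial : ℝ) * ((1 - δ * j) * (1 - δ + j)) := by
            refine mul_le_mul_of_nonneg_left ?_ hf
            nlinarith [mul_nonneg h0 hj, mul_nonneg (mul_nonneg h0 h0) hj]
        _ = (j.factorial : ℝ) * (1 - δ * j) * (1 - δ + j) := by ring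
        _ ≤ _ := by gcongr
    · have h1 := ascPochhammer_eval_nonneg (by linarith : 0 ≤ 1 - δ) (j + 1)
      refine le_trans ?_ h1
      apply mul_nonpos_of_nonneg_of_nonpos (by positivity)
      push_cast
      linarith

theorem kummerTail_le_zero (d N : ℕ) {δ z : ℝ} (h0 : 0 ≤ δ) (hδ : δ ≤ 1) (hz : 0 ≤ z) :
    kummerTail d N δ z ≤ kummerTail d N 0 z :=
  (summable_tail h0 hδ hz).tsum_le_tsum
    (fun j => mul_le_mul_of_nonneg_right (tailCoeff_le_zero h0 hδ j) (pow_nonneg hz _))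
    (summable_tail le_rfl zero_le_one hz)

/-- The term j = 0 is independent of δ, and the relative change of the j-th term is at most δj. The
factor j is absorbed by passing from the j-th coefficient to the preceding one, at the price of one
power of z. -/
theorem kummerTail_zero_sub_le (d N : ℕ) {δ z : ℝ} (h0 : 0 ≤ δ) (hδ : δ ≤ 1) (hz : 0 ≤ z) :
    kummerTail d N 0 z - kummerTail d N δ z ≤ δ * z * kummerTail d N 0 z := by
  have s0 := summable_tail (d := d) (N := N) le_rfl zero_le_one hz
  have s1 := summable_tail (d := d) (N := N) h0 hδ hz
  have s2 := s0.sub s1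
  rw [kummerTail, kummerTail, ← s0.tsum_sub s1, s2.tsum_eq_zero_add, ← tsum_mul_left]
  have e0 : tailCoeff d N 0 0 * z ^ (0 + N + 1) - tailCoeff d N δ 0 * z ^ (0 + N + 1) = 0 := by
    simp [tailCoeff]
  rw [e0, zero_add]
  refine ((summable_nat_add_iff 1).2 s2).tsum_le_tsum (fun j => ?_) (s0.mul_left _)
  have h2 := ascPochhammer_eval_pos (by positivity : 0 < (d : ℝ) + 1) (j + 1 + N + 1)
  have h3 : tailCoeff d N 0 (j + 1) - tailCoeff d N δ (j + 1) ≤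
      δ * (j + 1) * tailCoeff d N 0 (j + 1) := by
    have := factorial_mul_le_ascPochhammer h0 hδ (j + 1)
    rw [tailCoeff, tailCoeff, sub_zero, ascPochhammer_eval_one_eq, ← sub_div, ← mul_div_assoc]
    gcongr
    push_cast at this
    linarith
  have h4 : (j + 1) * tailCoeff d N 0 (j + 1) ≤ tailCoeff d N 0 j := by
    rw [tailCoeff_zero_succ]
    have ht := tailCoeff_nonneg (d := d) (N := N) zero_le_one j
    have hle : ((j : ℝ) + 1) * ((j + 1) / (((d : ℝ) + 1 + (j + N + 1)) * (j + N + 2))) ≤ 1 := by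
      rw [← mul_div_assoc, div_le_one (by positivity)]
      exact mul_le_mul (by linarith) (by linarith) (by positivity) (by positivity)
    calc _ = tailCoeff d N 0 j *
          (((j : ℝ) + 1) * ((j + 1) / (((d : ℝ) + 1 + (j + N + 1)) * (j + N + 2)))) := by ring
      _ ≤ tailCoeff d N 0 j * 1 := by gcongr
      _ = _ := mul_one _
  calc _ = (tailCoeff d N 0 (j + 1) - tailCoeff d N δ (j + 1)) * z ^ (j + N + 1) * z := by ring
    _ ≤ (δ * (j + 1) * tailCoeff d N 0 (j + 1)) * z ^ (j + N + 1) * z := by gcongr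
    _ = δ * ((j + 1) * tailCoeff d N 0 (j + 1)) * z ^ (j + N + 1) * z := by ring
    _ ≤ δ * tailCoeff d N 0 j * z ^ (j + N + 1) * z := by gcongr
    _ = _ := by ring

/-! #### The tail at `δ = 0` -/

theorem one_add_pow_le {D x : ℝ} (hx : 0 ≤ x) (hxD : x ≤ D) (M : ℕ) :
    (1 + x) ^ M ≤ 1 + M * (1 + D) ^ M * x := by
  induction M with
  | zero => simp
  | succ M ih =>
    have hD : 0 ≤ D := hx.trans hxD
    have h1 : 1 ≤ (1 + D) ^ (M + 1) := one_le_pow₀ (by linarith)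
    rw [pow_succ]
    push_cast
    calc (1 + x) ^ M * (1 + x) ≤ (1 + M * (1 + D) ^ M * x) * (1 + x) := by gcongr
      _ = 1 + x + M * ((1 + D) ^ M * (1 + x)) * x := by ring
      _ ≤ 1 + (1 + D) ^ (M + 1) * x + M * ((1 + D) ^ M * (1 + D)) * x := by
          gcongr
          exact le_mul_of_one_le_left hx h1
      _ = _ := by ring

/-- The ratio `∏ (j+N+d+2+i)/(j+1+i)` of the tail coefficients to those of the exponential. -/
def tailRatio (d N j : ℕ) : ℝ :=
  ∏ i ∈ Finset.range (N + 1), (((j : ℝ) + N + d + 2 + i) / (j + 1 + i))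

theorem prod_range_add_factorial (j M : ℕ) :
    ∏ i ∈ Finset.range M, ((j : ℝ) + 1 + i) = ((j + M).factorial : ℝ) / j.factorial := by
  induction M with
  | zero => simp [(by positivity : (j.factorial : ℝ) ≠ 0)]
  | succ M ih =>
    rw [Finset.prod_range_succ, ih, ← add_assoc, Nat.factorial_succ]
    push_cast
    ring

/-- At δ = 0 every Pochhammer symbol is a quotient of factorials, and the tail becomes an
exponential series shifted by 2N + d + 2 with weights close to 1. -/
theorem tailCoeff_zero_eq (d N j : ℕ) :
    tailCoeff d N 0 j = d.factorial * tailRatio d N j / ((j + (2 * N + d + 2)).factorial : ℝ) := by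
  have e1 : ∏ i ∈ Finset.range (N + 1), ((j : ℝ) + N + d + 2 + i) =
      ((j + (2 * N + d + 2)).factorial : ℝ) / ((j + N + d + 1).factorial : ℝ) := by
    have := prod_range_add_factorial (j + N + d + 1) (N + 1)
    rw [show j + N + d + 1 + (N + 1) = j + (2 * N + d + 2) by ring] at this
    rw [← this]
    refine Finset.prod_congr rfl fun i _ => ?_
    push_cast; ring
  rw [tailRatio, Finset.prod_div_distrib, e1, prod_range_add_factorial, tailCoeff, sub_zero,
    ascPochhammer_eval_one_eq, ascPochhammer_eval_natCast_add_one,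
    show d + (j + N + 1) = j + N + d + 1 by ring, show j + (N + 1) = j + N + 1 by ring]
  field_simp

theorem one_le_tailRatio (d N j : ℕ) : 1 ≤ tailRatio d N j := by
  refine Finset.one_le_prod fun i _ => ?_
  rw [one_le_div (by positivity)]
  have : (0 : ℝ) ≤ N + d + 1 := by positivity
  linarith

/-- Each of the N + 1 factors is at most 1 + (N+d+1)/(j+1). The error is expressed through j + K +
1, K = 2N + d + 2, because this denominator turns (j+K)! into (j+K+1)! in the exponential series. -/
theorem exists_tailRatio_le (d N : ℕ) :
    ∃ C : ℝ, 0 ≤ C ∧ ∀ j : ℕ, tailRatio d N j ≤ 1 + C / (j + (2 * N + d + 2) + 1) := by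
  set D : ℝ := N + d + 1 with hD
  have hD0 : 0 ≤ D := by positivity
  set C₁ : ℝ := ((N + 1 : ℕ) : ℝ) * (1 + D) ^ (N + 1) * D with hC₁
  have hC₁0 : 0 ≤ C₁ := by positivity
  refine ⟨C₁ * (2 * N + d + 3), by positivity, fun j => ?_⟩
  have h1 : tailRatio d N j ≤ (1 + D / (j + 1)) ^ (N + 1) := by
    refine (Finset.prod_le_prod (fun i _ => by positivity)
      (g := fun _ => 1 + D / ((j : ℝ) + 1)) fun i _ => ?_).trans (by simp)
    have : ((j : ℝ) + N + d + 2 + i) / (j + 1 + i) = 1 + D / (j + 1 + i) := by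
      rw [hD]; field_simp; ring
    rw [this]
    gcongr 1 + D / ?_
    linarith
  have h2 := one_add_pow_le (D := D) (x := D / (j + 1)) (by positivity)
    (div_le_self hD0 (by linarith)) (N + 1)
  refine h1.trans (h2.trans ?_)
  have h3 : ((N + 1 : ℕ) : ℝ) * (1 + D) ^ (N + 1) * (D / (j + 1)) = C₁ / (j + 1) := by
    rw [hC₁]; ring
  rw [h3]
  gcongr 1 + ?_
  rw [div_le_div_iff₀ (by positivity) (by positivity), mul_assoc C₁]
  refine mul_le_mul_of_nonneg_left ?_ hC₁0
  have : (0 : ℝ) ≤ j * (2 * N + d + 2) := by positivity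
  linarith

/-- `T(0,z) = d! e^z z^{-(N+d+1)} (1 + O(1/z))`. -/
theorem exists_kummerTail_zero_bounds (d N : ℕ) : ∃ C : ℝ, ∀ z : ℝ, 0 < z →
    |kummerTail d N 0 z / (d.factorial * Real.exp z / z ^ (N + d + 1)) - 1| ≤ C / z := by
  obtain ⟨C, hC0, hC⟩ := exists_tailRatio_le d N
  set K := 2 * N + d + 2 with hK
  refine ⟨max C (K * K), fun z hz => ?_⟩
  have hexp : HasSum (fun i : ℕ => z ^ i / (i.factorial : ℝ)) (Real.exp z) := by
    rw [Real.exp_eq_exp_ℝ]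
    exact NormedSpace.expSeries_div_hasSum_exp z
  have hterm : ∀ i : ℕ, 0 ≤ z ^ i / (i.factorial : ℝ) := fun i => by positivity
  have hsK := (summable_nat_add_iff K).2 hexp.summable
  have hsK1 := (summable_nat_add_iff (K + 1)).2 hexp.summable
  have hsplit := hexp.summable.sum_add_tsum_nat_add K
  rw [hexp.tsum_eq] at hsplit
  have hsplit1 := hexp.summable.sum_add_tsum_nat_add (K + 1)
  rw [hexp.tsum_eq] at hsplit1
  have hhead1 : 0 ≤ ∑ i ∈ Finset.range (K + 1), z ^ i / (i.factorial : ℝ) :=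
    Finset.sum_nonneg fun i _ => hterm i
  have hhead0 : 0 ≤ ∑ i ∈ Finset.range K, z ^ i / (i.factorial : ℝ) :=
    Finset.sum_nonneg fun i _ => hterm i
  -- Each of the K omitted terms of the exponential series is O(e^z/z), since z^i/i! is (i+1)/z
  -- times the next term, which is at most e^z.
  have hhead : (∑ i ∈ Finset.range K, z ^ i / (i.factorial : ℝ)) ≤ K * (K * (Real.exp z / z)) := by
    refine (Finset.sum_le_card_nsmul _ _ (K * (Real.exp z / z)) fun i hi => ?_).trans
      (by simp)
    have hiK : i + 1 ≤ K := Finset.mem_range.1 hi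
    have h1 : z ^ (i + 1) / ((i + 1).factorial : ℝ) ≤ Real.exp z :=
      le_hasSum hexp (i + 1) fun j _ => hterm j
    have h2 : z ^ i / (i.factorial : ℝ) =
        ((i + 1 : ℕ) : ℝ) * (z ^ (i + 1) / ((i + 1).factorial : ℝ) / z) := by
      rw [Nat.factorial_succ]; push_cast
      have h3 : (i.factorial : ℝ) ≠ 0 := by positivity
      have h4 : (i : ℝ) + 1 ≠ 0 := by positivity
      field_simp
      ring
    rw [h2]
    have : ((i + 1 : ℕ) : ℝ) ≤ K := by exact_mod_cast hiK
    gcongr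
  have hT : kummerTail d N 0 z / (d.factorial * Real.exp z / z ^ (N + d + 1)) =
      (∑' j : ℕ, tailRatio d N j * (z ^ (j + K) / ((j + K).factorial : ℝ))) / Real.exp z := by
    have : kummerTail d N 0 z = d.factorial / z ^ (N + d + 1) *
        ∑' j : ℕ, tailRatio d N j * (z ^ (j + K) / ((j + K).factorial : ℝ)) := by
      rw [kummerTail, ← tsum_mul_left]
      refine tsum_congr fun j => ?_
      rw [tailCoeff_zero_eq, hK, show j + (2 * N + d + 2) = j + N + 1 + (N + d + 1) by ring,
        pow_add z (j + N + 1)]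
      have h5 : ((j + N + 1 + (N + d + 1)).factorial : ℝ) ≠ 0 := by positivity
      field_simp
    rw [this]
    field_simp
  -- The correction C/(j+K+1) raises the index of the exponential term by one, which costs exactly a
  -- factor 1/z.
  have hup : ∀ j : ℕ, tailRatio d N j * (z ^ (j + K) / ((j + K).factorial : ℝ)) ≤
      z ^ (j + K) / ((j + K).factorial : ℝ) +
        C / z * (z ^ (j + (K + 1)) / ((j + (K + 1)).factorial : ℝ)) := by
    intro j
    have h1 := mul_le_mul_of_nonneg_right (hC j) (hterm (j + K))
    refine h1.trans_eq ?_
    rw [← add_assoc j K 1, Nat.factorial_succ, pow_succ]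
    have h3 : ((j + K).factorial : ℝ) ≠ 0 := by positivity
    have h4 : (j : ℝ) + K + 1 ≠ 0 := by positivity
    have h5 : (j : ℝ) + (2 * N + d + 2) + 1 = (j : ℝ) + K + 1 := by rw [hK]; push_cast; ring
    rw [h5]
    push_cast
    field_simp
  have hlow : ∀ j : ℕ, z ^ (j + K) / ((j + K).factorial : ℝ) ≤
      tailRatio d N j * (z ^ (j + K) / ((j + K).factorial : ℝ)) := fun j =>
    le_mul_of_one_le_left (hterm _) (one_le_tailRatio d N j)
  have hsR : Summable fun j : ℕ => tailRatio d N j * (z ^ (j + K) / ((j + K).factorial : ℝ)) :=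
    Summable.of_nonneg_of_le (fun j => (hterm _).trans (hlow j)) hup
      (hsK.add (hsK1.mul_left _))
  have hS1 := hsR.tsum_le_tsum hup (hsK.add (hsK1.mul_left _))
  rw [hsK.tsum_add (hsK1.mul_left _), tsum_mul_left] at hS1
  have hS2 := hsK.tsum_le_tsum hlow hsR
  set S := ∑' j : ℕ, tailRatio d N j * (z ^ (j + K) / ((j + K).factorial : ℝ))
  have hE := Real.exp_pos z
  have hupper : S ≤ Real.exp z + C / z * Real.exp z := by
    have h6 : C / z * ∑' j : ℕ, z ^ (j + (K + 1)) / ((j + (K + 1)).factorial : ℝ) ≤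
        C / z * Real.exp z := by
      gcongr
      linarith
    linarith
  have hlower : Real.exp z - K * K / z * Real.exp z ≤ S := by
    have : (K : ℝ) * (K * (Real.exp z / z)) = K * K / z * Real.exp z := by ring
    linarith
  have e1 : S / Real.exp z - 1 = (S - Real.exp z) / Real.exp z := by field_simp
  rw [hT, e1, abs_div, abs_of_pos hE, div_le_iff₀ hE, abs_le]
  have m1 : C / z * Real.exp z ≤ max C (K * K) / z * Real.exp z := by
    gcongr; exact le_max_left _ _
  have m2 : K * K / z * Real.exp z ≤ max C (K * K) / z * Real.exp z := by
    gcongr; exact le_max_right _ _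
  constructor <;> linarith


/-! ### Arithmetic of relative errors O(1/z). -/

theorem isBigO_mul_sub_one {f g : ℝ → ℝ} (hf : (fun z => f z - 1) =O[atTop] fun z : ℝ => 1 / z)
    (hg : (fun z => g z - 1) =O[atTop] fun z : ℝ => 1 / z) :
    (fun z => f z * g z - 1) =O[atTop] fun z : ℝ => 1 / z := by
  have h0 : Tendsto (fun z : ℝ => 1 / z) atTop (𝓝 0) := by
    simpa using tendsto_inv_atTop_zero (𝕜 := ℝ)
  have h1 : (fun z : ℝ => 1 / z) =O[atTop] fun _ => (1 : ℝ) := h0.isBigO_one ℝ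
  have := (hf.mul (hg.trans h1)).add (hf.add hg |>.trans (by simpa using isBigO_refl _ _))
  refine (this.congr_left fun z => ?_).trans (by simpa using isBigO_refl _ _)
  ring

theorem isBigO_inv_sub_one {f : ℝ → ℝ} (hf : (fun z => f z - 1) =O[atTop] fun z : ℝ => 1 / z) :
    (fun z => (f z)⁻¹ - 1) =O[atTop] fun z : ℝ => 1 / z := by
  have h0 : Tendsto (fun z : ℝ => 1 / z) atTop (𝓝 0) := by
    simpa using tendsto_inv_atTop_zero (𝕜 := ℝ)
  have h1 : Tendsto f atTop (𝓝 1) := by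
    simpa using (hf.trans_tendsto h0).add_const 1
  have h2 : (fun z => (f z)⁻¹) =O[atTop] fun _ => (1 : ℝ) :=
    (h1.inv₀ one_ne_zero).isBigO_one ℝ
  have h3 := (hf.mul h2).neg_left
  simp only [mul_one] at h3
  refine h3.congr' ?_ EventuallyEq.rfl
  filter_upwards [h1.eventually_ne one_ne_zero] with z hz
  field_simp
  ring

theorem isBigO_one_div_of_le {f : ℝ → ℝ} {C : ℝ} (h : ∀ᶠ z in atTop, |f z| ≤ C / z) :
    f =O[atTop] fun z : ℝ => 1 / z := by
  refine IsBigO.of_bound C ?_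
  filter_upwards [h, eventually_gt_atTop 0] with z hz hz0
  rw [Real.norm_eq_abs, Real.norm_eq_abs, abs_of_pos (by positivity : 0 < 1 / z)]
  simpa [div_eq_mul_inv] using hz

/-! ### Roots near -N and their asymptotics. -/

theorem kummerHead_div_sub_one_le (d N : ℕ) {δ z : ℝ} (hδ : 0 ≤ δ) (hz : 1 ≤ z) :
    |kummerHead d N δ z /
        (z ^ N / ((ascPochhammer ℝ N).eval ((d : ℝ) + 1) * N.factorial)) - 1| ≤
      N * ((ascPochhammer ℝ N).eval ((d : ℝ) + 1) * N.factorial) / z := by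
  have hc := ascPochhammer_eval_pos (by positivity : 0 < (d : ℝ) + 1) N
  set c := (ascPochhammer ℝ N).eval ((d : ℝ) + 1) * N.factorial with hcdef
  have hc0 : 0 < c := by positivity
  have h := kummerHead_sub_le d N hδ hz
  rw [← hcdef] at h
  have e : kummerHead d N δ z / (z ^ N / c) - 1 = (kummerHead d N δ z - z ^ N / c) / (z ^ N / c) := by
    field_simp
  rw [e, abs_div, abs_of_pos (by positivity : 0 < z ^ N / c), div_le_iff₀ (by positivity)]
  refine h.trans (le_of_eq ?_)
  rcases N with _ | N
  · simp
  · rw [Nat.add_sub_cancel]; field_simp; ring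

theorem kummerHead_le (d N : ℕ) : ∃ C : ℝ, 0 < C ∧ ∀ δ z : ℝ, 0 ≤ δ → 1 ≤ z →
    kummerHead d N δ z ≤ C * z ^ N := by
  have hc := ascPochhammer_eval_pos (by positivity : 0 < (d : ℝ) + 1) N
  refine ⟨1 / ((ascPochhammer ℝ N).eval ((d : ℝ) + 1) * N.factorial) + N, by positivity,
    fun δ z hδ hz => ?_⟩
  have h := (abs_le.1 (kummerHead_sub_le d N hδ hz)).2
  have h1 : (N : ℝ) * z ^ (N - 1) ≤ N * z ^ N := by
    gcongr
    omega
  have h2 : z ^ N / ((ascPochhammer ℝ N).eval ((d : ℝ) + 1) * N.factorial) =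
    1 / ((ascPochhammer ℝ N).eval ((d : ℝ) + 1) * N.factorial) * z ^ N := by ring
  rw [add_mul]
  linarith

theorem kummerTail_ge' (d N : ℕ) : ∃ c : ℝ, 0 < c ∧ ∀ δ z : ℝ, 0 ≤ δ → δ ≤ 1 / 2 → 0 ≤ z →
    c * z ^ (N + 2) ≤ kummerTail d N δ z := by
  have hc := ascPochhammer_eval_pos (by positivity : 0 < (d : ℝ) + 1) (N + 2)
  exact ⟨_, by positivity, fun δ z h0 h1 hz => kummerTail_ge d N h0 h1 hz⟩

/-- Head minus δ times tail changes sign on [0, 1/2]: at δ = 0 only the positive head remains, while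
at δ = 1/2 the tail, at least of order z^{N+2}, outweighs the head, of order at most z^N. -/
theorem eventually_exists_root (d N : ℕ) : ∀ᶠ z in atTop, ∃ r : ℝ,
    -(N : ℝ) - 1 / 2 < r ∧ r < -(N : ℝ) ∧ kummerM r (d + 1) z = 0 := by
  obtain ⟨C, hC, hhead⟩ := kummerHead_le d N
  obtain ⟨c, hc, htail⟩ := kummerTail_ge' d N
  set q := (ascPochhammer ℝ N).eval ((d : ℝ) + 1) * N.factorial with hq
  have hq0 : 0 < q := by
    have := ascPochhammer_eval_pos (by positivity : 0 < (d : ℝ) + 1) N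
    positivity
  have hsq : Tendsto (fun z : ℝ => z ^ 2) atTop atTop := tendsto_pow_atTop two_ne_zero
  filter_upwards [eventually_ge_atTop 1, eventually_gt_atTop (N * q),
    hsq.eventually_gt_atTop (2 * C / c)] with z hz1 hzN hz2
  have hz0 : 0 < z := by linarith
  set Φ : ℝ → ℝ := fun δ =>
    kummerM (-(N : ℝ) - δ) (d + 1) z / (ascPochhammer ℝ N).eval (-(N : ℝ) - δ) with hΦ
  have hcont : ContinuousOn Φ (Set.Icc 0 (1 / 2)) := by
    refine ContinuousOn.div ?_ ?_ fun δ hδ => ascPochhammer_neg_ne_zero hδ.1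
    · exact ((continuous_kummerM_left (one_le_natCast_add_one d) z).comp
        (by fun_prop : Continuous fun δ : ℝ => -(N : ℝ) - δ)).continuousOn
    · exact ((ascPochhammer ℝ N).continuous.comp
        (by fun_prop : Continuous fun δ : ℝ => -(N : ℝ) - δ)).continuousOn
  have hΦ0 : 0 < Φ 0 := by
    simp only [hΦ]
    rw [kummerM_eq_head_sub_tail d N le_rfl, zero_mul, sub_zero]
    have h := kummerHead_div_sub_one_le d N le_rfl hz1
    rw [← hq] at h
    have h1 : (N : ℝ) * q / z < 1 := by rw [div_lt_one hz0]; exact hzN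
    have h2 := (abs_lt.1 (h.trans_lt h1)).1
    have h3 : 0 < kummerHead d N 0 z / (z ^ N / q) := by linarith
    exact (div_pos_iff_of_pos_right (by positivity)).1 h3
  have hΦ1 : Φ (1 / 2) < 0 := by
    simp only [hΦ]
    rw [kummerM_eq_head_sub_tail d N (by norm_num)]
    have h1 := hhead (1 / 2) z (by norm_num) hz1
    have h2 := htail (1 / 2) z (by norm_num) le_rfl hz0.le
    rw [div_lt_iff₀ hc] at hz2
    have h3 : z ^ N * (2 * C) < z ^ N * (z ^ 2 * c) := by gcongr
    have h4 : c * z ^ (N + 2) = z ^ N * (z ^ 2 * c) := by ring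
    linarith
  obtain ⟨δ, hδ, hδ0⟩ := intermediate_value_Icc' (by norm_num : (0 : ℝ) ≤ 1 / 2) hcont
    ⟨hΦ1.le, hΦ0.le⟩
  have hne0 : δ ≠ 0 := by rintro rfl; linarith
  have hne1 : δ ≠ 1 / 2 := by rintro rfl; linarith
  have hpos := lt_of_le_of_ne hδ.1 hne0.symm
  have hlt := lt_of_le_of_ne hδ.2 hne1
  refine ⟨-(N : ℝ) - δ, by linarith, by linarith, ?_⟩
  exact (div_eq_zero_iff.1 hδ0).resolve_right (ascPochhammer_neg_ne_zero hδ.1)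

/-- The intervals (-i - 1/2, -i), 0 ≤ i ≤ N, are disjoint and each contains a root, so at least N +
1 roots exceed -N - 1/2. -/
theorem eventually_lt_kummerRoot (d N : ℕ) :
    ∀ᶠ z in atTop, -(N : ℝ) - 1 / 2 < kummerRoot (N + 1) (d + 1) z := by
  have hall : ∀ᶠ z in atTop, ∀ i ∈ Finset.range (N + 1), ∃ r : ℝ,
      -(i : ℝ) - 1 / 2 < r ∧ r < -(i : ℝ) ∧ kummerM r (d + 1) z = 0 :=
    (Filter.eventually_all_finset _).2 fun i _ => eventually_exists_root d i
  filter_upwards [hall, eventually_gt_atTop 0] with z hz hz0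
  refine (isKummerRoot_kummerRoot d hz0 (by omega : 1 ≤ N + 1)).lt_of_le_encard ?_
  choose! r hr using hz
  have hinj : Set.InjOn r (Finset.range (N + 1)) := by
    intro i hi j hj hij
    have h1 := hr i (by simpa using hi)
    have h2 := hr j (by simpa using hj)
    rw [hij] at h1
    have h3 : (i : ℝ) < j + 1 := by linarith
    have h4 : (j : ℝ) < i + 1 := by linarith
    norm_cast at h3 h4
    omega
  have hcard : ((Finset.range (N + 1)).image r).card = N + 1 := by
    rw [Finset.card_image_of_injOn hinj, Finset.card_range]
  calc ((N + 1 : ℕ) : ℕ∞) = (((Finset.range (N + 1)).image r : Finset ℝ) : Set ℝ).encard := by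
        rw [Set.encard_coe_eq_coe_finsetCard, hcard]
    _ ≤ _ := by
      refine Set.encard_le_encard fun x hx => ?_
      obtain ⟨i, hi, rfl⟩ := Finset.mem_image.1 (Finset.mem_coe.1 hx)
      have h1 := hr i hi
      have h2 : (i : ℝ) ≤ N := by exact_mod_cast Nat.lt_succ_iff.1 (Finset.mem_range.1 hi)
      exact ⟨by linarith, h1.2.2⟩

theorem exists_kummerRoot_asymptotics (d N : ℕ) :
    ∃ e : ℝ → ℝ, e =O[atTop] (fun z : ℝ => 1 / z) ∧ ∀ᶠ z in atTop,
      -2 * (kummerRoot (N + 1) (d + 1) z + N) =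
        2 / (((d + N).factorial : ℝ) * N.factorial) * z ^ (d + 1 + 2 * N) * Real.exp (-z) *
          (1 + e z) := by
  set δ : ℝ → ℝ := fun z => -(N : ℝ) - kummerRoot (N + 1) (d + 1) z with hδdef
  obtain ⟨C, hC, hhead⟩ := kummerHead_le d N
  obtain ⟨c, hc, htail⟩ := kummerTail_ge' d N
  obtain ⟨C₂, hC₂⟩ := exists_kummerTail_zero_bounds d N
  set q := (ascPochhammer ℝ N).eval ((d : ℝ) + 1) * N.factorial with hq
  have hq' : q = (d + N).factorial * N.factorial / d.factorial := by
    rw [hq, ascPochhammer_eval_natCast_add_one]; ring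
  set f₁ : ℝ → ℝ := fun z => kummerHead d N (δ z) z / (z ^ N / q) with hf₁
  set f₂ : ℝ → ℝ := fun z =>
    kummerTail d N 0 z / (d.factorial * Real.exp z / z ^ (N + d + 1)) with hf₂
  set f₃ : ℝ → ℝ := fun z => kummerTail d N (δ z) z / kummerTail d N 0 z with hf₃
  have hδ : ∀ᶠ z in atTop, 1 ≤ z ∧ 0 ≤ δ z ∧ δ z ≤ 1 / 2 ∧
      δ z * kummerTail d N (δ z) z = kummerHead d N (δ z) z := by
    filter_upwards [eventually_lt_kummerRoot d N, eventually_ge_atTop 1] with z hz hz1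
    have hroot := isKummerRoot_kummerRoot d (by linarith : 0 < z) (by omega : 1 ≤ N + 1)
    have hlt := hroot.lt_neg (by linarith)
    have h0 : 0 ≤ δ z := by simp only [hδdef]; linarith
    refine ⟨hz1, h0, by simp only [hδdef]; linarith, ?_⟩
    have h := kummerM_eq_head_sub_tail d N (z := z) h0
    have e : -(N : ℝ) - δ z = kummerRoot (N + 1) (d + 1) z := by simp only [hδdef]; ring
    rw [e, hroot.1, zero_div] at h
    linarith
  have htail_pos : ∀ t z : ℝ, 0 ≤ t → t ≤ 1 / 2 → 1 ≤ z → 0 < kummerTail d N t z := by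
    intro t z h0 h1 hz
    have hz0 : 0 < z := by linarith
    exact lt_of_lt_of_le (by positivity) (htail t z h0 h1 hz0.le)
  have h₁ : (fun z => f₁ z - 1) =O[atTop] fun z : ℝ => 1 / z := by
    refine isBigO_one_div_of_le (C := N * q) ?_
    filter_upwards [hδ] with z hz
    exact kummerHead_div_sub_one_le d N hz.2.1 hz.1
  have h₂ : (fun z => f₂ z - 1) =O[atTop] fun z : ℝ => 1 / z := by
    refine isBigO_one_div_of_le (C := C₂) ?_
    filter_upwards [eventually_gt_atTop 0] with z hz using hC₂ z hz
  have h₃ : (fun z => f₃ z - 1) =O[atTop] fun z : ℝ => 1 / z := by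
    refine isBigO_one_div_of_le (C := C / c) ?_
    filter_upwards [hδ] with z ⟨hz1, h0, hhalf, heq⟩
    have hz0 : 0 < z := by linarith
    have hT0 := htail_pos 0 z le_rfl (by norm_num) hz1
    have hle := kummerTail_le_zero d N h0 (by linarith) hz0.le
    have hsub := kummerTail_zero_sub_le d N h0 (by linarith) hz0.le
    have e : f₃ z - 1 = -((kummerTail d N 0 z - kummerTail d N (δ z) z) / kummerTail d N 0 z) := by
      simp only [hf₃]; field_simp; ring
    rw [e, abs_neg, abs_of_nonneg (div_nonneg (by linarith) hT0.le), div_le_iff₀ hT0]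
    refine hsub.trans (mul_le_mul_of_nonneg_right ?_ hT0.le)
    -- The a priori bound: δ c z^{N+2} ≤ δ · tail = head ≤ C z^N. Hence δz ≤ (C/c)/z, the relative
    -- error of replacing the tail at δ by the tail at 0.
    have h4 : δ z * (c * z ^ (N + 2)) ≤ C * z ^ N := by
      refine le_trans ?_ ((heq.le).trans (hhead _ _ h0 hz1))
      exact mul_le_mul_of_nonneg_left (htail _ _ h0 hhalf hz0.le) h0
    have h5 : z ^ N * (δ z * z * (c * z)) ≤ z ^ N * C := by
      calc _ = δ z * (c * z ^ (N + 2)) := by ring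
        _ ≤ _ := h4
        _ = _ := by ring
    have h6 := le_of_mul_le_mul_left h5 (by positivity)
    rw [div_div, le_div_iff₀ (by positivity)]
    exact h6
  refine ⟨fun z => f₁ z * (f₂ z * f₃ z)⁻¹ - 1,
    isBigO_mul_sub_one h₁ (isBigO_inv_sub_one (isBigO_mul_sub_one h₂ h₃)), ?_⟩
  filter_upwards [hδ] with z ⟨hz1, h0, hhalf, heq⟩
  have hz0 : 0 < z := by linarith
  have hT0 := (htail_pos 0 z le_rfl (by norm_num) hz1).ne'
  have hT := (htail_pos (δ z) z h0 hhalf hz1).ne'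
  have hδz : -2 * (kummerRoot (N + 1) (d + 1) z + N) = 2 * δ z := by simp only [hδdef]; ring
  rw [hδz, add_sub_cancel]
  simp only [hf₁, hf₂, hf₃, ← heq, hq']
  rw [Real.exp_neg]
  have e2 : z ^ (d + 1 + 2 * N) = z ^ (N + d + 1) * z ^ N := by rw [← pow_add]; ring_nf
  rw [e2]
  field_simp


/-! ### Calculus of the magnetic gradient -/

/-- The `j`-th standard basis vector of `ℂ = ℝ²`. -/
def basisVec (j : Fin 2) : ℂ := (![1, Complex.I] : Fin 2 → ℂ) j

/-- The `j`-th real coordinate. -/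
def coord (j : Fin 2) (x : ℂ) : ℝ := ![x.re, x.im] j

/-- `u` is differentiable at `x` and `∂ⱼ u (x) = u'`. -/
def HasPartialDeriv (j : Fin 2) (u : ℂ → ℂ) (u' : ℂ) (x : ℂ) : Prop :=
  DifferentiableAt ℝ u x ∧ partialDeriv j u x = u'

theorem hasPartialDeriv_of_hasFDerivAt {j : Fin 2} {u : ℂ → ℂ} {L : ℂ →L[ℝ] ℂ} {x : ℂ}
    (h : HasFDerivAt u L x) : HasPartialDeriv j u (L (basisVec j)) x :=
  ⟨h.differentiableAt, by rw [partialDeriv, h.fderiv]; rfl⟩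

theorem HasPartialDeriv.congr_deriv {j : Fin 2} {u : ℂ → ℂ} {u' u'' : ℂ} {x : ℂ}
    (h : HasPartialDeriv j u u' x) (e : u' = u'') : HasPartialDeriv j u u'' x := e ▸ h

theorem HasPartialDeriv.add {j : Fin 2} {u v : ℂ → ℂ} {u' v' x : ℂ}
    (hu : HasPartialDeriv j u u' x) (hv : HasPartialDeriv j v v' x) :
    HasPartialDeriv j (fun x => u x + v x) (u' + v') x := by
  refine (hasPartialDeriv_of_hasFDerivAt (hu.1.hasFDerivAt.add hv.1.hasFDerivAt)).congr_deriv ?_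
  rw [← hu.2, ← hv.2]; rfl

theorem HasPartialDeriv.mul {j : Fin 2} {u v : ℂ → ℂ} {u' v' x : ℂ}
    (hu : HasPartialDeriv j u u' x) (hv : HasPartialDeriv j v v' x) :
    HasPartialDeriv j (fun x => u x * v x) (u' * v x + u x * v') x := by
  refine (hasPartialDeriv_of_hasFDerivAt (hu.1.hasFDerivAt.mul hv.1.hasFDerivAt)).congr_deriv ?_
  rw [← hu.2, ← hv.2]
  simp [partialDeriv, basisVec]
  ring

theorem hasPartialDeriv_const (j : Fin 2) (c x : ℂ) : HasPartialDeriv j (fun _ => c) 0 x :=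
  (hasPartialDeriv_of_hasFDerivAt (hasFDerivAt_const c x)).congr_deriv (by simp)

theorem HasPartialDeriv.const_mul {j : Fin 2} {u : ℂ → ℂ} {u' x : ℂ} (c : ℂ)
    (hu : HasPartialDeriv j u u' x) : HasPartialDeriv j (fun x => c * u x) (c * u') x :=
  ((hasPartialDeriv_const j c x).mul hu).congr_deriv (by simp)

theorem hasPartialDeriv_clm_pow (j : Fin 2) (σ : ℂ →L[ℝ] ℂ) (n : ℕ) (x : ℂ) :
    HasPartialDeriv j (fun x => σ x ^ n) (n * σ x ^ (n - 1) * σ (basisVec j)) x := by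
  refine (hasPartialDeriv_of_hasFDerivAt (σ.hasFDerivAt.pow n)).congr_deriv ?_
  simp

theorem hasPartialDeriv_coord (j : Fin 2) (x : ℂ) :
    HasPartialDeriv j (fun x => (coord j x : ℂ)) 1 x := by
  fin_cases j
  · refine (hasPartialDeriv_of_hasFDerivAt
      (Complex.ofRealCLM.comp Complex.reCLM).hasFDerivAt).congr_deriv ?_
    simp [basisVec]
  · refine (hasPartialDeriv_of_hasFDerivAt
      (Complex.ofRealCLM.comp Complex.imCLM).hasFDerivAt).congr_deriv ?_
    simp [basisVec]

theorem hasPartialDeriv_vectorPotential (B : ℝ) (j : Fin 2) (x : ℂ) :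
    HasPartialDeriv j (fun x => (vectorPotential B x j : ℂ)) 0 x := by
  revert j
  rw [Fin.forall_fin_two]
  constructor
  · have h := (hasPartialDeriv_of_hasFDerivAt (j := 0)
      (Complex.ofRealCLM.comp Complex.imCLM).hasFDerivAt (x := x)).const_mul (-(B / 2 : ℂ))
    have e : (fun x => (vectorPotential B x 0 : ℂ)) =
        fun x => -(B / 2 : ℂ) * (Complex.ofRealCLM.comp Complex.imCLM) x := by
      funext x
      have : vectorPotential B x 0 = B / 2 * (-x.im) := rfl
      simp [this]
    rw [e]
    exact h.congr_deriv (by simp [basisVec])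
  · have h := (hasPartialDeriv_of_hasFDerivAt (j := 1)
      (Complex.ofRealCLM.comp Complex.reCLM).hasFDerivAt (x := x)).const_mul (B / 2 : ℂ)
    have e : (fun x => (vectorPotential B x 1 : ℂ)) =
        fun x => (B / 2 : ℂ) * (Complex.ofRealCLM.comp Complex.reCLM) x := by
      funext x
      have : vectorPotential B x 1 = B / 2 * x.re := rfl
      simp [this]
    rw [e]
    exact h.congr_deriv (by simp [basisVec])

theorem hasFDerivAt_normSq (x : ℂ) : HasFDerivAt (fun x : ℂ => Complex.normSq x)
    ((2 * x.re) • Complex.reCLM + (2 * x.im) • Complex.imCLM) x := by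
  have h := ((Complex.reCLM.hasFDerivAt (x := x)).pow 2).add
    ((Complex.imCLM.hasFDerivAt (x := x)).pow 2)
  refine (h.congr_fderiv ?_).congr_of_eventuallyEq (Eventually.of_forall fun y => ?_)
  · simp
  · simp [Complex.normSq_apply, sq]

theorem hasPartialDeriv_radial (j : Fin 2) {h : ℝ → ℝ} {h' : ℝ} {x : ℂ}
    (hh : HasDerivAt h h' (Complex.normSq x)) :
    HasPartialDeriv j (fun x => (h (Complex.normSq x) : ℂ)) (h' * (2 * coord j x)) x := by
  have h1 := hh.comp_hasFDerivAt x (hasFDerivAt_normSq x)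
  refine (hasPartialDeriv_of_hasFDerivAt
    (Complex.ofRealCLM.hasFDerivAt.comp x h1)).congr_deriv ?_
  fin_cases j <;> simp [basisVec, coord]

theorem HasPartialDeriv.magneticGradient_eq {B : ℝ} {j : Fin 2} {u : ℂ → ℂ} {u' x : ℂ}
    (h : HasPartialDeriv j u u' x) :
    magneticGradient B u j x = -Complex.I * u' + vectorPotential B x j * u x := by
  rw [magneticGradient, h.2]

/-- The differential expression `(-i∇ + A)² u`. -/
def magneticLaplacian (B : ℝ) (u : ℂ → ℂ) (x : ℂ) : ℂ :=
  ∑ j, magneticGradient B (magneticGradient B u j) j x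

/-- In this gauge A_j does not depend on x_j, so (-i∂_j + A_j)² = -∂_j² - 2iA_j∂_j + A_j²; the rest
is the product rule. -/
theorem magneticGradient_magneticGradient_clm_pow_mul_radial (B : ℝ) (σ : ℂ →L[ℝ] ℂ) (n : ℕ)
    {h h' h'' : ℝ → ℝ} (hh : ∀ t, HasDerivAt h (h' t) t) (hh' : ∀ t, HasDerivAt h' (h'' t) t)
    (j : Fin 2) (x : ℂ) :
    magneticGradient B (magneticGradient B
        (fun x => σ x ^ n * (h (Complex.normSq x) : ℂ)) j) j x =
      -(n * ((n - 1 : ℕ) * σ x ^ (n - 1 - 1) * σ (basisVec j)) * σ (basisVec j)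
          * h (Complex.normSq x)
        + 2 * (n * σ x ^ (n - 1) * σ (basisVec j)) * (h' (Complex.normSq x) * (2 * coord j x))
        + σ x ^ n * (h'' (Complex.normSq x) * (2 * coord j x) * (2 * coord j x)
          + h' (Complex.normSq x) * 2))
      - 2 * Complex.I * vectorPotential B x j * (n * σ x ^ (n - 1) * σ (basisVec j)
          * h (Complex.normSq x) + σ x ^ n * (h' (Complex.normSq x) * (2 * coord j x)))
      + vectorPotential B x j ^ 2 * (σ x ^ n * h (Complex.normSq x)) := by
  have hu := fun x => (hasPartialDeriv_clm_pow j σ n x).mul (hasPartialDeriv_radial j (hh _))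
  have e1 : magneticGradient B (fun x => σ x ^ n * (h (Complex.normSq x) : ℂ)) j =
      fun x => -Complex.I * (n * σ x ^ (n - 1) * σ (basisVec j) * h (Complex.normSq x) +
        σ x ^ n * (h' (Complex.normSq x) * (2 * coord j x))) +
        vectorPotential B x j * (σ x ^ n * h (Complex.normSq x)) :=
    funext fun x => (hu x).magneticGradient_eq
  rw [e1]
  have t1 := (((hasPartialDeriv_clm_pow j σ (n - 1) x).const_mul (n : ℂ)).mul
    (hasPartialDeriv_const j (σ (basisVec j)) x)).mul (hasPartialDeriv_radial j (hh _))
  have t2 := (hasPartialDeriv_clm_pow j σ n x).mul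
    ((hasPartialDeriv_radial j (hh' _)).mul ((hasPartialDeriv_coord j x).const_mul 2))
  have t3 := (hasPartialDeriv_vectorPotential B j x).mul (hu x)
  have t := ((t1.add t2).const_mul (-Complex.I)).add t3
  rw [t.magneticGradient_eq]
  ring_nf
  simp only [Complex.I_sq]
  ring

/-- `(-i∇ + A)²` on functions `P(x) h(|x|²)`, where `P = xⁿ` (`ε = 1`) or `P = x̄ⁿ` (`ε = -1`). -/
theorem magneticLaplacian_clm_pow_mul_radial (B : ℝ) {σ : ℂ →L[ℝ] ℂ} {ε : ℝ} (hε : ε ^ 2 = 1)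
    (h1 : σ 1 = 1) (hI : σ Complex.I = ε * Complex.I) (n : ℕ)
    {h h' h'' : ℝ → ℝ} (hh : ∀ t, HasDerivAt h (h' t) t) (hh' : ∀ t, HasDerivAt h' (h'' t) t)
    (x : ℂ) :
    magneticLaplacian B (fun x => σ x ^ n * (h (Complex.normSq x) : ℂ)) x =
      σ x ^ n * ((-4 * Complex.normSq x * h'' (Complex.normSq x)
        - 4 * (n + 1) * h' (Complex.normSq x)
        + (B * (ε * n) + B ^ 2 / 4 * Complex.normSq x) * h (Complex.normSq x) : ℝ) : ℂ) := by
  have hσx : σ x = x.re + ε * x.im * Complex.I := by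
    have : x = (x.re : ℝ) • (1 : ℂ) + (x.im : ℝ) • Complex.I := by
      simp [Complex.re_add_im]
    conv_lhs => rw [this]
    rw [map_add, map_smul, map_smul, h1, hI]
    simp
    ring
  -- The prefactor n makes the truncated exponent harmless at n = 0.
  have hn : (n : ℂ) * (σ x ^ (n - 1) * σ x) = n * σ x ^ n := by
    rcases n with _ | n
    · simp
    · rw [Nat.add_sub_cancel, pow_succ]
  have hε' : (ε : ℂ) ^ 2 = 1 := by exact_mod_cast hε
  rw [magneticLaplacian, Fin.sum_univ_two,
    magneticGradient_magneticGradient_clm_pow_mul_radial B σ n hh hh',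
    magneticGradient_magneticGradient_clm_pow_mul_radial B σ n hh hh']
  have hb0 : basisVec 0 = 1 := rfl
  have hb1 : basisVec 1 = Complex.I := rfl
  have hc0 : coord 0 x = x.re := rfl
  have hc1 : coord 1 x = x.im := rfl
  have hv0 : vectorPotential B x 0 = B / 2 * (-x.im) := rfl
  have hv1 : vectorPotential B x 1 = B / 2 * x.re := rfl
  rw [hb0, hb1, hc0, hc1, hv0, hv1, h1, hI]
  have hns : (Complex.normSq x : ℂ) = x.re ^ 2 + x.im ^ 2 := by
    rw [Complex.normSq_apply]; push_cast; ring
  push_cast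
  rw [hns]
  generalize h (Complex.normSq x) = H0
  generalize h' (Complex.normSq x) = H1
  generalize h'' (Complex.normSq x) = H2
  have hI2 := Complex.I_sq
  generalize σ x ^ (n - 1) = Q at *
  generalize σ x ^ n = P at *
  generalize σ x ^ (n - 1 - 1) = Q2
  rw [hσx] at hn
  generalize ((n - 1 : ℕ) : ℂ) = n1
  -- The second derivatives of P cancel because P is harmonic: σ(1)² + σ(i)² = 1 - ε² = 0.
  linear_combination (-4 * (H1 : ℂ) + B * ε * H0) * hn - (n * n1 * Q2 * H0) * (hε' * Complex.I ^ 2)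
    + (-(n * n1 * Q2 * H0) - n * H0 * Q * x.re * B * ε) * hI2
    - (n * H0 * Q * Complex.I * B * x.im) * hε'


/-! ### Integration by parts, and smooth functions in the form domain -/

theorem contDiff_partialDeriv {u : ℂ → ℂ} (hu : ContDiff ℝ ∞ u) (j : Fin 2) :
    ContDiff ℝ ∞ (partialDeriv j u) :=
  (hu.fderiv_right (m := ∞) (by simp)).clm_apply contDiff_const

theorem contDiff_vectorPotential (B : ℝ) (j : Fin 2) :
    ContDiff ℝ ∞ fun x => (vectorPotential B x j : ℂ) := by
  have hre : ContDiff ℝ ∞ fun x : ℂ => x.re := Complex.reCLM.contDiff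
  have him : ContDiff ℝ ∞ fun x : ℂ => x.im := Complex.imCLM.contDiff
  refine Complex.ofRealCLM.contDiff.comp ?_
  revert j
  rw [Fin.forall_fin_two]
  exact ⟨contDiff_const.mul him.neg, contDiff_const.mul hre⟩

theorem contDiff_magneticGradient {u : ℂ → ℂ} (hu : ContDiff ℝ ∞ u) (B : ℝ) (j : Fin 2) :
    ContDiff ℝ ∞ (magneticGradient B u j) :=
  (contDiff_const.mul (contDiff_partialDeriv hu j)).add ((contDiff_vectorPotential B j).mul hu)

theorem contDiff_magneticLaplacian {u : ℂ → ℂ} (hu : ContDiff ℝ ∞ u) (B : ℝ) :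
    ContDiff ℝ ∞ (magneticLaplacian B u) :=
  ContDiff.sum fun j _ => contDiff_magneticGradient (contDiff_magneticGradient hu B j) B j

theorem partialDeriv_eq_zero_of_notMem_tsupport {φ : ℂ → ℂ} {x : ℂ} (hx : x ∉ tsupport φ)
    (j : Fin 2) : partialDeriv j φ x = 0 := by
  have : fderiv ℝ φ x = 0 := by
    by_contra h
    exact hx (support_fderiv_subset ℝ h)
  simp [partialDeriv, this]

theorem magneticGradient_eq_zero_of_notMem_tsupport {φ : ℂ → ℂ} {x : ℂ} (hx : x ∉ tsupport φ)
    (B : ℝ) (j : Fin 2) : magneticGradient B φ j x = 0 := by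
  simp [magneticGradient, partialDeriv_eq_zero_of_notMem_tsupport hx, image_eq_zero_of_notMem_tsupport hx]

/-- Each component is formally symmetric: the sign from integration by parts is offset by the
conjugation of i, and A is real. -/
theorem integral_mul_conj_magneticGradient {v φ : ℂ → ℂ} (hv : ContDiff ℝ ∞ v)
    (hφ : ContDiff ℝ ∞ φ) (hc : HasCompactSupport φ) (B : ℝ) (j : Fin 2) :
    ∫ x, v x * (starRingEnd ℂ) (magneticGradient B φ j x) =
      ∫ x, magneticGradient B v j x * (starRingEnd ℂ) (φ x) := by
  set ψ : ℂ → ℂ := fun x => (starRingEnd ℂ) (φ x) with hψdef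
  have hψ : ContDiff ℝ ∞ ψ := Complex.conjCLE.contDiff.comp hφ
  have hψc : HasCompactSupport ψ := hc.comp_left (g := starRingEnd ℂ) (map_zero _)
  have hφd : Differentiable ℝ φ := hφ.differentiable (by simp)
  have hψd : Differentiable ℝ ψ := hψ.differentiable (by simp)
  have hvd : Differentiable ℝ v := hv.differentiable (by simp)
  have hψ' : ∀ x, partialDeriv j ψ x = (starRingEnd ℂ) (partialDeriv j φ x) := by
    intro x
    have := (Complex.conjCLE : ℂ ≃L[ℝ] ℂ).toContinuousLinearMap.hasFDerivAt.comp x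
      (hφd x).hasFDerivAt
    have e : fderiv ℝ ψ x = _ := this.fderiv
    rw [partialDeriv, e]
    rfl
  have hψ'c : HasCompactSupport (partialDeriv j ψ) :=
    HasCompactSupport.intro hψc fun x hx => partialDeriv_eq_zero_of_notMem_tsupport hx j
  have cv := hv.continuous
  have cv' := (contDiff_partialDeriv hv j).continuous
  have cψ := hψ.continuous
  have cψ' := (contDiff_partialDeriv hψ j).continuous
  have cA := (contDiff_vectorPotential B j).continuous
  have i1 : Integrable fun x => v x * partialDeriv j ψ x :=
    (cv.mul cψ').integrable_of_hasCompactSupport hψ'c.mul_left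
  have i2 : Integrable fun x => partialDeriv j v x * ψ x :=
    (cv'.mul cψ).integrable_of_hasCompactSupport hψc.mul_left
  have i3 : Integrable fun x => v x * ψ x :=
    (cv.mul cψ).integrable_of_hasCompactSupport hψc.mul_left
  have i4 : Integrable fun x => (vectorPotential B x j * v x) * ψ x :=
    ((cA.mul cv).mul cψ).integrable_of_hasCompactSupport hψc.mul_left
  have key : ∫ x, v x * partialDeriv j ψ x = -∫ x, partialDeriv j v x * ψ x :=
    integral_mul_fderiv_eq_neg_fderiv_mul_of_integrable i2 i1 i3
      (fun x _ => hvd x) (fun x _ => hψd x)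
  have e1 : ∀ x, v x * (starRingEnd ℂ) (magneticGradient B φ j x) =
      Complex.I * (v x * partialDeriv j ψ x) + (vectorPotential B x j * v x) * ψ x := by
    intro x
    rw [hψ']
    simp only [magneticGradient, map_add, map_mul, map_neg, Complex.conj_I, Complex.conj_ofReal,
      hψdef]
    ring
  have e2 : ∀ x, magneticGradient B v j x * (starRingEnd ℂ) (φ x) =
      -Complex.I * (partialDeriv j v x * ψ x) + (vectorPotential B x j * v x) * ψ x := by
    intro x
    simp only [magneticGradient, hψdef]
    ring
  simp_rw [e1, e2]
  rw [integral_add (i1.const_mul _) i4, integral_add (i2.const_mul _) i4, integral_const_mul,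
    integral_const_mul, key]
  ring

theorem setIntegral_conj_testFunction {Ω : Set ℂ} {φ F : ℂ → ℂ} (hφ : IsTestFunction Ω φ) :
    ∫ x in Ω, F x * (starRingEnd ℂ) (φ x) = ∫ x, F x * (starRingEnd ℂ) (φ x) := by
  refine setIntegral_eq_integral_of_forall_compl_eq_zero fun x hx => ?_
  rw [image_eq_zero_of_notMem_tsupport fun h => hx (hφ.2.2 h)]
  simp

theorem setIntegral_magneticGradient {Ω : Set ℂ} {u φ : ℂ → ℂ} (hu : ContDiff ℝ ∞ u)
    (hφ : IsTestFunction Ω φ) (B : ℝ) :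
    ∫ x in Ω, ∑ j, magneticGradient B u j x * (starRingEnd ℂ) (magneticGradient B φ j x) =
      ∫ x in Ω, magneticLaplacian B u x * (starRingEnd ℂ) (φ x) := by
  rw [setIntegral_conj_testFunction hφ, setIntegral_eq_integral_of_forall_compl_eq_zero]
  · have hφ' : ∀ j, HasCompactSupport fun x => (starRingEnd ℂ) (magneticGradient B φ j x) :=
      fun j => HasCompactSupport.intro hφ.2.1 fun x hx => by
        rw [magneticGradient_eq_zero_of_notMem_tsupport hx, map_zero]
    have hφc : HasCompactSupport fun x => (starRingEnd ℂ) (φ x) :=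
      hφ.2.1.comp_left (g := starRingEnd ℂ) (map_zero _)
    simp only [magneticLaplacian, Finset.sum_mul]
    rw [integral_finsetSum, integral_finsetSum]
    · exact Finset.sum_congr rfl fun j _ => integral_mul_conj_magneticGradient
        (contDiff_magneticGradient hu B j) hφ.1 hφ.2.1 B j
    · intro j _
      exact ((contDiff_magneticGradient (contDiff_magneticGradient hu B j) B j).continuous.mul
        (Complex.continuous_conj.comp hφ.1.continuous)).integrable_of_hasCompactSupport hφc.mul_left
    · intro j _
      exact ((contDiff_magneticGradient hu B j).continuous.mul
        (Complex.continuous_conj.comp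
          (contDiff_magneticGradient hφ.1 B j).continuous)).integrable_of_hasCompactSupport
        (hφ' j).mul_left
  · intro x hx
    refine Finset.sum_eq_zero fun j _ => ?_
    rw [magneticGradient_eq_zero_of_notMem_tsupport fun h => hx (hφ.2.2 h)]
    simp

/-! ### Approximation by cutting off near the circle. -/

theorem tendsto_eLpNorm_two_of_bounded {α : Type*} [MeasurableSpace α] {μ : Measure α}
    [IsFiniteMeasure μ] {f : ℕ → α → ℂ} (hf : ∀ n, AEStronglyMeasurable (f n) μ) {C : ℝ}
    (hC : ∀ n, ∀ᵐ x ∂μ, ‖f n x‖ ≤ C) (hlim : ∀ᵐ x ∂μ, Tendsto (fun n => f n x) atTop (𝓝 0)) :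
    Tendsto (fun n => eLpNorm (f n) 2 μ) atTop (𝓝 0) := by
  have h : Tendsto (fun n => ∫⁻ x, ‖f n x‖ₑ ^ (2 : ℝ) ∂μ) atTop (𝓝 (∫⁻ _, 0 ∂μ)) := by
    refine tendsto_lintegral_of_dominated_convergence' (fun _ => ENNReal.ofReal C ^ (2 : ℝ))
      (fun n => (hf n).enorm.pow_const _) (fun n => ?_) ?_ ?_
    · filter_upwards [hC n] with x hx
      have : ‖f n x‖ₑ ≤ ENNReal.ofReal C := by
        rw [← ofReal_norm]; exact ENNReal.ofReal_le_ofReal hx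
      gcongr
    · rw [lintegral_const]
      finiteness
    · filter_upwards [hlim] with x hx
      have h1 : Tendsto (fun n => ‖f n x‖ₑ) atTop (𝓝 0) := by
        simpa [Function.comp_def] using (continuous_enorm.tendsto (0 : ℂ)).comp hx
      simpa [Function.comp_def] using
        (ENNReal.continuous_rpow_const (y := (2 : ℝ))).tendsto 0 |>.comp h1
  rw [lintegral_zero] at h
  have h2 := (ENNReal.continuous_rpow_const (y := (1 / 2 : ℝ))).tendsto 0 |>.comp h
  simp only [ENNReal.zero_rpow_of_pos (by norm_num : (0 : ℝ) < 1 / 2)] at h2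
  refine h2.congr fun n => ?_
  rw [eLpNorm_eq_lintegral_rpow_enorm_toReal (by norm_num) (by norm_num)]
  simp

theorem volume_disk_lt_top (R : ℝ) : volume (disk R) < ⊤ := measure_ball_lt_top

instance isFiniteMeasure_restrict_disk (R : ℝ) : IsFiniteMeasure (volume.restrict (disk R)) :=
  ⟨by simpa using volume_disk_lt_top R⟩

theorem measurableSet_disk (R : ℝ) : MeasurableSet (disk R) := Metric.isOpen_ball.measurableSet

theorem exists_bound_on_disk {f : ℂ → ℂ} (hf : Continuous f) (R : ℝ) :
    ∃ C, ∀ x ∈ disk R, ‖f x‖ ≤ C := by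
  obtain ⟨C, hC⟩ := (isCompact_closedBall (0 : ℂ) R).exists_bound_of_continuousOn hf.continuousOn
  exact ⟨C, fun x hx => hC x (Metric.ball_subset_closedBall hx)⟩

theorem memLp_two_of_continuous {f : ℂ → ℂ} (hf : Continuous f) (R : ℝ) :
    MemLp f 2 (volume.restrict (disk R)) := by
  obtain ⟨C, hC⟩ := exists_bound_on_disk hf R
  exact MemLp.of_bound hf.aestronglyMeasurable C
    ((ae_restrict_iff' (measurableSet_disk R)).2 (Eventually.of_forall hC))

/-- A smooth cutoff function: `0` for `t ≤ 1`, `1` for `2 ≤ t`. -/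
def cutoff (t : ℝ) : ℝ := Real.smoothTransition (t - 1)

theorem contDiff_cutoff : ContDiff ℝ ∞ cutoff :=
  Real.smoothTransition.contDiff.comp (contDiff_id.sub contDiff_const)

theorem cutoff_of_le {t : ℝ} (h : t ≤ 1) : cutoff t = 0 :=
  Real.smoothTransition.zero_of_nonpos (by linarith)

theorem cutoff_of_ge {t : ℝ} (h : 2 ≤ t) : cutoff t = 1 :=
  Real.smoothTransition.one_of_one_le (by linarith)

theorem abs_cutoff_sub_one_le (t : ℝ) : |cutoff t - 1| ≤ 1 := by
  have h0 := Real.smoothTransition.nonneg (t - 1)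
  have h1 := Real.smoothTransition.le_one (t - 1)
  rw [cutoff, abs_le]
  constructor <;> linarith

theorem deriv_cutoff_of_lt {t : ℝ} (h : t < 1) : deriv cutoff t = 0 := by
  have : cutoff =ᶠ[𝓝 t] fun _ => 0 := by
    filter_upwards [Iio_mem_nhds h] with s hs using cutoff_of_le (le_of_lt hs)
  simp [this.deriv_eq]

theorem deriv_cutoff_of_gt {t : ℝ} (h : 2 < t) : deriv cutoff t = 0 := by
  have : cutoff =ᶠ[𝓝 t] fun _ => 1 := by
    filter_upwards [Ioi_mem_nhds h] with s hs using cutoff_of_ge (le_of_lt hs)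
  simp [this.deriv_eq]

/-- The product is invariant under scaling of the argument: the growth k + 1 of the differentiated
cutoff is paid for by the distance factor that u contributes. -/
theorem exists_abs_deriv_cutoff_mul_le : ∃ K : ℝ, ∀ t, |deriv cutoff t * t| ≤ K := by
  have hc : Continuous fun t => deriv cutoff t * t :=
    (contDiff_cutoff.continuous_deriv (by simp)).mul continuous_id
  obtain ⟨K, hK⟩ := (isCompact_Icc (a := (1 : ℝ)) (b := 2)).exists_bound_of_continuousOn
    hc.continuousOn
  have hK0 : 0 ≤ K := (norm_nonneg _).trans (hK 1 ⟨le_rfl, by norm_num⟩)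
  refine ⟨K, fun t => ?_⟩
  rcases lt_or_ge t 1 with h | h
  · simpa [deriv_cutoff_of_lt h] using hK0
  · rcases lt_or_ge 2 t with h' | h'
    · simpa [deriv_cutoff_of_gt h'] using hK0
    · exact hK t ⟨h, h'⟩

theorem mem_disk_iff {R : ℝ} (hR : 0 < R) {x : ℂ} : x ∈ disk R ↔ Complex.normSq x < R ^ 2 := by
  rw [disk, mem_ball_zero_iff, Complex.normSq_eq_norm_sq, sq_lt_sq₀ (norm_nonneg _) hR.le]

theorem abs_coord_le_norm (j : Fin 2) (x : ℂ) : |coord j x| ≤ ‖x‖ := by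
  revert j
  rw [Fin.forall_fin_two]
  exact ⟨Complex.abs_re_le_norm x, Complex.abs_im_le_norm x⟩

theorem contDiff_normSq : ContDiff ℝ ∞ fun x : ℂ => Complex.normSq x := by
  have hre : ContDiff ℝ ∞ fun x : ℂ => x.re := Complex.reCLM.contDiff
  have him : ContDiff ℝ ∞ fun x : ℂ => x.im := Complex.imCLM.contDiff
  simp_rw [Complex.normSq_apply]
  exact (hre.mul hre).add (him.mul him)

/-- A function smooth on the plane and vanishing to first order on the circle of radius `R` lies in
the form domain. -/
theorem inFormDomain_of_contDiff {R : ℝ} (hR : 0 < R) (B : ℝ) {u : ℂ → ℂ} (hu : ContDiff ℝ ∞ u)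
    {C : ℝ} (hC : ∀ x ∈ disk R, ‖u x‖ ≤ C * (R ^ 2 - Complex.normSq x)) :
    InFormDomain (disk R) B u (magneticGradient B u) := by
  refine ⟨memLp_two_of_continuous hu.continuous R, fun j => memLp_two_of_continuous
    (contDiff_magneticGradient hu B j).continuous R, ?_⟩
  -- The cutoff removes a boundary layer of width about 1/(k+1) in |x|². At a fixed interior point
  -- it is locally constant equal to 1 once k is large.
  set h : ℕ → ℝ → ℝ := fun k t => cutoff ((k + 1) * (R ^ 2 - t)) with hh
  have hderiv : ∀ k t, HasDerivAt (h k)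
      (deriv cutoff ((k + 1) * (R ^ 2 - t)) * (-((k : ℝ) + 1))) t := by
    intro k t
    have h1 : HasDerivAt (fun t : ℝ => ((k : ℝ) + 1) * (R ^ 2 - t)) (-((k : ℝ) + 1)) t := by
      simpa using ((hasDerivAt_id t).const_sub (R ^ 2)).const_mul ((k : ℝ) + 1)
    exact ((contDiff_cutoff.differentiable (by simp)) _).hasDerivAt.comp t h1
  set φ : ℕ → ℂ → ℂ := fun k x => (h k (Complex.normSq x) : ℂ) * u x with hφ
  have hsmooth : ∀ k, ContDiff ℝ ∞ (φ k) := by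
    intro k
    refine ContDiff.mul ?_ hu
    exact Complex.ofRealCLM.contDiff.comp
      (contDiff_cutoff.comp (contDiff_const.mul (contDiff_const.sub contDiff_normSq)))
  have hgrad : ∀ k j x, magneticGradient B (φ k) j x - magneticGradient B u j x =
      ((h k (Complex.normSq x) - 1 : ℝ) : ℂ) * magneticGradient B u j x +
      2 * Complex.I * ((deriv cutoff ((k + 1) * (R ^ 2 - Complex.normSq x)) * (k + 1) *
        coord j x : ℝ) : ℂ) * u x := by
    intro k j x
    have hux : HasPartialDeriv j u (partialDeriv j u x) x :=
      ⟨hu.differentiable (by simp) x, rfl⟩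
    rw [((hasPartialDeriv_radial j (hderiv k _)).mul hux).magneticGradient_eq]
    simp only [magneticGradient]
    push_cast
    ring
  have hae : ∀ {p : ℂ → Prop}, (∀ x ∈ disk R, p x) → ∀ᵐ x ∂volume.restrict (disk R), p x :=
    fun hp => (ae_restrict_iff' (measurableSet_disk R)).2 (Eventually.of_forall hp)
  have hlarge : ∀ x ∈ disk R, ∀ᶠ k : ℕ in atTop, 2 < ((k : ℝ) + 1) * (R ^ 2 - Complex.normSq x) := by
    intro x hx
    have hpos : 0 < R ^ 2 - Complex.normSq x := by linarith [(mem_disk_iff hR).1 hx]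
    exact ((tendsto_natCast_atTop_atTop.atTop_add tendsto_const_nhds).atTop_mul_const
      hpos).eventually_gt_atTop 2
  refine ⟨φ, fun k => ⟨hsmooth k, ?_⟩, ?_, fun j => ?_⟩
  · set S : Set ℂ := {x | 1 ≤ ((k : ℝ) + 1) * (R ^ 2 - Complex.normSq x)} with hS
    have hSclosed : IsClosed S := isClosed_le continuous_const
      (continuous_const.mul (continuous_const.sub contDiff_normSq.continuous))
    have hSdisk : S ⊆ disk R := by
      intro x hx
      rw [mem_disk_iff hR]
      by_contra! hle
      have hx' : 1 ≤ ((k : ℝ) + 1) * (R ^ 2 - Complex.normSq x) := hx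
      have : ((k : ℝ) + 1) * (R ^ 2 - Complex.normSq x) ≤ 0 :=
        mul_nonpos_of_nonneg_of_nonpos (by positivity) (by linarith)
      linarith
    have hsub : tsupport (φ k) ⊆ S := by
      refine closure_minimal (fun x hx => ?_) hSclosed
      by_contra hxS
      refine hx ?_
      have : ((k : ℝ) + 1) * (R ^ 2 - Complex.normSq x) ≤ 1 := (not_le.1 hxS).le
      simp [hφ, hh, cutoff_of_le this]
    refine ⟨?_, hsub.trans hSdisk⟩
    exact (isCompact_closedBall (0 : ℂ) R).of_isClosed_subset (isClosed_tsupport _)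
      ((hsub.trans hSdisk).trans Metric.ball_subset_closedBall)
  · obtain ⟨M, hM⟩ := exists_bound_on_disk hu.continuous R
    have e : ∀ k x, φ k x - u x = ((h k (Complex.normSq x) - 1 : ℝ) : ℂ) * u x := by
      intro k x; simp only [hφ]; push_cast; ring
    refine tendsto_eLpNorm_two_of_bounded (C := M) (fun k =>
      ((hsmooth k).continuous.sub hu.continuous).aestronglyMeasurable) (fun k => hae ?_) (hae ?_)
    · intro x hx
      rw [e, norm_mul, Complex.norm_real, Real.norm_eq_abs]
      calc _ ≤ 1 * M := mul_le_mul (abs_cutoff_sub_one_le _) (hM x hx) (norm_nonneg _) zero_le_one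
        _ = M := one_mul M
    · intro x hx
      refine tendsto_const_nhds.congr' ?_
      filter_upwards [hlarge x hx] with k hk
      rw [e]
      simp [hh, cutoff_of_ge hk.le]
  · obtain ⟨M, hM⟩ := exists_bound_on_disk (contDiff_magneticGradient hu B j).continuous R
    obtain ⟨K, hK⟩ := exists_abs_deriv_cutoff_mul_le
    -- M bounds the gradient of u. The second term bounds the derivative of the cutoff times u: K
    -- controls cutoff'(t)·t with t = (k+1)(R² - |x|²), R controls the coordinate, and C comes from
    -- the first-order vanishing of u.
    refine tendsto_eLpNorm_two_of_bounded (C := M + 2 * (K * R * |C|)) (fun k =>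
      ((contDiff_magneticGradient (hsmooth k) B j).continuous.sub
        (contDiff_magneticGradient hu B j).continuous).aestronglyMeasurable)
        (fun k => hae ?_) (hae ?_)
    · intro x hx
      rw [hgrad]
      refine (norm_add_le _ _).trans (add_le_add ?_ ?_)
      · rw [norm_mul, Complex.norm_real, Real.norm_eq_abs]
        calc _ ≤ 1 * M := mul_le_mul (abs_cutoff_sub_one_le _) (hM x hx) (norm_nonneg _) zero_le_one
          _ = M := one_mul M
      · have hpos : 0 < R ^ 2 - Complex.normSq x := by linarith [(mem_disk_iff hR).1 hx]
        have hxR : ‖x‖ ≤ R := (mem_ball_zero_iff.1 hx).le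
        have hu' : ‖u x‖ ≤ |C| * (R ^ 2 - Complex.normSq x) :=
          (hC x hx).trans (mul_le_mul_of_nonneg_right (le_abs_self C) hpos.le)
        have hK' := hK (((k : ℝ) + 1) * (R ^ 2 - Complex.normSq x))
        rw [norm_mul, norm_mul, norm_mul, Complex.norm_real, Complex.norm_I, Real.norm_eq_abs,
          abs_mul, Complex.norm_ofNat, mul_one, mul_assoc]
        refine mul_le_mul_of_nonneg_left ?_ zero_le_two
        set D := deriv cutoff (((k : ℝ) + 1) * (R ^ 2 - Complex.normSq x))
        calc |D * (k + 1)| * |coord j x| * ‖u x‖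
            ≤ |D * (k + 1)| * R * (|C| * (R ^ 2 - Complex.normSq x)) := by
              gcongr
              exact (abs_coord_le_norm j x).trans hxR
          _ = |D * ((k + 1) * (R ^ 2 - Complex.normSq x))| * R * |C| := by
              rw [← mul_assoc D, abs_mul (D * _) (R ^ 2 - Complex.normSq x), abs_of_pos hpos]; ring
          _ ≤ K * R * |C| := by gcongr
    · intro x hx
      refine tendsto_const_nhds.congr' ?_
      filter_upwards [hlarge x hx] with k hk
      rw [hgrad]
      simp [hh, cutoff_of_ge hk.le, deriv_cutoff_of_gt hk]

theorem magneticLaplacianEq_of_contDiff {R : ℝ} (hR : 0 < R) (B : ℝ) {u : ℂ → ℂ}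
    (hu : ContDiff ℝ ∞ u) {C : ℝ} (hC : ∀ x ∈ disk R, ‖u x‖ ≤ C * (R ^ 2 - Complex.normSq x)) :
    MagneticLaplacianEq (disk R) B u (magneticLaplacian B u) :=
  ⟨memLp_two_of_continuous (contDiff_magneticLaplacian hu B).continuous R, _,
    inFormDomain_of_contDiff hR B hu hC, fun _ hφ => setIntegral_magneticGradient hu hφ B⟩

/-! ### Extension of the weak equation to smooth functions vanishing on the circle. -/

theorem integrable_mul_conj {α : Type*} [MeasurableSpace α] {μ : Measure α} {f g : α → ℂ}
    (hf : MemLp f 2 μ) (hg : MemLp g 2 μ) :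
    Integrable (fun x => f x * (starRingEnd ℂ) (g x)) μ :=
  hf.integrable_mul hg.star

theorem tendsto_integral_mul_conj {α : Type*} [MeasurableSpace α] {μ : Measure α}
    {f : ℕ → α → ℂ} {f₀ g : α → ℂ} (hf : ∀ n, MemLp (f n) 2 μ) (hf₀ : MemLp f₀ 2 μ)
    (hg : MemLp g 2 μ) (hlim : Tendsto (fun n => eLpNorm (fun x => f n x - f₀ x) 2 μ) atTop (𝓝 0)) :
    Tendsto (fun n => ∫ x, f n x * (starRingEnd ℂ) (g x) ∂μ) atTop
      (𝓝 (∫ x, f₀ x * (starRingEnd ℂ) (g x) ∂μ)) := by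
  refine tendsto_integral_of_L1' _ (integrable_mul_conj hf₀ hg).1
    (Eventually.of_forall fun n => integrable_mul_conj (hf n) hg) ?_
  have hmul := ENNReal.Tendsto.mul_const (b := eLpNorm g 2 μ) hlim (Or.inr hg.2.ne)
  rw [zero_mul] at hmul
  refine tendsto_of_tendsto_of_tendsto_of_le_of_le tendsto_const_nhds hmul
    (fun _ => zero_le) fun n => ?_
  have h := eLpNorm_smul_le_mul_eLpNorm (p := 2) (q := 2) (r := 1) hg.star.1 ((hf n).sub hf₀).1
  have e1 : eLpNorm (star g) 2 μ = eLpNorm g 2 μ := eLpNorm_congr_norm_ae (by simp)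
  rw [e1] at h
  refine le_trans (le_of_eq ?_) h
  congr 1
  funext x
  simp [sub_mul]

theorem tendsto_integral_conj_mul {α : Type*} [MeasurableSpace α] {μ : Measure α}
    {f : ℕ → α → ℂ} {f₀ g : α → ℂ} (hf : ∀ n, MemLp (f n) 2 μ) (hf₀ : MemLp f₀ 2 μ)
    (hg : MemLp g 2 μ) (hlim : Tendsto (fun n => eLpNorm (fun x => f n x - f₀ x) 2 μ) atTop (𝓝 0)) :
    Tendsto (fun n => ∫ x, g x * (starRingEnd ℂ) (f n x) ∂μ) atTop
      (𝓝 (∫ x, g x * (starRingEnd ℂ) (f₀ x) ∂μ)) := by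
  have h := (Complex.continuous_conj.tendsto _).comp (tendsto_integral_mul_conj hf hf₀ hg hlim)
  have e : ∀ v : α → ℂ, (starRingEnd ℂ) (∫ x, v x * (starRingEnd ℂ) (g x) ∂μ) =
      ∫ x, g x * (starRingEnd ℂ) (v x) ∂μ := by
    intro v
    rw [← integral_conj]
    refine integral_congr_ae (Eventually.of_forall fun x => ?_)
    simp [mul_comm]
  rw [e] at h
  exact h.congr fun n => e _

/-- The weak equation may be tested with smooth functions vanishing on the boundary, and all
derivatives put on the test function. -/
theorem MagneticLaplacianEq.setIntegral_eq {R B : ℝ} (hR : 0 < R) {ψ f u : ℂ → ℂ}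
    (h : MagneticLaplacianEq (disk R) B ψ f) (hu : ContDiff ℝ ∞ u) {C : ℝ}
    (hC : ∀ x ∈ disk R, ‖u x‖ ≤ C * (R ^ 2 - Complex.normSq x)) :
    ∫ x in disk R, f x * (starRingEnd ℂ) (u x) =
      ∫ x in disk R, ψ x * (starRingEnd ℂ) (magneticLaplacian B u x) := by
  obtain ⟨hf, g, ⟨hψ, hg, φ, hφ, hφψ, hφg⟩, hweak⟩ := h
  obtain ⟨hu2, hDu2, w, hw, hwu, hwD⟩ := inFormDomain_of_contDiff hR B hu hC
  have hL : ∀ {v : ℂ → ℂ}, IsTestFunction (disk R) v → MemLp v 2 (volume.restrict (disk R)) :=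
    fun hv => memLp_two_of_continuous hv.1.continuous R
  have hLD : ∀ {v : ℂ → ℂ}, IsTestFunction (disk R) v → ∀ j,
      MemLp (magneticGradient B v j) 2 (volume.restrict (disk R)) :=
    fun hv j => memLp_two_of_continuous (contDiff_magneticGradient hv.1 B j).continuous R
  -- Here u is approximated by test functions, for which the weak equation holds.
  have h1 : ∫ x in disk R, ∑ j, g j x * (starRingEnd ℂ) (magneticGradient B u j x) =
      ∫ x in disk R, f x * (starRingEnd ℂ) (u x) := by
    have t1 := tendsto_finsetSum (Finset.univ : Finset (Fin 2)) fun j _ =>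
      tendsto_integral_conj_mul (fun n => hLD (hw n) j) (hDu2 j) (hg j) (hwD j)
    have t2 := tendsto_integral_conj_mul (fun n => hL (hw n)) hu2 hf hwu
    rw [integral_finsetSum _ fun j _ => integrable_mul_conj (hg j) (hDu2 j)]
    refine tendsto_nhds_unique t1 (t2.congr fun n => ?_)
    rw [← hweak (w n) (hw n),
      integral_finsetSum _ fun j _ => integrable_mul_conj (hg j) (hLD (hw n) j)]
  -- Here ψ is approximated by test functions, so that u can be integrated by parts without boundary
  -- terms.
  have h2 : ∫ x in disk R, ∑ j, g j x * (starRingEnd ℂ) (magneticGradient B u j x) =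
      ∫ x in disk R, ψ x * (starRingEnd ℂ) (magneticLaplacian B u x) := by
    have hLap := memLp_two_of_continuous (contDiff_magneticLaplacian hu B).continuous R
    have t1 := tendsto_finsetSum (Finset.univ : Finset (Fin 2)) fun j _ =>
      tendsto_integral_mul_conj (fun n => hLD (hφ n) j) (hg j) (hDu2 j) (hφg j)
    have t2 := tendsto_integral_mul_conj (fun n => hL (hφ n)) hψ hLap hφψ
    rw [integral_finsetSum _ fun j _ => integrable_mul_conj (hg j) (hDu2 j)]
    refine tendsto_nhds_unique t1 (t2.congr fun n => ?_)
    have e := congrArg (starRingEnd ℂ) (setIntegral_magneticGradient hu (hφ n) B)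
    rw [← integral_conj, ← integral_conj] at e
    rw [← integral_finsetSum _ fun j _ => integrable_mul_conj (hLD (hφ n) j) (hDu2 j)]
    simp only [map_sum, map_mul, Complex.conj_conj] at e
    simp only [mul_comm] at e ⊢
    exact e.symm
  rw [← h1, h2]


/-! ### Radial functions with vanishing moments -/

theorem integrableOn_comp_polarCoord_symm {f : ℂ → ℂ} (hf : Integrable f) :
    IntegrableOn (fun p : ℝ × ℝ => p.1 • f (Complex.polarCoord.symm p)) polarCoord.target := by
  have hF : Integrable (fun q : ℝ × ℝ => f (Complex.measurableEquivRealProd.symm q)) :=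
    ((Complex.volume_preserving_equiv_real_prod.symm).integrable_comp_emb
      Complex.measurableEquivRealProd.symm.measurableEmbedding).2 hf
  have h := (integrableOn_image_iff_integrableOn_abs_det_fderiv_smul volume
    polarCoord.open_target.measurableSet
    (fun p _ => (hasFDerivAt_polarCoord_symm p).hasFDerivWithinAt)
    polarCoord.symm.injOn
    (fun q : ℝ × ℝ => f (Complex.measurableEquivRealProd.symm q))).1 hF.integrableOn
  refine h.congr_fun (fun p hp => ?_) polarCoord.open_target.measurableSet
  have hp1 : 0 < p.1 := hp.1
  simp only [det_fderivPolarCoordSymm, abs_of_pos hp1]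
  rfl

theorem mem_disk_polarCoord_symm {R : ℝ} {p : ℝ × ℝ} (hp : p ∈ polarCoord.target) :
    Complex.polarCoord.symm p ∈ disk R ↔ p.1 < R := by
  have hp1 : 0 < p.1 := hp.1
  rw [disk, mem_ball_zero_iff, Complex.norm_polarCoord_symm, abs_of_pos hp1]

theorem norm_polarCoord_symm_of_mem {p : ℝ × ℝ} (hp : p ∈ polarCoord.target) :
    ‖Complex.polarCoord.symm p‖ = p.1 := by
  have hp1 : 0 < p.1 := hp.1
  rw [Complex.norm_polarCoord_symm, abs_of_pos hp1]

section Radial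

variable {R : ℝ} {G : ℂ → ℂ} {κ : ℝ → ℂ}

theorem polar_indicator_eq (hκ : ∀ x ∈ disk R, x ≠ 0 → G x = κ ‖x‖) (q : ℝ → ℂ) {p : ℝ × ℝ}
    (hp : p ∈ polarCoord.target) :
    (disk R).indicator (fun x => G x * q (Complex.normSq x)) (Complex.polarCoord.symm p) =
      if p.1 < R then κ p.1 * q (p.1 ^ 2) else 0 := by
  have hp1 : 0 < p.1 := hp.1
  have hn := norm_polarCoord_symm_of_mem hp
  split_ifs with h
  · have hmem := (mem_disk_polarCoord_symm (R := R) hp).2 h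
    have hne : Complex.polarCoord.symm p ≠ 0 := by
      intro h0
      rw [h0, norm_zero] at hn
      exact hp1.ne hn
    rw [Set.indicator_of_mem hmem, hκ _ hmem hne, Complex.normSq_eq_norm_sq, hn]
  · exact Set.indicator_of_notMem (fun hmem => h ((mem_disk_polarCoord_symm hp).1 hmem)) _

theorem subset_polarCoord_target (R : ℝ) :
    Set.Ioo 0 R ×ˢ Set.Ioo (-Real.pi) Real.pi ⊆ polarCoord.target :=
  Set.prod_mono (fun _ h => h.1) subset_rfl

/-- By Fubini almost every slice at a fixed angle is integrable, and the integrand does not depend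
on the angle, so one slice suffices. -/
theorem integrableOn_radial (hG : IntegrableOn G (disk R))
    (hκ : ∀ x ∈ disk R, x ≠ 0 → G x = κ ‖x‖) :
    IntegrableOn (fun r : ℝ => (r : ℂ) * κ r) (Set.Ioo 0 R) := by
  have h := integrableOn_comp_polarCoord_symm
    ((integrable_indicator_iff (measurableSet_disk R)).2 hG)
  have h2 : IntegrableOn (fun p : ℝ × ℝ => (p.1 : ℂ) * κ p.1)
      (Set.Ioo 0 R ×ˢ Set.Ioo (-Real.pi) Real.pi) := by
    refine (h.mono_set (subset_polarCoord_target R)).congr_fun (fun p hp => ?_)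
      (measurableSet_Ioo.prod measurableSet_Ioo)
    have e := polar_indicator_eq hκ (fun _ => 1) (subset_polarCoord_target R hp)
    have hpR : p.1 < R := hp.1.2
    simp only [mul_one, hpR, if_true] at e
    simp only [e, Complex.real_smul]
  rw [IntegrableOn, Measure.volume_eq_prod, ← Measure.prod_restrict] at h2
  have hne : volume.restrict (Set.Ioo (-Real.pi) Real.pi) ≠ 0 := by
    rw [Ne, Measure.restrict_eq_zero, Real.volume_Ioo]
    simp [Real.pi_pos]
  have : (ae (volume.restrict (Set.Ioo (-Real.pi) Real.pi))).NeBot := ae_neBot.2 hne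
  obtain ⟨θ, hθ⟩ := h2.prod_left_ae.exists
  exact hθ

theorem setIntegral_radial (hκ : ∀ x ∈ disk R, x ≠ 0 → G x = κ ‖x‖) (q : ℝ → ℂ) :
    ∫ x in disk R, G x * q (Complex.normSq x) =
      (∫ r in Set.Ioo 0 R, (r : ℂ) * κ r * q (r ^ 2)) * (2 * Real.pi : ℝ) := by
  rw [← integral_indicator (measurableSet_disk R), ← Complex.integral_comp_polarCoord_symm,
    setIntegral_eq_of_subset_of_forall_sdiff_eq_zero polarCoord.open_target.measurableSet
      (subset_polarCoord_target R)]
  · have h := setIntegral_prod_mul (μ := (volume : Measure ℝ)) (ν := (volume : Measure ℝ))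
      (fun r : ℝ => (r : ℂ) * κ r * q (r ^ 2)) (fun _ : ℝ => (1 : ℂ))
      (Set.Ioo 0 R) (Set.Ioo (-Real.pi) Real.pi)
    have hpi : ∫ _ in Set.Ioo (-Real.pi) Real.pi, (1 : ℂ) = (2 * Real.pi : ℝ) := by
      rw [setIntegral_const, Measure.real, Real.volume_Ioo,
        ENNReal.toReal_ofReal (by linarith [Real.pi_pos])]
      simp
      ring
    rw [hpi] at h
    rw [← h, Measure.volume_eq_prod]
    refine setIntegral_congr_fun (measurableSet_Ioo.prod measurableSet_Ioo) fun p hp => ?_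
    have e := polar_indicator_eq hκ q (subset_polarCoord_target R hp)
    have hpR : p.1 < R := hp.1.2
    simp only [hpR, if_true] at e
    simp only [e, Complex.real_smul, mul_one, mul_assoc]
  · intro p hp
    rw [polar_indicator_eq hκ q hp.1]
    have : ¬ p.1 < R := fun h => hp.2 ⟨⟨hp.1.1, h⟩, hp.1.2⟩
    simp [this]

/-- An integrable radial function on the disk all of whose moments vanish is zero. -/
theorem ae_eq_zero_of_moments_eq_zero (hG : IntegrableOn G (disk R))
    (hκ : ∀ x ∈ disk R, x ≠ 0 → G x = κ ‖x‖)
    (hmom : ∀ k : ℕ, ∫ x in disk R, G x * ((Complex.normSq x : ℂ)) ^ k = 0) :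
    G =ᵐ[volume.restrict (disk R)] 0 := by
  have hint := integrableOn_radial hG hκ
  have hpow : ∀ k : ℕ, ∫ r in Set.Ioo 0 R, (r : ℂ) * κ r * ((r ^ 2 : ℝ) : ℂ) ^ k = 0 := by
    intro k
    have h := setIntegral_radial hκ fun t => (t : ℂ) ^ k
    rw [hmom k] at h
    refine (mul_eq_zero.1 h.symm).resolve_right ?_
    exact_mod_cast (mul_pos two_pos Real.pi_pos).ne'
  have hbd : ∀ {q : ℝ → ℝ}, ContinuousOn q (Set.Icc 0 R) →
      IntegrableOn (fun r : ℝ => (r : ℂ) * κ r * (q r : ℂ)) (Set.Ioo 0 R) := by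
    intro q hq
    obtain ⟨C, hC⟩ := isCompact_Icc.exists_bound_of_continuousOn hq
    refine hint.mul_bdd (c := C) ?_ ?_
    · exact (Complex.continuous_ofReal.comp_continuousOn
        (hq.mono Set.Ioo_subset_Icc_self)).aestronglyMeasurable measurableSet_Ioo
    · refine (ae_restrict_iff' measurableSet_Ioo).2 (Eventually.of_forall fun r hr => ?_)
      rw [Complex.norm_real]
      exact hC r (Set.Ioo_subset_Icc_self hr)
  have hpoly : ∀ p : Polynomial ℝ,
      ∫ r in Set.Ioo 0 R, (r : ℂ) * κ r * ((p.eval (r ^ 2) : ℝ) : ℂ) = 0 := by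
    intro p
    induction p using Polynomial.induction_on' with
    | add p q hp hq =>
      simp only [Polynomial.eval_add, Complex.ofReal_add, mul_add]
      rw [integral_add (hbd (by fun_prop)) (hbd (by fun_prop)), hp, hq, add_zero]
    | monomial k c =>
      have e : ∀ r : ℝ, (r : ℂ) * κ r * ((((Polynomial.monomial k) c).eval (r ^ 2) : ℝ) : ℂ) =
          c * ((r : ℂ) * κ r * ((r ^ 2 : ℝ) : ℂ) ^ k) := by
        intro r
        rw [Polynomial.eval_monomial]
        push_cast
        ring
      simp_rw [e]
      rw [integral_const_mul, hpow, mul_zero]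
  -- Only polynomials in r² are available, so Weierstrass' theorem is applied to t ↦ g(√t) on [0,
  -- R²].
  have hsmooth : ∀ g : ℝ → ℝ, Continuous g →
      ∫ r in Set.Ioo 0 R, (r : ℂ) * κ r * (g r : ℂ) = 0 := by
    intro g hg
    rw [← norm_le_zero_iff]
    refine le_of_forall_pos_le_add fun ε hε => ?_
    set I := ∫ r in Set.Ioo 0 R, ‖(r : ℂ) * κ r‖ with hI
    obtain ⟨p, hp⟩ := exists_polynomial_near_of_continuousOn 0 (R ^ 2) (fun t => g (√t))
      (hg.comp Real.continuous_sqrt).continuousOn (ε / (I + 1)) (by positivity)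
    have e : ∫ r in Set.Ioo 0 R, (r : ℂ) * κ r * (g r : ℂ) =
        ∫ r in Set.Ioo 0 R, (r : ℂ) * κ r * ((g r - p.eval (r ^ 2) : ℝ) : ℂ) := by
      simp only [Complex.ofReal_sub, mul_sub]
      rw [integral_sub (hbd hg.continuousOn) (hbd (by fun_prop)), hpoly p, sub_zero]
    rw [e, zero_add]
    calc _ ≤ ∫ r in Set.Ioo 0 R, ‖(r : ℂ) * κ r‖ * (ε / (I + 1)) := by
          refine norm_integral_le_of_norm_le (hint.norm.mul_const _)
            ((ae_restrict_iff' measurableSet_Ioo).2 (Eventually.of_forall fun r hr => ?_))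
          rw [norm_mul]
          refine mul_le_mul_of_nonneg_left ?_ (norm_nonneg _)
          rw [Complex.norm_real, Real.norm_eq_abs, abs_sub_comm]
          have := hp (r ^ 2) ⟨sq_nonneg r, by
            have := hr.1; have := hr.2; gcongr⟩
          rw [Real.sqrt_sq hr.1.le] at this
          exact this.le
      _ = I * (ε / (I + 1)) := by rw [integral_mul_const]
      _ ≤ ε := by
          rw [← mul_div_assoc, div_le_iff₀ (by positivity)]
          nlinarith
  -- The fundamental lemma of the calculus of variations on (0, R); polar coordinates then carry the
  -- result back to the disk.
  have hzero : ∀ᵐ r : ℝ, r ∈ Set.Ioo 0 R → (r : ℂ) * κ r = 0 := by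
    refine isOpen_Ioo.ae_eq_zero_of_integral_contDiff_smul_eq_zero hint.locallyIntegrableOn
      fun g hg _ hsupp => ?_
    have e : ∫ r, g r • ((r : ℂ) * κ r) = ∫ r in Set.Ioo 0 R, g r • ((r : ℂ) * κ r) := by
      refine (setIntegral_eq_integral_of_forall_compl_eq_zero fun r hr => ?_).symm
      rw [image_eq_zero_of_notMem_tsupport fun h => hr (hsupp h), zero_smul]
    rw [e, ← hsmooth g hg.continuous]
    refine setIntegral_congr_fun measurableSet_Ioo fun r _ => ?_
    simp only [Complex.real_smul]
    ring
  have hprod : ∀ᵐ p : ℝ × ℝ, p.1 ∈ Set.Ioo 0 R → (p.1 : ℂ) * κ p.1 = 0 :=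
    (Measure.quasiMeasurePreserving_fst (μ := (volume : Measure ℝ))
      (ν := (volume : Measure ℝ))).ae hzero
  have hlint : ∫⁻ x in disk R, ‖G x‖ₑ = 0 := by
    rw [← lintegral_indicator (measurableSet_disk R), ← Complex.lintegral_comp_polarCoord_symm]
    rw [lintegral_eq_zero_of_ae_eq_zero]
    refine (ae_restrict_iff' polarCoord.open_target.measurableSet).2 ?_
    filter_upwards [hprod] with p hp hmem
    have hp1 : 0 < p.1 := hmem.1
    have e := polar_indicator_eq hκ (fun _ => 1) hmem
    simp only [mul_one] at e
    have e2 : (disk R).indicator (fun x => ‖G x‖ₑ) (Complex.polarCoord.symm p) =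
        ‖(disk R).indicator G (Complex.polarCoord.symm p)‖ₑ := by
      rw [enorm_indicator_eq_indicator_enorm]
    have e3 : (disk R).indicator G (Complex.polarCoord.symm p) = 0 := by
      refine e.trans ?_
      split_ifs with h
      · exact (mul_eq_zero.1 (hp ⟨hp1, h⟩)).resolve_left (by exact_mod_cast hp1.ne')
      · rfl
    rw [e2, e3, enorm_zero, smul_zero, Pi.zero_apply]
  have h0 := (lintegral_eq_zero_iff' hG.aestronglyMeasurable.enorm).1 hlint
  filter_upwards [h0] with x hx
  simpa using hx

end Radial


/-! ### Functions of fixed angular momentum -/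

/-- The sign of the angular momentum, `1` if it vanishes. -/
def angularSign (l : ℤ) : ℝ := if 0 ≤ l then 1 else -1

/-- `x` or `x̄`, according to the sign of the angular momentum. -/
def angularCLM (l : ℤ) : ℂ →L[ℝ] ℂ :=
  if 0 ≤ l then ContinuousLinearMap.id ℝ ℂ else Complex.conjCLE.toContinuousLinearMap

/-- The function `|x|^|l| e^{ilθ} e^{-B|x|²/4} y(B|x|²/2)`. -/
def angularProfile (l : ℤ) (B : ℝ) (y : ℝ → ℝ) (x : ℂ) : ℂ :=
  angularCLM l x ^ l.natAbs *
    ((Real.exp (-(B * Complex.normSq x / 4)) * y (B * Complex.normSq x / 2) : ℝ) : ℂ)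

theorem angularSign_sq (l : ℤ) : angularSign l ^ 2 = 1 := by
  unfold angularSign; split_ifs <;> norm_num

theorem angularSign_mul_natAbs (l : ℤ) : angularSign l * l.natAbs = l := by
  unfold angularSign
  split_ifs with h
  · rw [one_mul, ← Int.cast_natCast, Int.natAbs_of_nonneg h]
  · have : ((l.natAbs : ℤ) : ℝ) = ((-l : ℤ) : ℝ) := by
      rw [Int.ofNat_natAbs_of_nonpos (by omega)]
    rw [← Int.cast_natCast, this]
    push_cast
    ring

theorem angularCLM_one (l : ℤ) : angularCLM l 1 = 1 := by
  unfold angularCLM; split_ifs <;> simp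

theorem angularCLM_I (l : ℤ) : angularCLM l Complex.I = angularSign l * Complex.I := by
  unfold angularCLM angularSign; split_ifs <;> simp

theorem norm_angularCLM (l : ℤ) (x : ℂ) : ‖angularCLM l x‖ = ‖x‖ := by
  unfold angularCLM; split_ifs <;> simp

theorem angularCLM_ofReal_mul_exp_pow (l : ℤ) (r θ : ℝ) :
    angularCLM l (r * Complex.exp (θ * Complex.I)) ^ l.natAbs =
      r ^ l.natAbs * Complex.exp (l * θ * Complex.I) := by
  have h : angularCLM l (r * Complex.exp (θ * Complex.I)) =
      r * Complex.exp (angularSign l * (θ * Complex.I)) := by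
    unfold angularCLM angularSign
    split_ifs
    · simp
    · simp [← Complex.exp_conj]
  have e : ((l : ℤ) : ℂ) = ((angularSign l * l.natAbs : ℝ) : ℂ) := by
    rw [angularSign_mul_natAbs]; simp
  rw [h, mul_pow, ← Complex.exp_nat_mul, e]
  congr 2
  push_cast
  ring

theorem contDiff_angularProfile (l : ℤ) (B : ℝ) {y : ℝ → ℝ} (hy : ContDiff ℝ ∞ y) :
    ContDiff ℝ ∞ (angularProfile l B y) := by
  have h1 : ContDiff ℝ ∞ fun x : ℂ =>
      Real.exp (-(B * Complex.normSq x / 4)) * y (B * Complex.normSq x / 2) :=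
    (((contDiff_const.mul contDiff_normSq).div_const 4).neg.exp).mul
      (hy.comp ((contDiff_const.mul contDiff_normSq).div_const 2))
  exact ((angularCLM l).contDiff.pow _).mul (Complex.ofRealCLM.contDiff.comp h1)

theorem angularProfile_add_mul (l : ℤ) (B c₁ c₂ : ℝ) (y₁ y₂ : ℝ → ℝ) (x : ℂ) :
    angularProfile l B (fun s => c₁ * y₁ s + c₂ * y₂ s) x =
      c₁ * angularProfile l B y₁ x + c₂ * angularProfile l B y₂ x := by
  simp only [angularProfile]
  push_cast
  ring

theorem hasAngularMomentum_angularProfile (R : ℝ) (l : ℤ) (B : ℝ) (y : ℝ → ℝ) :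
    HasAngularMomentum R l (angularProfile l B y) := by
  refine ⟨fun r => r ^ l.natAbs *
    ((Real.exp (-(B * r ^ 2 / 4)) * y (B * r ^ 2 / 2) : ℝ) : ℂ), fun r hr _ θ => ?_⟩
  have hn : Complex.normSq (r * Complex.exp (θ * Complex.I)) = r ^ 2 := by
    rw [Complex.normSq_eq_norm_sq, norm_mul, Complex.norm_exp_ofReal_mul_I, Complex.norm_real,
      mul_one, Real.norm_eq_abs, sq_abs]
  rw [angularProfile, angularCLM_ofReal_mul_exp_pow, hn]
  ring

/-- On functions of angular momentum `l` the magnetic Laplacian acts as Kummer's operator. -/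
theorem magneticLaplacian_angularProfile (l : ℤ) (B : ℝ) {y y' y'' : ℝ → ℝ}
    (hy : ∀ t, HasDerivAt y (y' t) t) (hy' : ∀ t, HasDerivAt y' (y'' t) t) (x : ℂ) :
    magneticLaplacian B (angularProfile l B y) x =
      angularProfile l B (fun s => -2 * B * (s * y'' s + ((l.natAbs : ℝ) + 1 - s) * y' s -
        (((l.natAbs : ℝ) + 1 + l) / 2) * y s)) x := by
  set E : ℝ → ℝ := fun t => Real.exp (-(B * t / 4)) with hE
  have hEd : ∀ t, HasDerivAt E (E t * (-(B / 4))) t := by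
    intro t
    have h1 : HasDerivAt (fun t : ℝ => -(B * t / 4)) (-(B / 4)) t := by
      simpa using (((hasDerivAt_id t).const_mul B).div_const 4).fun_neg
    exact h1.exp
  have hlin : ∀ t, HasDerivAt (fun t : ℝ => B * t / 2) (B / 2) t := by
    intro t
    simpa using ((hasDerivAt_id t).const_mul B).div_const 2
  have hyc : ∀ t, HasDerivAt (fun t : ℝ => y (B * t / 2)) (y' (B * t / 2) * (B / 2)) t :=
    fun t => (hy _).comp t (hlin t)
  have hyc' : ∀ t, HasDerivAt (fun t : ℝ => y' (B * t / 2)) (y'' (B * t / 2) * (B / 2)) t :=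
    fun t => (hy' _).comp t (hlin t)
  have hh : ∀ t, HasDerivAt (fun t => E t * y (B * t / 2))
      (E t * (B / 2 * (y' (B * t / 2) - y (B * t / 2) / 2))) t := fun t =>
    ((hEd t).mul (hyc t)).congr_deriv (by ring)
  have hh' : ∀ t, HasDerivAt (fun t => E t * (B / 2 * (y' (B * t / 2) - y (B * t / 2) / 2)))
      (E t * (B ^ 2 / 4 * (y'' (B * t / 2) - y' (B * t / 2) + y (B * t / 2) / 4))) t := fun t =>
    ((hEd t).mul (((hyc' t).fun_sub ((hyc t).div_const 2)).const_mul (B / 2))).congr_deriv (by ring)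
  have h := magneticLaplacian_clm_pow_mul_radial B (angularSign_sq l) (angularCLM_one l)
    (angularCLM_I l) l.natAbs hh hh' x
  rw [angularSign_mul_natAbs] at h
  refine h.trans ?_
  simp only [angularProfile]
  congr 2
  simp only [hE]
  ring

/-- A bounded derivative and the zero at z give |y(s)| ≤ K(z - s), and z - s = (B/2)(R² - |x|²). -/
theorem exists_angularProfile_bound (l : ℤ) {R B : ℝ} (hR : 0 < R) (hB : 0 < B) {y : ℝ → ℝ}
    (hy : ContDiff ℝ ∞ y) (hy0 : y (B * R ^ 2 / 2) = 0) :
    ∃ C, ∀ x ∈ disk R, ‖angularProfile l B y x‖ ≤ C * (R ^ 2 - Complex.normSq x) := by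
  set z := B * R ^ 2 / 2 with hz
  have hz0 : 0 ≤ z := by positivity
  obtain ⟨K, hK⟩ := (isCompact_Icc (a := (0 : ℝ)) (b := z)).exists_bound_of_continuousOn
    (hy.continuous_deriv (by simp)).continuousOn
  have hlip : ∀ s ∈ Set.Icc 0 z, |y s| ≤ K * (z - s) := by
    intro s hs
    have := (convex_Icc (0 : ℝ) z).norm_image_sub_le_of_norm_deriv_le
      (fun t _ => (hy.differentiable (by simp)) t) hK ⟨hz0, le_rfl⟩ hs
    rw [hy0, sub_zero, Real.norm_eq_abs, Real.norm_eq_abs, abs_sub_comm,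
      abs_of_nonneg (by linarith [hs.2] : 0 ≤ z - s)] at this
    exact this
  refine ⟨R ^ l.natAbs * (K * (B / 2)), fun x hx => ?_⟩
  have hxR : ‖x‖ ≤ R := (mem_ball_zero_iff.1 hx).le
  have hns := (mem_disk_iff hR).1 hx
  have hn0 := Complex.normSq_nonneg x
  have hs : B * Complex.normSq x / 2 ∈ Set.Icc 0 z := by
    refine ⟨by positivity, ?_⟩
    rw [hz]
    gcongr
  have hyx := hlip _ hs
  rw [angularProfile, norm_mul, norm_pow, norm_angularCLM, Complex.norm_real, Real.norm_eq_abs,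
    abs_mul, abs_of_pos (Real.exp_pos _)]
  have hexp : Real.exp (-(B * Complex.normSq x / 4)) ≤ 1 := by
    rw [Real.exp_le_one_iff, neg_nonpos]; positivity
  calc ‖x‖ ^ l.natAbs * (Real.exp (-(B * Complex.normSq x / 4)) * |y (B * Complex.normSq x / 2)|)
      ≤ R ^ l.natAbs * (1 * (K * (z - B * Complex.normSq x / 2))) := by gcongr
    _ = _ := by rw [hz]; ring

/-! ### Eigenvalues of fixed angular momentum -/

theorem isEigenvalueWithMomentum_of_kummerM_eq_zero {R B : ℝ} (hR : 0 < R) (hB : 0 < B) (l : ℤ)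
    {a : ℝ} (ha : kummerM a ((l.natAbs : ℝ) + 1) (B * R ^ 2 / 2) = 0) :
    IsEigenvalueWithMomentum R B l (((l.natAbs : ℝ) + 1 + l - 2 * a) * B) := by
  have hb := one_le_natCast_add_one l.natAbs
  set y := kummerM a ((l.natAbs : ℝ) + 1) with hy
  have hsmooth := contDiff_angularProfile l B (contDiff_kummerM hb a)
  obtain ⟨C, hC⟩ := exists_angularProfile_bound l hR hB (contDiff_kummerM hb a) ha
  refine ⟨angularProfile l B y, ⟨?_, ?_⟩, hasAngularMomentum_angularProfile R l B y⟩
  · have h := magneticLaplacianEq_of_contDiff hR B hsmooth hC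
    have e : magneticLaplacian B (angularProfile l B y) = fun x =>
        ((((l.natAbs : ℝ) + 1 + l - 2 * a) * B : ℝ) : ℂ) * angularProfile l B y x := by
      funext x
      rw [magneticLaplacian_angularProfile l B (hasDerivAt_kummerM hb a) (hasDerivAt_kummerD hb a)]
      have e1 : (fun s => -2 * B * (s * (a / ((l.natAbs : ℝ) + 1) *
          kummerD (a + 1) ((l.natAbs : ℝ) + 1 + 1) s) + ((l.natAbs : ℝ) + 1 - s) *
          kummerD a ((l.natAbs : ℝ) + 1) s - (((l.natAbs : ℝ) + 1 + l) / 2) *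
          kummerM a ((l.natAbs : ℝ) + 1) s)) =
          fun s => (((l.natAbs : ℝ) + 1 + l - 2 * a) * B) * y s + 0 * y s := by
        funext s
        have := kummer_ode hb a s
        linear_combination (-2 * B) * this
      rw [e1, angularProfile_add_mul]
      simp
    rw [e] at h
    exact h
  · intro h0
    have heq : Set.EqOn (angularProfile l B y) 0 (disk R) :=
      Measure.eqOn_open_of_ae_eq h0 Metric.isOpen_ball hsmooth.continuous.continuousOn
        continuousOn_const
    -- If the function vanished, so would M on an interval (0, z), after division by the nonzero
    -- factors; letting r → 0 contradicts M(a,b,0) = 1.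
    have hy0 : ∀ r ∈ Set.Ioo 0 R, y (B * r ^ 2 / 2) = 0 := by
      intro r hr
      have hmem : (r : ℂ) ∈ disk R := by
        rw [disk, mem_ball_zero_iff, Complex.norm_real, Real.norm_eq_abs, abs_of_pos hr.1]
        exact hr.2
      have h1 := heq hmem
      have hr0 : angularCLM l (r : ℂ) ≠ 0 := by
        rw [← norm_pos_iff, norm_angularCLM, Complex.norm_real]
        exact norm_pos_iff.2 hr.1.ne'
      rw [angularProfile, Pi.zero_apply] at h1
      have h2 := (mul_eq_zero.1 h1).resolve_left (pow_ne_zero _ hr0)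
      have h3 := (mul_eq_zero.1 (Complex.ofReal_eq_zero.1 h2)).resolve_left (Real.exp_pos _).ne'
      rw [Complex.normSq_ofReal, ← sq] at h3
      exact h3
    have hc : Continuous fun r : ℝ => y (B * r ^ 2 / 2) :=
      (contDiff_kummerM hb a).continuous.comp (by fun_prop)
    have h1 := (hc.tendsto 0).mono_left (nhdsWithin_le_nhds (s := Set.Ioi 0))
    have h2 : Tendsto (fun r : ℝ => y (B * r ^ 2 / 2)) (𝓝[>] 0) (𝓝 0) := by
      refine tendsto_const_nhds.congr' ?_
      filter_upwards [Ioo_mem_nhdsGT hR] with r hr using (hy0 r hr).symm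
    have := tendsto_nhds_unique h1 h2
    simp [hy] at this

/-- A sequence of at most exponential growth with `(k+1)(k+b) μ_k = (k+1+a) μ_{k+1}` vanishes. -/
theorem eq_zero_of_moment_recursion {μ : ℕ → ℂ} {C z a b : ℝ} (hb : 1 ≤ b) (hz : 0 ≤ z)
    (hbound : ∀ k, ‖μ k‖ ≤ C * z ^ k)
    (hrec : ∀ k : ℕ, (((k + 1) * (k + b) : ℝ) : ℂ) * μ k = ((k + 1 + a : ℝ) : ℂ) * μ (k + 1))
    (k : ℕ) : μ k = 0 := by
  have hC : 0 ≤ C := by simpa using (norm_nonneg _).trans (hbound 0)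
  set A := (1 + |a|) * z with hA
  -- Since |k+1+a| ≤ (1+|a|)(k+1) and k + b ≥ k + 1, each use of the recursion bounds the k-th
  -- moment by (1+|a|)/(k+1) times the next. After N uses the factorial outweighs the exponential
  -- growth.
  have key : ∀ N k : ℕ, ‖μ k‖ ≤ C * z ^ k * A ^ N * (k.factorial / (k + N).factorial) := by
    intro N
    induction N with
    | zero =>
      intro k
      have : (k.factorial : ℝ) ≠ 0 := by positivity
      simpa [this] using hbound k
    | succ N ih =>
      intro k
      have hk0 : (0 : ℝ) ≤ k := by positivity
      have h1 := congrArg norm (hrec k)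
      rw [norm_mul, norm_mul, Complex.norm_real, Complex.norm_real, Real.norm_eq_abs,
        Real.norm_eq_abs, abs_of_pos (by positivity)] at h1
      have h2 : |(k : ℝ) + 1 + a| ≤ (1 + |a|) * (k + 1) := by
        rw [abs_le]
        have := neg_abs_le a
        have := le_abs_self a
        have := mul_nonneg (abs_nonneg a) hk0
        constructor <;> nlinarith
      have h3 : ((k : ℝ) + 1) * (k + 1) * ‖μ k‖ ≤
          (k + 1) * (k + 1) * (C * z ^ k * A ^ (N + 1) *
            (k.factorial / (k + (N + 1)).factorial)) := by
        calc ((k : ℝ) + 1) * (k + 1) * ‖μ k‖ ≤ (k + 1) * (k + b) * ‖μ k‖ := by gcongr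
          _ = |(k : ℝ) + 1 + a| * ‖μ (k + 1)‖ := h1
          _ ≤ (1 + |a|) * (k + 1) * (C * z ^ (k + 1) * A ^ N *
              ((k + 1).factorial / (k + 1 + N).factorial)) := by
            gcongr
            exact ih (k + 1)
          _ = _ := by
            rw [Nat.factorial_succ, show k + 1 + N = k + (N + 1) by ring, hA]
            push_cast
            ring
      exact le_of_mul_le_mul_left h3 (by positivity)
  have hlim : Tendsto (fun N : ℕ => C * z ^ k * k.factorial * (A ^ N / (N.factorial : ℝ))) atTop
      (𝓝 0) := by
    simpa using (FloorSemiring.tendsto_pow_div_factorial_atTop A).const_mul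
      (C * z ^ k * k.factorial)
  rw [← norm_le_zero_iff]
  refine ge_of_tendsto' hlim fun N => (key N k).trans ?_
  have h4 : (N.factorial : ℝ) ≤ (k + N).factorial := by
    exact_mod_cast Nat.factorial_le (by omega)
  calc C * z ^ k * A ^ N * (k.factorial / (k + N).factorial)
      ≤ C * z ^ k * A ^ N * (k.factorial / N.factorial) := by gcongr
    _ = _ := by ring

/-- The phase e^{ilθ} cancels against its conjugate. The origin is excluded because
`HasAngularMomentum` says nothing there. -/
theorem HasAngularMomentum.exists_radial {R : ℝ} {l : ℤ} {ψ : ℂ → ℂ}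
    (h : HasAngularMomentum R l ψ) (B : ℝ) :
    ∃ κ : ℝ → ℂ, ∀ x ∈ disk R, x ≠ 0 →
      ψ x * (starRingEnd ℂ) (angularProfile l B (fun _ => 1) x) = κ ‖x‖ := by
  obtain ⟨Z, hZ⟩ := h
  refine ⟨fun r => Z r * (r ^ l.natAbs * ((Real.exp (-(B * r ^ 2 / 4)) : ℝ) : ℂ)),
    fun x hx hx0 => ?_⟩
  have hr : 0 < ‖x‖ := norm_pos_iff.2 hx0
  have hrR : ‖x‖ < R := mem_ball_zero_iff.1 hx
  have hpolar : x = ‖x‖ * Complex.exp (Complex.arg x * Complex.I) :=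
    (Complex.norm_mul_exp_arg_mul_I x).symm
  have e1 : ψ x = Z ‖x‖ * Complex.exp (l * Complex.arg x * Complex.I) := by
    conv_lhs => rw [hpolar]
    exact hZ _ hr hrR _
  have e2 : angularCLM l x ^ l.natAbs = ‖x‖ ^ l.natAbs *
      Complex.exp (l * Complex.arg x * Complex.I) := by
    conv_lhs => rw [hpolar]
    exact angularCLM_ofReal_mul_exp_pow l _ _
  have e3 : Complex.exp (l * Complex.arg x * Complex.I) *
      (starRingEnd ℂ) (Complex.exp (l * Complex.arg x * Complex.I)) = 1 := by
    rw [← Complex.exp_conj, ← Complex.exp_add]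
    simp
  rw [angularProfile, e1, e2, Complex.normSq_eq_norm_sq, mul_one]
  simp only [map_mul, map_pow, Complex.conj_ofReal]
  linear_combination (Z ‖x‖ * (‖x‖ : ℂ) ^ l.natAbs *
    ((Real.exp (-(B * ‖x‖ ^ 2 / 4)) : ℝ) : ℂ)) * e3

/-- No regularity of ψ is used: all derivatives are put on the smooth test functions, and the weak
equation is turned into a recursion for the moments of ψ against |x|^|l| e^{ilθ} e^{-B|x|²/4} s^k, s
= B|x|²/2. If M(a,b,z) ≠ 0, all these moments vanish, and so does ψ. -/
theorem kummerM_eq_zero_of_isEigenvalueWithMomentum {R B : ℝ} (hR : 0 < R) (hB : 0 < B) {l : ℤ}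
    {lam : ℝ} (h : IsEigenvalueWithMomentum R B l lam) :
    kummerM (((l.natAbs : ℝ) + 1 + l - lam / B) / 2) ((l.natAbs : ℝ) + 1) (B * R ^ 2 / 2) = 0 := by
  by_contra hM
  obtain ⟨ψ, ⟨hψ, hne⟩, hang⟩ := h
  set b : ℝ := (l.natAbs : ℝ) + 1 with hbdef
  have hb : 1 ≤ b := one_le_natCast_add_one l.natAbs
  set a : ℝ := (b + l - lam / B) / 2 with ha
  set z : ℝ := B * R ^ 2 / 2 with hz
  have hz0 : 0 ≤ z := by positivity
  have hlam : lam = B * (b + l) - 2 * B * a := by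
    rw [ha]; field_simp; ring
  have hψ2 : MemLp ψ 2 (volume.restrict (disk R)) := by
    obtain ⟨-, g, hg, -⟩ := hψ
    exact hg.1
  set pw : ℕ → ℂ → ℂ := fun k => angularProfile l B fun s => s ^ k with hpw
  have hpwc : ∀ k, ContDiff ℝ ∞ (pw k) := fun k =>
    contDiff_angularProfile l B (contDiff_id.pow k)
  have hpw2 : ∀ k, MemLp (pw k) 2 (volume.restrict (disk R)) := fun k =>
    memLp_two_of_continuous (hpwc k).continuous R
  set μ : ℕ → ℂ := fun k => ∫ x in disk R, ψ x * (starRingEnd ℂ) (pw k x) with hμ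
  have hpw_eq : ∀ k x, pw k x = (((B * Complex.normSq x / 2) ^ k : ℝ) : ℂ) * pw 0 x := by
    intro k x
    simp only [hpw, angularProfile, pow_zero]
    push_cast
    ring
  have hrec : ∀ k : ℕ, (((k + 1) * (k + b) : ℝ) : ℂ) * μ k = ((k + 1 + a : ℝ) : ℂ) * μ (k + 1) := by
    intro k
    -- The multiple of M that makes s^{k+1} - cM vanish at s = z; this is where M(a,b,z) ≠ 0 enters.
    set c : ℝ := z ^ (k + 1) / kummerM a b z with hc
    set y : ℝ → ℝ := fun s => s ^ (k + 1) - c * kummerM a b s with hy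
    set y' : ℝ → ℝ := fun s => ((k + 1 : ℕ) : ℝ) * s ^ k - c * kummerD a b s with hy'
    set y'' : ℝ → ℝ := fun s => ((k + 1 : ℕ) : ℝ) * ((k : ℝ) * s ^ (k - 1)) -
      c * (a / b * kummerD (a + 1) (b + 1) s) with hy''
    have hyd : ∀ s, HasDerivAt y (y' s) s := fun s =>
      (hasDerivAt_pow (k + 1) s).sub ((hasDerivAt_kummerM hb a s).const_mul c)
    have hyd' : ∀ s, HasDerivAt y' (y'' s) s := fun s =>
      ((hasDerivAt_pow k s).const_mul _).sub ((hasDerivAt_kummerD hb a s).const_mul c)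
    have hysmooth : ContDiff ℝ ∞ y :=
      (contDiff_id.pow (k + 1)).sub (contDiff_const.mul (contDiff_kummerM hb a))
    have hyz : y z = 0 := by
      simp only [hy, hc]
      field_simp
      ring
    obtain ⟨C, hC⟩ := exists_angularProfile_bound l hR hB hysmooth hyz
    have htest := hψ.setIntegral_eq hR (contDiff_angularProfile l B hysmooth) hC
    -- Kummer's operator annihilates M and sends s^{k+1} to (k+1)(k+b)s^k - (k+1+a)s^{k+1}. The
    -- λ-terms cancel in the tested equation, and only this relation between two moments is left.
    have hpoint : ∀ x, magneticLaplacian B (angularProfile l B y) x =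
        lam * angularProfile l B y x + ((-2 * B : ℝ) : ℂ) *
          ((((k + 1) * (k + b) : ℝ) : ℂ) * pw k x - ((k + 1 + a : ℝ) : ℂ) * pw (k + 1) x) := by
      intro x
      rw [magneticLaplacian_angularProfile l B hyd hyd']
      have e1 : (fun s => -2 * B * (s * y'' s + ((l.natAbs : ℝ) + 1 - s) * y' s -
          (((l.natAbs : ℝ) + 1 + l) / 2) * y s)) = fun s => lam * y s + (-2 * B) *
          (fun s => ((k + 1) * (k + b)) * s ^ k + (-(k + 1 + a)) * s ^ (k + 1)) s := by
        funext s
        have hode := kummer_ode hb a s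
        have hk : (k : ℝ) * s ^ (k - 1) * s = k * s ^ k := by
          rcases k with _ | k
          · simp
          · rw [Nat.add_sub_cancel, pow_succ]; ring
        rw [← hbdef, hlam]
        simp only [hy, hy', hy'']
        push_cast
        linear_combination (2 * B * c) * hode - (2 * B * (k + 1)) * hk
      rw [e1, angularProfile_add_mul, angularProfile_add_mul]
      push_cast
      simp only [hpw]
      ring
    have i1 : Integrable (fun x => ψ x * (starRingEnd ℂ) (angularProfile l B y x))
        (volume.restrict (disk R)) := integrable_mul_conj hψ2
      (memLp_two_of_continuous (contDiff_angularProfile l B hysmooth).continuous R)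
    have ik : ∀ k, Integrable (fun x => ψ x * (starRingEnd ℂ) (pw k x))
        (volume.restrict (disk R)) := fun k => integrable_mul_conj hψ2 (hpw2 k)
    have e2 : ∀ x, ψ x * (starRingEnd ℂ) (magneticLaplacian B (angularProfile l B y) x) =
        lam * (ψ x * (starRingEnd ℂ) (angularProfile l B y x)) +
        ((-2 * B : ℝ) : ℂ) * ((((k + 1) * (k + b) : ℝ) : ℂ) * (ψ x * (starRingEnd ℂ) (pw k x)) -
          ((k + 1 + a : ℝ) : ℂ) * (ψ x * (starRingEnd ℂ) (pw (k + 1) x))) := by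
      intro x
      rw [hpoint]
      simp only [map_add, map_mul, map_sub, Complex.conj_ofReal]
      ring
    simp only [e2, mul_assoc] at htest
    have i2 : Integrable (fun x => (((k + 1) * (k + b) : ℝ) : ℂ) *
        (ψ x * (starRingEnd ℂ) (pw k x)) - ((k + 1 + a : ℝ) : ℂ) *
          (ψ x * (starRingEnd ℂ) (pw (k + 1) x))) (volume.restrict (disk R)) :=
      ((ik k).const_mul _).sub ((ik (k + 1)).const_mul _)
    rw [integral_add (i1.const_mul _) (i2.const_mul _), integral_const_mul,
      integral_const_mul,
      integral_sub ((ik k).const_mul _) ((ik (k + 1)).const_mul _), integral_const_mul,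
      integral_const_mul, left_eq_add] at htest
    have hB2 : ((-2 * B : ℝ) : ℂ) ≠ 0 := by
      exact_mod_cast (by nlinarith : -2 * B < 0).ne
    exact sub_eq_zero.1 ((mul_eq_zero.1 htest).resolve_left hB2)
  have hbound : ∀ k, ‖μ k‖ ≤ (∫ x in disk R, ‖ψ x * (starRingEnd ℂ) (pw 0 x)‖) * z ^ k := by
    intro k
    rw [← integral_mul_const]
    refine norm_integral_le_of_norm_le ((integrable_mul_conj hψ2 (hpw2 0)).norm.mul_const _)
      ((ae_restrict_iff' (measurableSet_disk R)).2 (Eventually.of_forall fun x hx => ?_))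
    have hn0 := Complex.normSq_nonneg x
    have hns := (mem_disk_iff hR).1 hx
    rw [hpw_eq, map_mul, Complex.conj_ofReal, mul_left_comm, norm_mul, mul_comm]
    refine mul_le_mul_of_nonneg_left ?_ (norm_nonneg _)
    rw [Complex.norm_real, Real.norm_eq_abs, abs_of_nonneg (by positivity), hz]
    gcongr
  have hμ0 := eq_zero_of_moment_recursion hb hz0 hbound hrec
  obtain ⟨κ, hκ⟩ := hang.exists_radial B
  have hzero := ae_eq_zero_of_moments_eq_zero
    (G := fun x => ψ x * (starRingEnd ℂ) (angularProfile l B (fun _ => 1) x))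
    (integrable_mul_conj hψ2 (by simpa [hpw] using hpw2 0)) hκ (by
      intro k
      have h1 := hμ0 k
      simp only [hμ] at h1
      have e : ∀ x, ψ x * (starRingEnd ℂ) (pw k x) = ((B / 2 : ℝ) : ℂ) ^ k *
          (ψ x * (starRingEnd ℂ) (angularProfile l B (fun _ => 1) x) *
            (Complex.normSq x : ℂ) ^ k) := by
        intro x
        rw [hpw_eq, map_mul, Complex.conj_ofReal]
        simp only [hpw, pow_zero]
        push_cast
        ring
      simp_rw [e] at h1
      rw [integral_const_mul] at h1
      refine (mul_eq_zero.1 h1).resolve_left (pow_ne_zero _ ?_)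
      exact_mod_cast (by positivity : B / 2 ≠ 0))
  refine hne ?_
  have hne0 : ∀ᵐ x ∂volume.restrict (disk R), x ≠ (0 : ℂ) :=
    ae_restrict_of_ae (Measure.ae_ne volume 0)
  filter_upwards [hzero, hne0] with x hx hx0
  refine (mul_eq_zero.1 hx).resolve_right ((map_ne_zero (starRingEnd ℂ)).2
    (mul_ne_zero (pow_ne_zero _ ?_) ?_))
  · rw [← norm_pos_iff, norm_angularCLM]
    exact norm_pos_iff.2 hx0
  · rw [mul_one]
    exact_mod_cast (Real.exp_pos _).ne'

end

end MagneticDisk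

/-! ### Assembly of the theorem. -/

theorem theorem2p1 (R : ℝ) (hR : 0 < R) (l : ℤ) :
    -- the branches are well defined and are exactly the eigenvalues of angular momentum `l`,
    -- in increasing order
    (∀ B : ℝ, 0 < B →
      (∀ m : ℕ, 1 ≤ m → MagneticDisk.IsKummerRoot (|(l : ℝ)| + 1) (B * R ^ 2 / 2) m
        (MagneticDisk.kummerRoot m (|(l : ℝ)| + 1) (B * R ^ 2 / 2))) ∧
      (∀ m : ℕ, 1 ≤ m →
        MagneticDisk.eigenvalueBranch R m l B < MagneticDisk.eigenvalueBranch R (m + 1) l B) ∧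
      (∀ lam : ℝ, MagneticDisk.IsEigenvalueWithMomentum R B l lam ↔
        ∃ m : ℕ, 1 ≤ m ∧ lam = MagneticDisk.eigenvalueBranch R m l B)) ∧
    ∀ m : ℕ, 1 ≤ m →
      -- the lower bound
      (∀ B : ℝ, 0 < B →
        MagneticDisk.eigenvalueBranch R m l B / B > (l : ℝ) + |(l : ℝ)| + 1 + 2 * ((m : ℝ) - 1)) ∧
      -- the asymptotics of the remainder
      ∃ e : ℝ → ℝ, e =O[atTop] (fun B : ℝ => 1 / B) ∧
        ∀ᶠ B : ℝ in atTop,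
          MagneticDisk.eigenvalueBranch R m l B / B
              - ((l : ℝ) + |(l : ℝ)| + 1 + 2 * ((m : ℝ) - 1)) =
            2 / (Real.Gamma (|(l : ℝ)| + m) * Real.Gamma m)
              * (B * R ^ 2 / 2) ^ (l.natAbs + 1 + 2 * (m - 1))
              * Real.exp (-(B * R ^ 2 / 2)) * (1 + e B) := by
  have habs : |(l : ℝ)| = (l.natAbs : ℝ) := by rw [Nat.cast_natAbs, Int.cast_abs]
  rw [habs]
  have hpos : ∀ B : ℝ, 0 < B → 0 < B * R ^ 2 / 2 := fun B hB => by positivity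
  have hdiv : ∀ (m : ℕ) (B : ℝ), 0 < B → MagneticDisk.eigenvalueBranch R m l B / B =
      (l : ℝ) + (l.natAbs : ℝ) + 1 -
        2 * MagneticDisk.kummerRoot m ((l.natAbs : ℝ) + 1) (B * R ^ 2 / 2) := by
    intro m B hB
    rw [MagneticDisk.eigenvalueBranch, habs, mul_div_cancel_right₀ _ hB.ne']
  have hroot : ∀ (m : ℕ) (B : ℝ), 0 < B → 1 ≤ m →
      MagneticDisk.IsKummerRoot ((l.natAbs : ℝ) + 1) (B * R ^ 2 / 2) m
        (MagneticDisk.kummerRoot m ((l.natAbs : ℝ) + 1) (B * R ^ 2 / 2)) :=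
    fun m B hB hm => MagneticDisk.isKummerRoot_kummerRoot l.natAbs (hpos B hB) hm
  refine ⟨fun B hB => ⟨fun m hm => hroot m B hB hm, fun m hm => ?_, fun lam => ⟨fun h => ?_, ?_⟩⟩,
    fun m hm => ⟨fun B hB => ?_, ?_⟩⟩
  · have h := (hroot m B hB hm).lt_of_succ (hroot (m + 1) B hB (by omega))
    rw [← div_lt_div_iff_of_pos_right hB, hdiv m B hB, hdiv (m + 1) B hB]
    linarith
  · have h0 := MagneticDisk.kummerM_eq_zero_of_isEigenvalueWithMomentum hR hB h
    obtain ⟨m, hm, hr⟩ := MagneticDisk.exists_isKummerRoot_of_eq_zero l.natAbs (hpos B hB) h0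
    have hu := hr.unique (hroot m B hB hm)
    refine ⟨m, hm, ?_⟩
    rw [← div_left_inj' hB.ne', hdiv m B hB, ← hu]
    ring
  · rintro ⟨m, hm, rfl⟩
    have h := MagneticDisk.isEigenvalueWithMomentum_of_kummerM_eq_zero hR hB l (hroot m B hB hm).1
    rwa [MagneticDisk.eigenvalueBranch, habs, add_comm (l : ℝ), add_right_comm]
  · obtain ⟨N, rfl⟩ := Nat.exists_eq_add_of_le' hm
    have h := (hroot (N + 1) B hB hm).lt_neg (hpos B hB)
    rw [hdiv _ B hB]
    push_cast
    linarith
  · obtain ⟨N, rfl⟩ := Nat.exists_eq_add_of_le' hm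
    obtain ⟨e, he, hasym⟩ := MagneticDisk.exists_kummerRoot_asymptotics l.natAbs N
    have hlim : Tendsto (fun B : ℝ => B * R ^ 2 / 2) atTop atTop := by
      simpa [mul_div_assoc] using
        tendsto_id.atTop_mul_const (show (0 : ℝ) < R ^ 2 / 2 by positivity)
    refine ⟨fun B => e (B * R ^ 2 / 2), (he.comp_tendsto hlim).trans ?_, ?_⟩
    -- With z = BR²/2 one has 1/z = (2/R²)(1/B), so errors O(1/z) are O(1/B) for fixed R.
    · refine (isBigO_const_mul_self (2 / R ^ 2) (fun B : ℝ => 1 / B) atTop).congr_left fun B => ?_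
      simp only [Function.comp_apply, one_div, inv_div]
      rw [div_mul_eq_div_div, ← div_eq_mul_inv, div_right_comm]
    · filter_upwards [hlim.eventually hasym, eventually_gt_atTop 0] with B hB hB0
      have hΓ₁ : Real.Gamma ((l.natAbs : ℝ) + ((N + 1 : ℕ) : ℝ)) =
          ((l.natAbs + N).factorial : ℝ) := by
        rw [← Real.Gamma_nat_eq_factorial]
        push_cast
        ring_nf
      have hΓ₂ : Real.Gamma ((N + 1 : ℕ) : ℝ) = (N.factorial : ℝ) := by
        rw [← Real.Gamma_nat_eq_factorial]
        push_cast
        rfl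
      rw [hΓ₁, hΓ₂, Nat.add_sub_cancel, ← hB, hdiv _ B hB0]
      push_cast
      ring
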